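/- Let $n\ge 1$ be an integer and $1\le p,q\le\infty$ (with $1/\infty=0$). For $k,l=1,\dots,n$ let $u_k$ and $v_l$ be the unitaries on $\ell_2^n$ given by $u_k(e_j)=e^{2\pi i kj/n}e_j$ and $v_l(e_j)=e_{l+j}$ (indices modulo $n$), and put $T_{k,l}=v_l u_{-k}$. Operator spaces: $S_\infty^n=M_n$ and $\ell_\infty^m$ carry their usual structures as $C^*$-algebras, and $S_1^n=(S_\infty^n)^*$, $\ell_1^m=(\ell_\infty^m)^*$ for the pairings $\langle B,C\rangle=\mathrm{tr}(BC^{t})$ and $\langle b,c\rangle=\sum_i b_ic_i$, where $M_k[F^*]=CB(F,M_k)$. By complex interpolation ($M_k[(F_0,F_1)_\theta]=(M_k[F_0],M_k[F_1])_\theta$) one sets $S_p^n=(S_\infty^n,S_1^n)_{1/p}$ and $\ell_p^m=(\ell_\infty^m,\ell_1^m)_{1/p}$. For an operator space $E$ (a complex Banach space with matrix norms satisfying Ruan's axioms), $S_p^n[E]=(S_\infty^n\otimes_{\min}E,\;S_1^n\widehat\otimes E)_{1/p}$ and $\ell_p^m[E]=(\ell_\infty^m\otimes_{\min}E,\;\ell_1^m\widehat\otimes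 E)_{1/p}$, where $\widehat\otimes$ is the operator space projective tensor product. Write $S_q^n(F)=S_q^n[F]$. Let $$J=J_{p,q}:M_n\to \ell_\infty^{n^2}\otimes M_n,\qquad J(\rho)=n^{1-\frac1p-\frac1q}\,\frac1n\sum_{k,l=1}^n e_{k,l}\otimes T_{k,l}\,\rho\, T_{k,l}^*.$$ Then $J$ is completely positive, and there is a completely positive linear map $W:\ell_\infty^{n^2}\otimes M_n\to M_n$ with $W\circ J=\mathrm{id}$ such that the following hold. 1. $J:S_p^n\to S_q^n(\ell_p^{n^2})$ is a complete isometry, $W:S_q^n(\ell_p^{n^2})\to S_p^n$ is a complete contraction, and $P=J\circ W$ is a completely positive and completely contractive projection of $S_q^n(\ell_p^{n^2})$ onto the range of $J$. Thus $S_p^n$ is completely isometric to a completely complemented subspace of $S_q^n(\ell_p^{n^2})$. 2. For every operator space $E$, $J\otimes \mathrm{id}_E:S_p^n[E]\to S_q^n(\ell_p^{n^2}[E])$ is a complete isometry, $W\otimes\mathrm{id}_E:S_q^n(\ell_p^{n^2}[E])\to S_p^n[E]$ is a complete contraction with $(W\otimes\mathrm{id}_E)\circ(J\otimes\mathrm{id}_E)=\mathrm{id}$,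 and $(J\otimes\mathrm{id}_E)\circ(W\otimes\mathrm{id}_E)$ is a completely contractive projection onto the range of $J\otimes\mathrm{id}_E$. -/

import Mathlib

open scoped ENNReal

noncomputable section

namespace OpSp

open scoped Matrix.Norms.L2Operator in
/-- The operator norm of a (possibly rectangular) complex matrix, as an operator between the
Hilbert spaces `ℓ₂`. -/
def opNorm {m n : Type} [Fintype m] [Fintype n] [DecidableEq n] (A : Matrix m n ℂ) : ℝ :=
  ‖A‖

/-- A family of matrix norms on `V`: for each `k`, a real-valued function on `M_k[V]`. -/
abbrev MatNorms (V : Type*) := (k : ℕ) → Matrix (Fin k) (Fin k) V → ℝ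

/-- The product `α w β` of a matrix `w` over `V` with scalar matrices. -/
def sandwich {V : Type*} [AddCommMonoid V] [Module ℂ V] {k l : ℕ} (α : Matrix (Fin k) (Fin l) ℂ)
    (w : Matrix (Fin l) (Fin l) V) (β : Matrix (Fin l) (Fin k) ℂ) : Matrix (Fin k) (Fin k) V :=
  Matrix.of fun r s => ∑ i, ∑ j, (α r i * β j s) • w i j

/-- The block diagonal matrix `v ⊕ w`. -/
def directSum {V : Type*} [Zero V] {k l : ℕ} (v : Matrix (Fin k) (Fin k) V)
    (w : Matrix (Fin l) (Fin l) V) : Matrix (Fin (k + l)) (Fin (k + l)) V :=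
  Matrix.reindex finSumFinEquiv finSumFinEquiv (Matrix.fromBlocks v 0 0 w)

/-- `N` is an operator space structure on the complex normed space `E`: every `N k` is a norm on
`M_k[E]`, `N 1` is the given norm of `E`, and the two axioms of Ruan hold. (Completeness of `E` is
a separate hypothesis.) -/
structure IsOperatorSpace {E : Type*} [NormedAddCommGroup E] [NormedSpace ℂ E]
    (N : MatNorms E) : Prop where
  add_le : ∀ k (x y : Matrix (Fin k) (Fin k) E), N k (x + y) ≤ N k x + N k y
  smul_eq : ∀ k (c : ℂ) (x : Matrix (Fin k) (Fin k) E), N k (c • x) = ‖c‖ * N k x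
  eq_zero : ∀ k (x : Matrix (Fin k) (Fin k) E), N k x = 0 → x = 0
  one_eq : ∀ x : E, N 1 (Matrix.of fun _ _ => x) = ‖x‖
  directSum_eq : ∀ k l (v : Matrix (Fin k) (Fin k) E) (w : Matrix (Fin l) (Fin l) E),
    N (k + l) (directSum v w) = max (N k v) (N l w)
  sandwich_le : ∀ k l (α : Matrix (Fin k) (Fin l) ℂ) (w : Matrix (Fin l) (Fin l) E)
    (β : Matrix (Fin l) (Fin k) ℂ), N k (sandwich α w β) ≤ opNorm α * N l w * opNorm β

/-! ### Completely contractive and completely isometric maps -/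

section Maps

variable {V W : Type*} [AddCommGroup V] [Module ℂ V] [AddCommGroup W] [Module ℂ W]

/-- `id_{M_k} ⊗ T` is a contraction for every `k`. -/
def IsCompleteContraction (N : MatNorms V) (N' : MatNorms W) (T : V →ₗ[ℂ] W) : Prop :=
  ∀ k (x : Matrix (Fin k) (Fin k) V), N' k (x.map T) ≤ N k x

/-- `id_{M_k} ⊗ T` is an isometry for every `k`. -/
def IsCompleteIsometry (N : MatNorms V) (N' : MatNorms W) (T : V →ₗ[ℂ] W) : Prop :=
  ∀ k (x : Matrix (Fin k) (Fin k) V), N' k (x.map T) = N k x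

/-- The completely bounded norm of a completely bounded map `T`. -/
def cbNorm (N : MatNorms V) (N' : MatNorms W) (T : V →ₗ[ℂ] W) : ℝ :=
  sInf {C | 0 ≤ C ∧ ∀ k (x : Matrix (Fin k) (Fin k) V), N' k (x.map T) ≤ C * N k x}

end Maps

/-! ### Basic constructions of operator spaces -/

/-- The operator space `ℂ`. -/
def scalarNorms : MatNorms ℂ := fun _ A => opNorm A

/-- The operator space `S_∞^n[E] = M_n[E] = M_n ⊗_min E`, with `M_k[M_n[E]] = M_{kn}[E]`. -/
def sInfty (n : ℕ) {E : Type*} (N : MatNorms E) : MatNorms (Matrix (Fin n) (Fin n) E) :=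
  fun k x => N (k * n) (Matrix.reindex finProdFinEquiv finProdFinEquiv
    (Matrix.comp (Fin k) (Fin k) (Fin n) (Fin n) E x))

/-- The operator space `ℓ_∞^κ[E] = ℓ_∞^κ ⊗_min E`, with
`‖x‖_{M_k(ℓ_∞^κ[E])} = max_c ‖x_c‖_{M_k[E]}`. -/
def ellInfty (κ : Type) {E : Type*} (N : MatNorms E) : MatNorms (κ → E) :=
  fun k x => ⨆ c : κ, N k (x.map fun v => v c)

/-- For a matrix `x = (x_ij)` over `V` and a pairing `b` of `V` with `W`, the linear map
`W → M_k`, `w ↦ (b x_ij w)_ij`. -/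
def pairingMap {V W : Type*} [AddCommGroup V] [Module ℂ V] [AddCommGroup W] [Module ℂ W]
    (b : V →ₗ[ℂ] W →ₗ[ℂ] ℂ) {k : ℕ} (x : Matrix (Fin k) (Fin k) V) :
    W →ₗ[ℂ] Matrix (Fin k) (Fin k) ℂ where
  toFun w := Matrix.of fun i j => b (x i j) w
  map_add' w w' := by ext i j; simp
  map_smul' c w := by ext i j; simp

/-- The dual operator space structure on `V = W^*`, where `V` is identified with the dual of `W`
by the pairing `b`: `M_k[W^*] = CB(W, M_k)`. -/
def dualNorms {V W : Type*} [AddCommGroup V] [Module ℂ V] [AddCommGroup W] [Module ℂ W]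
    (b : V →ₗ[ℂ] W →ₗ[ℂ] ℂ) (N : MatNorms W) : MatNorms V :=
  fun k x => cbNorm N (sInfty k scalarNorms) (pairingMap b x)

/-- The projective operator space tensor norms on `U`, where `U` is identified with the algebraic
tensor product `V ⊗ W` by the bilinear map `b`. -/
def projNorms {V W U : Type*} [AddCommGroup V] [Module ℂ V] [AddCommGroup W] [Module ℂ W]
    [AddCommGroup U] [Module ℂ U] (b : V →ₗ[ℂ] W →ₗ[ℂ] U) (N : MatNorms V) (N' : MatNorms W) :
    MatNorms U :=
  fun k t => sInf {C | ∃ (l m : ℕ) (α : Matrix (Fin k) (Fin l × Fin m) ℂ)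
    (x : Matrix (Fin l) (Fin l) V) (y : Matrix (Fin m) (Fin m) W)
    (β : Matrix (Fin l × Fin m) (Fin k) ℂ),
    (∀ r s, t r s = ∑ a : Fin l × Fin m, ∑ c : Fin l × Fin m,
      (α r a * β c s) • b (x a.1 c.1) (y a.2 c.2)) ∧
    C = opNorm α * N l x * N' m y * opNorm β}

/-- Complex interpolation (Calderón's method) of two families of matrix norms on one space `V`,
with `M_k[V_θ] = (M_k[V_0], M_k[V_1])_θ`. It is used only for couples of norms on `M_k[V]` that
both induce the topology which the norm of `V` induces entrywise; that norm serves only to say which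
functions on the strip are analytic, continuous and bounded. -/
def interp {V : Type*} [NormedAddCommGroup V] [NormedSpace ℂ V] (N₀ N₁ : MatNorms V) (θ : ℝ) :
    MatNorms V :=
  fun k x => sInf {C | 0 ≤ C ∧ ∃ f : ℂ → Matrix (Fin k) (Fin k) V,
    (∀ i j, DiffContOnCl ℂ (fun z => f z i j) (Complex.HadamardThreeLines.verticalStrip 0 1)) ∧
    (∃ B : ℝ, ∀ z ∈ Complex.HadamardThreeLines.verticalClosedStrip 0 1, ∀ i j, ‖f z i j‖ ≤ B) ∧
    f (θ : ℂ) = x ∧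
    (∀ t : ℝ, N₀ k (f (t * Complex.I)) ≤ C) ∧
    (∀ t : ℝ, N₁ k (f (1 + t * Complex.I)) ≤ C)}

/-! ### The spaces `S_p^n`, `S_p^n[E]`, `ℓ_p^κ` and `ℓ_p^κ[E]` -/

/-- The pairing `⟨B, C⟩ = tr (B Cᵀ)` on `n × n` matrices. -/
def tracePairing (n : ℕ) :
    Matrix (Fin n) (Fin n) ℂ →ₗ[ℂ] Matrix (Fin n) (Fin n) ℂ →ₗ[ℂ] ℂ :=
  LinearMap.mk₂ ℂ (fun B C => (B * C.transpose).trace)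
    (by intros; simp [add_mul]) (by intros; simp)
    (by intros; simp [mul_add]) (by intros; simp)

/-- The pairing `⟨b, c⟩ = ∑ b_i c_i`. -/
def sumPairing (κ : Type) [Fintype κ] : (κ → ℂ) →ₗ[ℂ] (κ → ℂ) →ₗ[ℂ] ℂ :=
  LinearMap.mk₂ ℂ (fun b c => ∑ i, b i * c i)
    (by intros; simp [add_mul, Finset.sum_add_distrib])
    (by intros; simp [mul_assoc, Finset.mul_sum])
    (by intros; simp [mul_add, Finset.sum_add_distrib])
    (by intros; simp [mul_left_comm, Finset.mul_sum])

/-- The identification of `M_n ⊗ E` with the `n × n` matrices over `E`. -/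
def matTensor (n : ℕ) (E : Type*) [AddCommGroup E] [Module ℂ E] :
    Matrix (Fin n) (Fin n) ℂ →ₗ[ℂ] E →ₗ[ℂ] Matrix (Fin n) (Fin n) E :=
  LinearMap.mk₂ ℂ (fun A e => Matrix.of fun i j => A i j • e)
    (by intros; ext; simp [add_smul]) (by intros; ext; simp [mul_smul])
    (by intros; ext; simp) (by intros; ext; simp only [Matrix.smul_apply, Matrix.of_apply]; exact smul_comm _ _ _)

/-- The identification of `ℂ^κ ⊗ E` with `κ → E`. -/
def piTensor (κ : Type) (E : Type*) [AddCommGroup E] [Module ℂ E] :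
    (κ → ℂ) →ₗ[ℂ] E →ₗ[ℂ] (κ → E) :=
  LinearMap.mk₂ ℂ (fun a e => fun i => a i • e)
    (by intros; ext; simp [add_smul]) (by intros; ext; simp [mul_smul])
    (by intros; ext; simp) (by intros; ext; simp only [Pi.smul_apply]; exact smul_comm _ _ _)

/-- The operator space `S_1^n = M_n^*`. -/
def sOne (n : ℕ) : MatNorms (Matrix (Fin n) (Fin n) ℂ) :=
  dualNorms (tracePairing n) (sInfty n scalarNorms)

/-- The operator space `ℓ_1^κ = (ℓ_∞^κ)^*`. -/
def ellOne (κ : Type) [Fintype κ] : MatNorms (κ → ℂ) :=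
  dualNorms (sumPairing κ) (ellInfty κ scalarNorms)

section Lp

/- The entrywise supremum norm on matrices; it only enters through its topology, see `interp`. -/
attribute [local instance] Matrix.normedAddCommGroup Matrix.normedSpace

/-- The operator space `S_p^n = (M_n, S_1^n)_{1/p}`. -/
def schatten (p : ℝ≥0∞) (n : ℕ) : MatNorms (Matrix (Fin n) (Fin n) ℂ) :=
  interp (sInfty n scalarNorms) (sOne n) (p⁻¹).toReal

/-- The operator space `ℓ_p^κ = (ℓ_∞^κ, ℓ_1^κ)_{1/p}`. -/
def ell (p : ℝ≥0∞) (κ : Type) [Fintype κ] : MatNorms (κ → ℂ) :=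
  interp (ellInfty κ scalarNorms) (ellOne κ) (p⁻¹).toReal

variable {E : Type*} [NormedAddCommGroup E] [NormedSpace ℂ E]

/-- The operator space `S_p^n[E] = (M_n[E], S_1^n ⊗^ E)_{1/p}`. -/
def schattenV (p : ℝ≥0∞) (n : ℕ) (N : MatNorms E) : MatNorms (Matrix (Fin n) (Fin n) E) :=
  interp (sInfty n N) (projNorms (matTensor n E) (sOne n) N) (p⁻¹).toReal

/-- The operator space `ℓ_p^κ[E] = (ℓ_∞^κ[E], ℓ_1^κ ⊗^ E)_{1/p}`. -/
def ellV (p : ℝ≥0∞) (κ : Type) [Fintype κ] (N : MatNorms E) : MatNorms (κ → E) :=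
  interp (ellInfty κ N) (projNorms (piTensor κ E) (ellOne κ) N) (p⁻¹).toReal

end Lp

/-! ### Complete positivity -/

/-- `T` is completely positive with respect to the cones `C k` and `D k` of positive elements of
`M_k[V]` and `M_k[W]`. -/
def IsCompletelyPositive {V W : Type*} [AddCommGroup V] [Module ℂ V] [AddCommGroup W] [Module ℂ W]
    (C : (k : ℕ) → Set (Matrix (Fin k) (Fin k) V)) (D : (k : ℕ) → Set (Matrix (Fin k) (Fin k) W))
    (T : V →ₗ[ℂ] W) : Prop :=
  ∀ k, ∀ x ∈ C k, x.map T ∈ D k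

open scoped ComplexOrder in
/-- The positive elements of `M_k[M_n] = M_{kn}`. -/
def matCone (n k : ℕ) : Set (Matrix (Fin k) (Fin k) (Matrix (Fin n) (Fin n) ℂ)) :=
  {x | (Matrix.comp (Fin k) (Fin k) (Fin n) (Fin n) ℂ x).PosSemidef}

open scoped ComplexOrder in
/-- The positive elements of `M_k[M_n(ℓ_∞^κ)] = ℓ_∞^κ(M_{kn})`. -/
def matEllCone (n : ℕ) (κ : Type) (k : ℕ) :
    Set (Matrix (Fin k) (Fin k) (Matrix (Fin n) (Fin n) (κ → ℂ))) :=
  {x | ∀ c : κ, ((Matrix.comp (Fin k) (Fin k) (Fin n) (Fin n) (κ → ℂ) x).map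
    fun v => v c).PosSemidef}

/-! ### Tensoring maps with the identity of `E` -/

/-- `T ⊗ id_E` for a linear map `T : M_n → M_n(ℂ^κ)`. -/
def tensorIdOut {n : ℕ} {κ : Type}
    (T : Matrix (Fin n) (Fin n) ℂ →ₗ[ℂ] Matrix (Fin n) (Fin n) (κ → ℂ))
    (E : Type*) [AddCommGroup E] [Module ℂ E] :
    Matrix (Fin n) (Fin n) E →ₗ[ℂ] Matrix (Fin n) (Fin n) (κ → E) where
  toFun x := Matrix.of fun i j c => ∑ a, ∑ b, T (Matrix.single a b 1) i j c • x a b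
  map_add' x y := by ext i j c; simp [Finset.sum_add_distrib]
  map_smul' r x := by ext i j c; simp only [Matrix.smul_apply, Pi.smul_apply, Matrix.of_apply, RingHom.id_apply, Finset.smul_sum, smul_comm r]

/-- `T ⊗ id_E` for a linear map `T : M_n(ℂ^κ) → M_n`. -/
def tensorIdIn {n : ℕ} {κ : Type} [Fintype κ] [DecidableEq κ]
    (T : Matrix (Fin n) (Fin n) (κ → ℂ) →ₗ[ℂ] Matrix (Fin n) (Fin n) ℂ)
    (E : Type*) [AddCommGroup E] [Module ℂ E] :
    Matrix (Fin n) (Fin n) (κ → E) →ₗ[ℂ] Matrix (Fin n) (Fin n) E where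
  toFun x := Matrix.of fun i j =>
    ∑ a, ∑ b, ∑ c, T (Matrix.single a b (Pi.single c 1)) i j • x a b c
  map_add' x y := by ext i j; simp [Finset.sum_add_distrib]
  map_smul' r x := by ext i j; simp only [Matrix.smul_apply, Pi.smul_apply, Matrix.of_apply, RingHom.id_apply, Finset.smul_sum, smul_comm r]

/-! ### The embedding -/

/-- The unitary `u_k`: `e_j ↦ exp (2 π i k j / n) e_j`. -/
def clock (n : ℕ) (k : ℤ) : Matrix (Fin n) (Fin n) ℂ :=
  Matrix.diagonal fun j => Complex.exp (2 * Real.pi * Complex.I * k * (j : ℕ) / n)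

/-- The unitary `v_l`: `e_j ↦ e_{l + j}`, with `l + j` modulo `n`. -/
def shift (n : ℕ) (l : Fin n) : Matrix (Fin n) (Fin n) ℂ :=
  Matrix.of fun i j => if i = l + j then 1 else 0

/-- `T_{k,l} = v_l u_{-k}`. -/
def weyl (n : ℕ) (k l : Fin n) : Matrix (Fin n) (Fin n) ℂ :=
  shift n l * clock n (-((k : ℕ) : ℤ))

/-- The map `ρ ↦ n^{1 - 1/p - 1/q} (1/n) ∑_{k,l} e_{k,l} ⊗ T_{k,l} ρ T_{k,l}^*`. -/
def teleport (n : ℕ) (p q : ℝ≥0∞) :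
    Matrix (Fin n) (Fin n) ℂ →ₗ[ℂ] Matrix (Fin n) (Fin n) (Fin n × Fin n → ℂ) where
  toFun ρ := Matrix.of fun i j c =>
    (((n : ℝ) ^ (1 - (p⁻¹).toReal - (q⁻¹).toReal) * (1 / (n : ℝ)) : ℝ) : ℂ) *
      (weyl n c.1 c.2 * ρ * (weyl n c.1 c.2).conjTranspose) i j
  map_add' x y := by ext i j c; simp [mul_add, add_mul]
  map_smul' r x := by ext i j c; simp [mul_left_comm]

end OpSp

end

/-! Write T_c for the unitaries T_{k,l}, c = (k,l). They are orthogonal for the trace. Up to scalars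
J is `twirl`, x ↦ ∑_c T_c x T_c^* ⊗ e_c, and W is `untwirl`, y ↦ ∑_c T_c^* y_c T_c. Since `untwirl`
after `twirl` is n² times the identity, and a map with a completely contractive left inverse cannot
shrink norms, it suffices to bound the completely bounded norm of `twirl` by n^(1/p+1/q) and that of
`untwirl` by n^(2-1/p-1/q): the product of the two bounds is exactly n². The scalar statement is the
case E = ℂ.

Both bounds rest on `IsUnitaryFamily.opNorm_sum_conj_le`: for a matrix x over S_1^n, the norm of ∑_c
T_c x T_c^* ⊗ Y_c is at most n ‖x‖ max ‖Y_c‖. Indeed the sum is the trace pairing of x with A = V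
diag(Y_c) V^*, where the columns of V are the vectorised T_c, and orthogonality gives V^*V = n.

Put F = ℓ_p[E]. For `twirl`: into M_n[ℓ_∞[E]] it is contractive on M_n[E], being conjugation by
unitaries; from S_1^n ⊗^ E to M_n[ℓ_1 ⊗^ E] it has norm at most n. Interpolation gives n^(1/p) from
S_p^n[E] to M_n[F]. The identity M_n[F] → S_1^n ⊗^ F has norm at most n, so M_n[F] → S_q^n[F] costs
n^(1/q) (`schattenV_twirl_le`).

For `untwirl`: with x over S_1^n fixed, y ↦ untwirl(x ⊗ y) has norm at most n ‖x‖ from ℓ_∞[E] to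
M_n[E] and at most ‖x‖ from ℓ_1 ⊗^ E to S_1^n ⊗^ E, hence n^(1-1/p) ‖x‖ from F to S_p^n[E]. By the
definition of the projective norm, `untwirl` has norm at most n^(1-1/p) on S_1^n ⊗^ F, so at most
n^(2-1/p) on M_n[F]; a second interpolation, in q, finishes (`schattenV_untwirl_le`).

For an abstract E the bound from ℓ_∞[E] to M_n[E] is reduced to scalar matrices by
`IsOperatorSpace.le_of_forall_amplify_le`, a form of Ruan's theorem, proved by separating a convex
cone from an open convex set. -/

noncomputable section

set_option linter.unusedSectionVars false

namespace OpSp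

/-! ### Operator norms of scalar matrices. -/

section OpNorm

open scoped Matrix.Norms.L2Operator
open Matrix

variable {ι κ l m n o : Type} [Fintype ι] [Fintype κ] [Fintype l] [Fintype m] [Fintype n]
  [Fintype o] [DecidableEq ι] [DecidableEq κ] [DecidableEq l] [DecidableEq m] [DecidableEq n]
  [DecidableEq o]

theorem opNorm_nonneg (A : Matrix m n ℂ) : 0 ≤ opNorm A := norm_nonneg A

theorem opNorm_add_le (A B : Matrix m n ℂ) : opNorm (A + B) ≤ opNorm A + opNorm B :=
  norm_add_le A B

theorem opNorm_smul (c : ℂ) (A : Matrix m n ℂ) : opNorm (c • A) = ‖c‖ * opNorm A :=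
  norm_smul c A

theorem opNorm_eq_zero {A : Matrix m n ℂ} : opNorm A = 0 ↔ A = 0 :=
  norm_eq_zero (a := A)

@[simp] theorem opNorm_zero : opNorm (0 : Matrix m n ℂ) = 0 :=
  norm_zero (E := Matrix m n ℂ)

theorem opNorm_mul_le (A : Matrix l m ℂ) (B : Matrix m n ℂ) :
    opNorm (A * B) ≤ opNorm A * opNorm B :=
  l2_opNorm_mul A B

theorem opNorm_conjTranspose (A : Matrix m n ℂ) : opNorm Aᴴ = opNorm A :=
  l2_opNorm_conjTranspose A

theorem opNorm_conjTranspose_mul_self (A : Matrix m n ℂ) : opNorm (Aᴴ * A) = opNorm A ^ 2 := by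
  rw [sq]; exact l2_opNorm_conjTranspose_mul_self A

theorem opNorm_mul_conjTranspose_self (A : Matrix m n ℂ) : opNorm (A * Aᴴ) = opNorm A ^ 2 := by
  have := opNorm_conjTranspose_mul_self Aᴴ
  rwa [conjTranspose_conjTranspose, opNorm_conjTranspose] at this

theorem norm_mulVec_le (A : Matrix m n ℂ) (x : EuclideanSpace ℂ n) :
    ‖WithLp.toLp 2 (A *ᵥ x)‖ ≤ opNorm A * ‖x‖ :=
  l2_opNorm_mulVec A x

theorem sum_sq_mulVec_le (A : Matrix m n ℂ) (x : n → ℂ) :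
    ∑ i, ‖(A *ᵥ x) i‖ ^ 2 ≤ opNorm A ^ 2 * ∑ j, ‖x j‖ ^ 2 := by
  have h := norm_mulVec_le A (WithLp.toLp 2 x)
  have h2 := pow_le_pow_left₀ (norm_nonneg _) h 2
  rwa [mul_pow, EuclideanSpace.norm_sq_eq, EuclideanSpace.norm_sq_eq] at h2

theorem opNorm_le_of_sum_sq {A : Matrix m n ℂ} {C : ℝ} (hC : 0 ≤ C)
    (h : ∀ x : n → ℂ, ∑ i, ‖(A *ᵥ x) i‖ ^ 2 ≤ C ^ 2 * ∑ j, ‖x j‖ ^ 2) : opNorm A ≤ C := by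
  unfold opNorm
  rw [l2_opNorm_def]
  refine ContinuousLinearMap.opNorm_le_bound _ hC fun x => ?_
  refine (sq_le_sq₀ (norm_nonneg _) (by positivity)).mp ?_
  rw [mul_pow, EuclideanSpace.norm_sq_eq, EuclideanSpace.norm_sq_eq]
  exact h x.ofLp

theorem opNorm_one_le : opNorm (1 : Matrix m m ℂ) ≤ 1 :=
  opNorm_le_of_sum_sq zero_le_one fun x => by simp

theorem opNorm_le_one_of_conjTranspose_mul_self {V : Matrix m n ℂ} (h : Vᴴ * V = 1) :
    opNorm V ≤ 1 := by
  have h1 := opNorm_conjTranspose_mul_self V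
  rw [h] at h1
  have h2 : opNorm V ^ 2 ≤ 1 := h1 ▸ opNorm_one_le
  exact (sq_le_one_iff₀ (opNorm_nonneg V)).mp h2

theorem opNorm_mul_mul_le {A : Matrix l m ℂ} {B : Matrix m n ℂ} {C : Matrix n o ℂ} {a b c : ℝ}
    (ha : opNorm A ≤ a) (hb : opNorm B ≤ b) (hc : opNorm C ≤ c) :
    opNorm (A * B * C) ≤ a * b * c := by
  have h0 := (opNorm_nonneg A).trans ha
  have h1 := (opNorm_nonneg B).trans hb
  calc opNorm (A * B * C) ≤ opNorm (A * B) * opNorm C := opNorm_mul_le _ _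
    _ ≤ (opNorm A * opNorm B) * opNorm C :=
      mul_le_mul_of_nonneg_right (opNorm_mul_le _ _) (opNorm_nonneg _)
    _ ≤ a * b * c := mul_le_mul (mul_le_mul ha hb (opNorm_nonneg _) h0) hc (opNorm_nonneg _)
        (mul_nonneg h0 h1)

/-- The isometry between coordinate spaces given by an injection. -/
theorem opNorm_one_submatrix_le (e : ι → m) (he : Function.Injective e) :
    opNorm ((1 : Matrix m m ℂ).submatrix id e) ≤ 1 := by
  apply opNorm_le_one_of_conjTranspose_mul_self
  ext i j
  simp [Matrix.mul_apply, Matrix.one_apply, he.eq_iff]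

/-- A submatrix is a compression between two coordinate isometries. -/
theorem opNorm_submatrix_le (A : Matrix m n ℂ) (e : ι → m) (f : κ → n)
    (he : Function.Injective e) (hf : Function.Injective f) :
    opNorm (A.submatrix e f) ≤ opNorm A := by
  have h : A.submatrix e f = ((1 : Matrix m m ℂ).submatrix id e)ᴴ * A *
      (1 : Matrix n n ℂ).submatrix id f := by
    ext i j
    simp [Matrix.mul_apply, Matrix.one_apply]
  rw [h]
  have := opNorm_mul_mul_le (A := ((1 : Matrix m m ℂ).submatrix id e)ᴴ) (B := A)
    ((opNorm_conjTranspose _).trans_le (opNorm_one_submatrix_le e he)) le_rfl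
    (opNorm_one_submatrix_le f hf)
  rwa [one_mul, mul_one] at this

theorem opNorm_submatrix_equiv (A : Matrix m n ℂ) (e : ι ≃ m) (f : κ ≃ n) :
    opNorm (A.submatrix e f) = opNorm A := by
  refine le_antisymm (opNorm_submatrix_le A e f e.injective f.injective) ?_
  have := opNorm_submatrix_le (A.submatrix e f) e.symm f.symm e.symm.injective f.symm.injective
  simpa using this

theorem opNorm_reindex (A : Matrix m n ℂ) (e : m ≃ ι) (f : n ≃ κ) :
    opNorm (Matrix.reindex e f A) = opNorm A :=
  opNorm_submatrix_equiv A e.symm f.symm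

theorem norm_entry_le (A : Matrix m n ℂ) (i : m) (j : n) : ‖A i j‖ ≤ opNorm A := by
  have h := sum_sq_mulVec_le A (Pi.single j 1)
  have h1 : ∑ k, ‖(Pi.single j 1 : n → ℂ) k‖ ^ 2 = 1 := by
    rw [Finset.sum_eq_single j] <;> simp +contextual
  rw [h1, mul_one] at h
  have h2 : ‖(A *ᵥ Pi.single j 1) i‖ ^ 2 ≤ ∑ i, ‖(A *ᵥ Pi.single j 1) i‖ ^ 2 :=
    Finset.single_le_sum (f := fun i => ‖(A *ᵥ Pi.single j 1) i‖ ^ 2)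
      (fun _ _ => by positivity) (Finset.mem_univ i)
  have h3 := h2.trans h
  rw [Matrix.mulVec_single_one] at h3
  exact (sq_le_sq₀ (norm_nonneg _) (opNorm_nonneg _)).mp h3

theorem opNorm_blockDiagonal_le {Y : κ → Matrix m n ℂ} {C : ℝ} (hC : 0 ≤ C)
    (h : ∀ c, opNorm (Y c) ≤ C) : opNorm (blockDiagonal Y) ≤ C := by
  refine opNorm_le_of_sum_sq hC fun x => ?_
  have hx : ∀ i c, (blockDiagonal Y *ᵥ x) (i, c) = (Y c *ᵥ fun j => x (j, c)) i := by
    intro i c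
    simp [Matrix.mulVec, dotProduct, Fintype.sum_prod_type, blockDiagonal_apply]
  rw [Fintype.sum_prod_type_right, Fintype.sum_prod_type_right, Finset.mul_sum]
  refine Finset.sum_le_sum fun c _ => ?_
  simp only [hx]
  refine (sum_sq_mulVec_le (Y c) _).trans ?_
  exact mul_le_mul_of_nonneg_right (pow_le_pow_left₀ (opNorm_nonneg _) (h c) 2)
    (Finset.sum_nonneg fun _ _ => by positivity)

open Kronecker in
theorem opNorm_kronecker_one_le (A : Matrix m n ℂ) : opNorm (A ⊗ₖ (1 : Matrix ι ι ℂ)) ≤ opNorm A := by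
  rw [Matrix.kronecker_one]
  exact opNorm_blockDiagonal_le (opNorm_nonneg A) fun _ => le_rfl

open Kronecker in
theorem opNorm_one_kronecker_le (A : Matrix m n ℂ) : opNorm ((1 : Matrix ι ι ℂ) ⊗ₖ A) ≤ opNorm A := by
  rw [Matrix.one_kronecker, opNorm_reindex]
  exact opNorm_blockDiagonal_le (opNorm_nonneg A) fun _ => le_rfl

open Kronecker in
theorem opNorm_kronecker_le (A : Matrix m n ℂ) (B : Matrix ι κ ℂ) :
    opNorm (A ⊗ₖ B) ≤ opNorm A * opNorm B := by
  have h : A ⊗ₖ B = (A ⊗ₖ (1 : Matrix ι ι ℂ)) * ((1 : Matrix n n ℂ) ⊗ₖ B) := by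
    rw [← mul_kronecker_mul]; simp
  rw [h]
  exact (opNorm_mul_le _ _).trans (mul_le_mul (opNorm_kronecker_one_le A)
    (opNorm_one_kronecker_le B) (opNorm_nonneg _) (opNorm_nonneg _))

theorem opNorm_fromBlocks_le (A : Matrix m n ℂ) (B : Matrix ι κ ℂ) :
    opNorm (fromBlocks A 0 0 B) ≤ max (opNorm A) (opNorm B) := by
  have hC : 0 ≤ max (opNorm A) (opNorm B) := le_max_of_le_left (opNorm_nonneg A)
  refine opNorm_le_of_sum_sq hC fun x => ?_
  rw [Fintype.sum_sum_type, Fintype.sum_sum_type, mul_add, fromBlocks_mulVec]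
  simp only [zero_mulVec, add_zero, zero_add, Sum.elim_inl, Sum.elim_inr]
  refine add_le_add ((sum_sq_mulVec_le A _).trans ?_) ((sum_sq_mulVec_le B _).trans ?_)
  · exact mul_le_mul_of_nonneg_right (pow_le_pow_left₀ (opNorm_nonneg _) (le_max_left _ _) 2)
      (Finset.sum_nonneg fun _ _ => by positivity)
  · exact mul_le_mul_of_nonneg_right (pow_le_pow_left₀ (opNorm_nonneg _) (le_max_right _ _) 2)
      (Finset.sum_nonneg fun _ _ => by positivity)

theorem opNorm_fromBlocks (A : Matrix m n ℂ) (B : Matrix ι κ ℂ) :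
    opNorm (fromBlocks A 0 0 B) = max (opNorm A) (opNorm B) := by
  refine le_antisymm (opNorm_fromBlocks_le A B) (max_le ?_ ?_)
  · exact opNorm_submatrix_le (fromBlocks A 0 0 B) Sum.inl Sum.inl Sum.inl_injective
      Sum.inl_injective
  · exact opNorm_submatrix_le (fromBlocks A 0 0 B) Sum.inr Sum.inr Sum.inr_injective
      Sum.inr_injective

/-- Testing with ξ the conjugate of Aη gives 2‖Aη‖² ≤ ‖Aη‖² + ‖η‖². This additive form of
contractivity is what the separation argument delivers. -/
theorem opNorm_le_one_of_bilinear {A : Matrix m n ℂ}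
    (h : ∀ (ξ : m → ℂ) (η : n → ℂ),
      2 * (∑ i, ∑ j, ξ i * A i j * η j).re ≤ ∑ i, ‖ξ i‖ ^ 2 + ∑ j, ‖η j‖ ^ 2) :
    opNorm A ≤ 1 := by
  refine opNorm_le_of_sum_sq zero_le_one fun η => ?_
  have := h (fun i => star ((A *ᵥ η) i)) η
  have e : (∑ i, ∑ j, star ((A *ᵥ η) i) * A i j * η j).re = ∑ i, ‖(A *ᵥ η) i‖ ^ 2 := by
    rw [Complex.re_sum]
    refine Finset.sum_congr rfl fun i _ => ?_
    have : ∑ j, star ((A *ᵥ η) i) * A i j * η j = star ((A *ᵥ η) i) * (A *ᵥ η) i := by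
      simp only [mul_assoc, ← Finset.mul_sum]; rfl
    rw [this, ← starRingEnd_apply, Complex.conj_mul']
    norm_cast
  rw [e] at this
  simp only [norm_star] at this
  linarith

theorem norm_bilinear_le (A : Matrix m n ℂ) (ξ : m → ℂ) (η : n → ℂ) :
    ‖∑ i, ∑ j, ξ i * A i j * η j‖ ≤
      opNorm A * Real.sqrt (∑ i, ‖ξ i‖ ^ 2) * Real.sqrt (∑ j, ‖η j‖ ^ 2) := by
  have e : ∑ i, ∑ j, ξ i * A i j * η j =
      inner ℂ (WithLp.toLp 2 (fun i => star (ξ i)) : EuclideanSpace ℂ m)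
        (WithLp.toLp 2 (A *ᵥ η)) := by
    simp [PiLp.inner_apply, Matrix.mulVec, dotProduct, Finset.mul_sum, mul_comm, mul_left_comm]
  rw [e]
  refine (norm_inner_le_norm _ _).trans ?_
  have h1 : ‖(WithLp.toLp 2 (fun i => star (ξ i)) : EuclideanSpace ℂ m)‖ =
      Real.sqrt (∑ i, ‖ξ i‖ ^ 2) := by
    rw [EuclideanSpace.norm_eq]; simp
  have h2 : ‖(WithLp.toLp 2 η : EuclideanSpace ℂ n)‖ = Real.sqrt (∑ i, ‖η i‖ ^ 2) := by
    rw [EuclideanSpace.norm_eq]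
  have h3 := norm_mulVec_le A (WithLp.toLp 2 η)
  rw [h2] at h3
  rw [h1]
  calc _ ≤ Real.sqrt (∑ i, ‖ξ i‖ ^ 2) * (opNorm A * Real.sqrt (∑ j, ‖η j‖ ^ 2)) :=
        mul_le_mul_of_nonneg_left h3 (Real.sqrt_nonneg _)
    _ = _ := by ring

end OpNorm
end OpSp
end

noncomputable section

namespace OpSp

/-! ### Positive functionals and density matrices. -/

section Separation

open Matrix
open scoped ComplexOrder

theorem trace_mul_conjTranspose_self_re {m n : Type} [Fintype m] [Fintype n] (A : Matrix m n ℂ) :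
    (A * Aᴴ).trace.re = ∑ i, ∑ j, ‖A i j‖ ^ 2 := by
  simp only [trace, diag_apply, mul_apply, conjTranspose_apply, Complex.re_sum]
  refine Finset.sum_congr rfl fun i _ => Finset.sum_congr rfl fun j _ => ?_
  rw [← starRingEnd_apply, Complex.mul_conj']
  norm_cast

/-- A positive real functional on Hermitian matrices is given by a density matrix. -/
theorem exists_posSemidef_of_functional {m : Type} [Fintype m] [DecidableEq m]
    (p : Matrix m m ℂ →ₗ[ℝ] ℝ) (hp : ∀ ξ : m → ℂ, 0 ≤ p (vecMulVec ξ (star ξ))) :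
    ∃ ρ : Matrix m m ℂ, ρ.PosSemidef ∧
      ∀ P : Matrix m m ℂ, P.IsHermitian → p P = (P * ρ).trace.re := by
  let e : m → m → Matrix m m ℂ := fun i j => single i j 1
  -- For a Hermitian ρ representing p, the values of p on e_ij + e_ji and on i(e_ij - e_ji) must be
  -- 2 Re ρ_ji and -2 Im ρ_ji; this forces the formula.
  let ρ : Matrix m m ℂ := of fun j i =>
    (2⁻¹ : ℂ) * ((p (e i j + e j i) : ℂ) - Complex.I * (p (Complex.I • (e i j - e j i)) : ℂ))
  have hρ : ∀ P : Matrix m m ℂ, P.IsHermitian → p P = (P * ρ).trace.re := by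
    intro P hP
    have h1 : P = ∑ i, ∑ j, (2⁻¹ : ℝ) • (P i j • e i j + star (P i j) • e j i) := by
      have h2 : P = ∑ i, ∑ j, P i j • e i j := by
        conv_lhs => rw [matrix_eq_sum_single P]
        simp [e, smul_single]
      have h3 : P = ∑ i, ∑ j, star (P i j) • e j i := by
        conv_lhs => rw [h2, Finset.sum_comm]
        refine Finset.sum_congr rfl fun i _ => Finset.sum_congr rfl fun j _ => ?_
        rw [hP.apply]
      simp only [← Finset.smul_sum, Finset.sum_add_distrib, ← h2, ← h3]
      rw [← two_smul ℝ, smul_smul]; norm_num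
    have h4 : (P * ρ).trace.re = ∑ i, ∑ j, (P i j * ρ j i).re := by
      simp [trace, mul_apply]
    conv_lhs => rw [h1]
    rw [h4, map_sum]
    refine Finset.sum_congr rfl fun i _ => ?_
    rw [map_sum]
    refine Finset.sum_congr rfl fun j _ => ?_
    have h5 : P i j • e i j + star (P i j) • e j i =
        (P i j).re • (e i j + e j i) + (P i j).im • (Complex.I • (e i j - e j i)) := by
      have hz : P i j = (P i j).re + (P i j).im * Complex.I := (Complex.re_add_im _).symm
      have hz' : star (P i j) = (P i j).re - (P i j).im * Complex.I := by
        apply Complex.ext <;> simp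
      rw [hz']
      nth_rewrite 1 [hz]
      simp only [← Complex.coe_smul, smul_smul, add_smul, sub_smul, smul_add, smul_sub]
      abel
    rw [h5, map_smul, map_add, map_smul, map_smul]
    simp [ρ, Complex.mul_re]
    ring
  have herm : ρ.IsHermitian := by
    ext i j
    simp only [ρ, conjTranspose_apply, of_apply]
    have hneg : p (Complex.I • (e j i - e i j)) = -p (Complex.I • (e i j - e j i)) := by
      rw [← map_neg, ← smul_neg, neg_sub]
    rw [hneg, add_comm (e j i)]
    apply Complex.ext <;> simp
  refine ⟨ρ, .of_dotProduct_mulVec_nonneg herm fun ξ => ?_, hρ⟩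
  have h1 : (star ξ ⬝ᵥ ρ *ᵥ ξ) = (vecMulVec ξ (star ξ) * ρ).trace := by
    rw [vecMulVec_mul, trace_vecMulVec, dotProduct_mulVec, dotProduct_comm]
  have h2 : (vecMulVec ξ (star ξ)).IsHermitian := by
    ext i j; simp [vecMulVec_apply, mul_comm]
  have h3 := hρ _ h2
  rw [← h1] at h3
  have h4 := hp ξ
  rw [h3] at h4
  have h5 := herm.im_star_dotProduct_mulVec_self ξ
  exact Complex.le_def.2 ⟨h4, by simpa using h5.symm⟩

/-- Adding a small multiple δ of the identity to the density matrix of p makes it positive definite,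
so its factor R is invertible. This costs only ε in the trace, and lets functionals later be divided
by R. -/
theorem exists_invertible_dominating {m : Type} [Fintype m] [DecidableEq m]
    (p : Matrix m m ℂ →ₗ[ℝ] ℝ) (hp : ∀ ξ : m → ℂ, 0 ≤ p (vecMulVec ξ (star ξ)))
    (hp1 : p 1 ≤ 1) {ε : ℝ} (hε : 0 < ε) :
    ∃ R : Matrix m m ℂ, IsUnit R ∧ (∑ i, ∑ j, ‖R i j‖ ^ 2 ≤ 1 + ε) ∧
      ∀ (r : ℕ) (α : Matrix m (Fin r) ℂ), p (α * αᴴ) ≤ ∑ i, ∑ j, ‖(R * α) i j‖ ^ 2 := by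
  obtain ⟨ρ, hρ, hpρ⟩ := exists_posSemidef_of_functional p hp
  obtain ⟨δ, hδ, hδε⟩ : ∃ δ : ℝ, 0 < δ ∧ δ * Fintype.card m ≤ ε := by
    refine ⟨ε / (Fintype.card m + 1), by positivity, ?_⟩
    rw [div_mul_eq_mul_div, div_le_iff₀ (by positivity)]
    nlinarith
  let ρ' : Matrix m m ℂ := ρ + (δ : ℂ) • 1
  have hpd : ρ'.PosDef := by
    refine PosDef.posSemidef_add hρ (PosDef.one.smul ?_)
    exact_mod_cast hδ
  obtain ⟨R, hR⟩ : ∃ R : Matrix m m ℂ, ρ' = Rᴴ * R := by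
    open scoped MatrixOrder in
    exact CStarAlgebra.nonneg_iff_eq_star_mul_self.mp hpd.posSemidef.nonneg
  have hU : IsUnit R := by
    have h := hpd.isUnit
    rw [hR, isUnit_iff_isUnit_det, det_mul, IsUnit.mul_iff] at h
    exact (isUnit_iff_isUnit_det R).2 h.2
  have htr : ∀ (r : ℕ) (α : Matrix m (Fin r) ℂ),
      (α * αᴴ * ρ').trace.re = ∑ i, ∑ j, ‖(R * α) i j‖ ^ 2 := by
    intro r α
    rw [← trace_mul_conjTranspose_self_re, conjTranspose_mul, hR, ← Matrix.mul_assoc,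
      trace_mul_comm]
    simp only [Matrix.mul_assoc]
  refine ⟨R, hU, ?_, fun r α => ?_⟩
  · rw [← trace_mul_conjTranspose_self_re, trace_mul_comm, ← hR]
    have h1 := hpρ 1 isHermitian_one
    rw [one_mul] at h1
    have : ρ'.trace.re = ρ.trace.re + δ * Fintype.card m := by
      simp [ρ', trace_add, trace_smul]
    linarith
  · rw [← htr, hpρ _ (isHermitian_mul_conjTranspose_self α)]
    have : (α * αᴴ * ρ').trace.re = (α * αᴴ * ρ).trace.re + δ * (α * αᴴ).trace.re := by
      simp [ρ', Matrix.mul_add]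
    rw [this, trace_mul_conjTranspose_self_re]
    have : 0 ≤ δ * ∑ i, ∑ j, ‖α i j‖ ^ 2 := by positivity
    linarith

end Separation

/-! ### Complete contractions into matrix algebras determine the norms of an operator space. -/

section Ruan

open Matrix

namespace IsOperatorSpace

variable {E : Type*} [NormedAddCommGroup E] [NormedSpace ℂ E] {N : MatNorms E}

/-- The matrix norm of an operator space, as a seminorm. -/
def seminorm (hN : IsOperatorSpace N) (k : ℕ) : Seminorm ℂ (Matrix (Fin k) (Fin k) E) :=
  Seminorm.of (N k) (hN.add_le k) (hN.smul_eq k)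

theorem seminorm_apply (hN : IsOperatorSpace N) (k : ℕ) (x : Matrix (Fin k) (Fin k) E) :
    hN.seminorm k x = N k x := rfl

theorem nonneg (hN : IsOperatorSpace N) (k : ℕ) (x : Matrix (Fin k) (Fin k) E) : 0 ≤ N k x :=
  apply_nonneg (hN.seminorm k) x

theorem map_zero (hN : IsOperatorSpace N) (k : ℕ) : N k 0 = 0 :=
  _root_.map_zero (hN.seminorm k)

end IsOperatorSpace

/-- Hahn–Banach, extending c z ↦ c p(z) from the line through z. The zero functional handles p z =
0, which also leaves z nonzero in the remaining case. -/
theorem exists_dual_eq_seminorm {V : Type*} [AddCommGroup V] [Module ℂ V] (p : Seminorm ℂ V)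
    (z : V) : ∃ F : V →ₗ[ℂ] ℂ, F z = p z ∧ ∀ x, ‖F x‖ ≤ p x := by
  by_cases hz : p z = 0
  · exact ⟨0, by simp [hz], fun x => by simp⟩
  have hz0 : z ≠ 0 := fun h => hz (by rw [h, map_zero])
  let f : Module.Dual ℂ (Submodule.span ℂ {z}) :=
    (p z : ℂ) • (LinearEquiv.toSpanNonzeroSingleton ℂ V z hz0).symm.toLinearMap
  have hf : ∀ c : ℂ, ∀ h, f ⟨c • z, h⟩ = p z * c := by
    intro c h
    have : (LinearEquiv.toSpanNonzeroSingleton ℂ V z hz0) c = ⟨c • z, h⟩ := rfl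
    change (p z : ℂ) * (LinearEquiv.toSpanNonzeroSingleton ℂ V z hz0).symm ⟨c • z, h⟩ = _
    rw [← this, LinearEquiv.symm_apply_apply]
  obtain ⟨g, hg, hgp⟩ := Module.Dual.exists_extension_of_le_seminorm (Submodule.span ℂ {z}) f
    (p := p) (by
      rintro ⟨x, hx⟩
      obtain ⟨c, rfl⟩ := Submodule.mem_span_singleton.1 hx
      rw [hf, map_smul_eq_mul, norm_mul, mul_comm, Complex.norm_real, Real.norm_of_nonneg
        (apply_nonneg p z)])
  refine ⟨g, ?_, hgp⟩
  have h := hg ⟨z, Submodule.mem_span_singleton_self z⟩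
  have h2 := hf 1 (by simp)
  simp only [one_smul, mul_one] at h2
  exact h.trans h2

section Sandwich

variable {V : Type*} [AddCommGroup V] [Module ℂ V] {k l r s : ℕ}

theorem sandwich_smul_smul (c d : ℂ) (α : Matrix (Fin k) (Fin l) ℂ)
    (w : Matrix (Fin l) (Fin l) V) (β : Matrix (Fin l) (Fin k) ℂ) :
    sandwich (c • α) w (d • β) = (c * d) • sandwich α w β := by
  ext i j
  simp only [sandwich, of_apply, Matrix.smul_apply, Finset.smul_sum, smul_smul, smul_eq_mul]
  refine Finset.sum_congr rfl fun a _ => Finset.sum_congr rfl fun b _ => ?_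
  congr 1; ring

/-- The row matrix `[α, γ]`. -/
def hcat (α : Matrix (Fin k) (Fin r) ℂ) (γ : Matrix (Fin k) (Fin s) ℂ) :
    Matrix (Fin k) (Fin (r + s)) ℂ :=
  (fromCols α γ).submatrix id finSumFinEquiv.symm

/-- The column matrix with blocks `β` and `δ`. -/
def vcat (β : Matrix (Fin r) (Fin k) ℂ) (δ : Matrix (Fin s) (Fin k) ℂ) :
    Matrix (Fin (r + s)) (Fin k) ℂ :=
  (fromRows β δ).submatrix finSumFinEquiv.symm id

theorem sandwich_directSum (α : Matrix (Fin k) (Fin r) ℂ) (γ : Matrix (Fin k) (Fin s) ℂ)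
    (v : Matrix (Fin r) (Fin r) V) (w : Matrix (Fin s) (Fin s) V)
    (β : Matrix (Fin r) (Fin k) ℂ) (δ : Matrix (Fin s) (Fin k) ℂ) :
    sandwich (hcat α γ) (directSum v w) (vcat β δ) = sandwich α v β + sandwich γ w δ := by
  ext i j
  simp only [sandwich, of_apply, Matrix.add_apply, ← finSumFinEquiv.sum_comp, Fintype.sum_sum_type]
  simp [hcat, vcat, directSum, -finSumFinEquiv_apply_left, -finSumFinEquiv_apply_right]

theorem hcat_mul_conjTranspose (α : Matrix (Fin k) (Fin r) ℂ) (γ : Matrix (Fin k) (Fin s) ℂ) :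
    hcat α γ * (hcat α γ)ᴴ = α * αᴴ + γ * γᴴ := by
  ext i j
  simp only [mul_apply, Matrix.add_apply, ← finSumFinEquiv.sum_comp, Fintype.sum_sum_type]
  simp [hcat, -finSumFinEquiv_apply_left, -finSumFinEquiv_apply_right]

theorem conjTranspose_mul_vcat (β : Matrix (Fin r) (Fin k) ℂ) (δ : Matrix (Fin s) (Fin k) ℂ) :
    (vcat β δ)ᴴ * vcat β δ = βᴴ * β + δᴴ * δ := by
  ext i j
  simp only [mul_apply, Matrix.add_apply, ← finSumFinEquiv.sum_comp, Fintype.sum_sum_type]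
  simp [vcat, -finSumFinEquiv_apply_left, -finSumFinEquiv_apply_right]

theorem sandwich_zero (α : Matrix (Fin k) (Fin r) ℂ) (β : Matrix (Fin r) (Fin k) ℂ) :
    sandwich α (0 : Matrix (Fin r) (Fin r) V) β = 0 := by
  ext i j; simp [sandwich]

theorem sandwich_one (z : Matrix (Fin k) (Fin k) V) : sandwich 1 z 1 = z := by
  ext i j
  simp [sandwich, one_apply, ite_smul, Finset.sum_ite_eq]

end Sandwich

variable {E : Type*} [NormedAddCommGroup E] [NormedSpace ℂ E] {N : MatNorms E}

/-- The amplification of `φ : E → M_K` applied to a matrix over `E`, as a scalar matrix. -/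
def amplify {ι κ : Type} (φ : E →ₗ[ℂ] Matrix κ κ ℂ) (v : Matrix ι ι E) :
    Matrix (ι × κ) (ι × κ) ℂ :=
  of fun x y => φ (v x.1 y.1) x.2 y.2

open scoped Matrix.Norms.L2Operator in
/-- Domination of a contractive functional on `M_k[E]` by a pair of real functionals. -/
theorem IsOperatorSpace.exists_dominating_functionals (hN : IsOperatorSpace N) {k : ℕ}
    (F : Matrix (Fin k) (Fin k) E →ₗ[ℂ] ℂ) (hF : ∀ v, ‖F v‖ ≤ N k v) :
    ∃ p q : Matrix (Fin k) (Fin k) ℂ →ₗ[ℝ] ℝ, (∀ P, p P ≤ opNorm P) ∧ (∀ Q, q Q ≤ opNorm Q) ∧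
      ∀ (r : ℕ) (α : Matrix (Fin k) (Fin r) ℂ) (v : Matrix (Fin r) (Fin r) E)
        (β : Matrix (Fin r) (Fin k) ℂ), N r v ≤ 1 →
        2 * (F (sandwich α v β)).re ≤ p (α * αᴴ) + q (βᴴ * β) := by
  let M := Matrix (Fin k) (Fin k) ℂ
  -- A is a convex cone: scalars are absorbed in α and β, and sums come from direct sums of
  -- contractions, by Ruan's first axiom. B is open and convex. The two are disjoint because
  -- |F(αvβ)| ≤ ‖α‖‖β‖, by the second axiom, and 2‖α‖‖β‖ ≤ ‖α‖² + ‖β‖².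
  let A : Set (M × M × ℝ) := {X | ∃ (r : ℕ) (α : Matrix (Fin k) (Fin r) ℂ)
    (v : Matrix (Fin r) (Fin r) E) (β : Matrix (Fin r) (Fin k) ℂ), N r v ≤ 1 ∧
    X = (α * αᴴ, βᴴ * β, 2 * (F (sandwich α v β)).re)}
  let B : Set (M × M × ℝ) := {X | ‖X.1‖ + ‖X.2.1‖ < X.2.2}
  have hAsmul : ∀ t : ℝ, 0 ≤ t → ∀ X ∈ A, t • X ∈ A := by
    rintro t ht X ⟨r, α, v, β, hv, rfl⟩
    have hs : ((Real.sqrt t : ℂ)) * (Real.sqrt t : ℂ) = t := by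
      rw [← Complex.ofReal_mul, Real.mul_self_sqrt ht]
    refine ⟨r, (Real.sqrt t : ℂ) • α, v, (Real.sqrt t : ℂ) • β, hv, ?_⟩
    rw [sandwich_smul_smul, hs]
    have hst : star (Real.sqrt t : ℂ) = (Real.sqrt t : ℂ) := Complex.conj_ofReal _
    rw [conjTranspose_smul, conjTranspose_smul, hst, Matrix.smul_mul, Matrix.smul_mul,
      Matrix.mul_smul, Matrix.mul_smul, smul_smul, smul_smul, hs, map_smul, smul_eq_mul,
      Complex.re_ofReal_mul, Complex.coe_smul, Complex.coe_smul, mul_left_comm]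
    rfl
  have hAadd : ∀ X ∈ A, ∀ Y ∈ A, X + Y ∈ A := by
    rintro X ⟨r, α, v, β, hv, rfl⟩ Y ⟨s, γ, w, δ, hw, rfl⟩
    refine ⟨r + s, hcat α γ, directSum v w, vcat β δ, ?_, ?_⟩
    · rw [hN.directSum_eq]; exact max_le hv hw
    · rw [hcat_mul_conjTranspose, conjTranspose_mul_vcat, sandwich_directSum]
      simp [mul_add]
  have hA : Convex ℝ A := fun X hX Y hY a b ha hb _ =>
    hAadd _ (hAsmul a ha X hX) _ (hAsmul b hb Y hY)
  have hB : Convex ℝ B := by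
    intro X hX Y hY a b ha hb hab
    simp only [B, Set.mem_ofPred_eq, Prod.fst_add, Prod.smul_fst, Prod.snd_add, Prod.smul_snd,
      smul_eq_mul] at hX hY ⊢
    have h1 : ‖a • X.1 + b • Y.1‖ ≤ a * ‖X.1‖ + b * ‖Y.1‖ := by
      refine (norm_add_le _ _).trans (le_of_eq ?_)
      rw [norm_smul, norm_smul, Real.norm_of_nonneg ha, Real.norm_of_nonneg hb]
    have h2 : ‖a • X.2.1 + b • Y.2.1‖ ≤ a * ‖X.2.1‖ + b * ‖Y.2.1‖ := by
      refine (norm_add_le _ _).trans (le_of_eq ?_)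
      rw [norm_smul, norm_smul, Real.norm_of_nonneg ha, Real.norm_of_nonneg hb]
    rcases ha.eq_or_lt with rfl | ha'
    · have : b = 1 := by linarith
      subst this
      simp only [zero_mul, one_mul, zero_add] at h1 h2 ⊢
      linarith
    · nlinarith [mul_lt_mul_of_pos_left hX ha', mul_le_mul_of_nonneg_left hY.le hb]
  have hBo : IsOpen B := by
    refine isOpen_lt ?_ ?_ <;> fun_prop
  have hdisj : Disjoint B A := by
    rw [Set.disjoint_left]
    rintro X hX ⟨r, α, v, β, hv, rfl⟩
    have hX' : opNorm (α * αᴴ) + opNorm (βᴴ * β) < 2 * (F (sandwich α v β)).re := hX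
    rw [opNorm_mul_conjTranspose_self, opNorm_conjTranspose_mul_self] at hX'
    have h1 : (F (sandwich α v β)).re ≤ opNorm α * opNorm β := by
      refine ((Complex.re_le_norm _).trans (hF _)).trans ((hN.sandwich_le _ _ _ _ _).trans ?_)
      have := mul_le_mul_of_nonneg_left hv (opNorm_nonneg α)
      rw [mul_one] at this
      exact mul_le_mul_of_nonneg_right this (opNorm_nonneg β)
    nlinarith [sq_nonneg (opNorm α - opNorm β)]
  obtain ⟨f, u, hfB, hfA⟩ := geometric_hahn_banach_open hB hBo hA hdisj
  have h0A : (0 : M × M × ℝ) ∈ A :=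
    ⟨0, 0, 0, 0, by rw [hN.map_zero]; exact zero_le_one, by
      simp [sandwich_zero]; rfl⟩
  have hu0 : u ≤ 0 := by simpa using hfA 0 h0A
  -- All t(0,0,1) with t > 0 lie in B, and f tends to 0 along them as t → 0, so u cannot be
  -- negative.
  have hu : u = 0 := by
    refine le_antisymm hu0 (not_lt.1 fun hlt => ?_)
    have h1 : ∀ t : ℝ, 0 < t → t * f (0, 0, 1) < u := fun t ht => by
      have : f (t • (0, 0, 1)) < u := hfB _ (by simpa [B] using ht)
      rwa [map_smul, smul_eq_mul] at this
    have h2 := h1 1 one_pos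
    have h3 : f (0, 0, 1) < 0 := by linarith
    have h4 := h1 (u / (2 * f (0, 0, 1))) (div_pos_of_neg_of_neg hlt (by linarith))
    rw [div_mul_eq_mul_div, mul_div_mul_right _ _ h3.ne] at h4
    linarith
  subst hu
  have hA0 : ∀ X ∈ A, 0 ≤ f X := hfA
  -- Dividing by s brings f to the form (P, Q, r) ↦ p P + q Q - r. Nonnegativity on A is then the
  -- domination, and negativity on B bounds p and q by the operator norm.
  set s : ℝ := -f (0, 0, 1) with hs
  have hspos : 0 < s := by
    have : f (0, 0, 1) < 0 := hfB _ (by simp [B])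
    linarith
  let p : M →ₗ[ℝ] ℝ := s⁻¹ • (f.toLinearMap ∘ₗ LinearMap.inl ℝ M (M × ℝ))
  let q : M →ₗ[ℝ] ℝ := s⁻¹ • (f.toLinearMap ∘ₗ LinearMap.inr ℝ M (M × ℝ) ∘ₗ LinearMap.inl ℝ M ℝ)
  have hp : ∀ P, p P = s⁻¹ * f (P, 0, 0) := fun P => rfl
  have hq : ∀ Q, q Q = s⁻¹ * f (0, Q, 0) := fun P => rfl
  have hf : ∀ P Q r, f (P, Q, r) = s * (p P + q Q - r) := by
    intro P Q r
    have h1 : ((P, Q, r) : M × M × ℝ) = (P, 0, 0) + (0, Q, 0) + r • (0, 0, 1) := by simp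
    rw [h1, map_add, map_add, map_smul, hp, hq, smul_eq_mul]
    rw [show f (0, 0, 1) = -s by simp [hs]]
    field_simp
    ring
  refine ⟨p, q, fun P => ?_, fun Q => ?_, fun r α v β hv => ?_⟩
  · refine le_of_forall_gt_imp_ge_of_dense fun c hc => ?_
    have h1 : f (P, 0, c) < 0 := hfB _ (by
      change ‖_‖ + ‖_‖ < c
      rw [norm_zero, add_zero]; exact hc)
    rw [hf, LinearMap.map_zero, add_zero] at h1
    have := neg_of_mul_neg_right h1 hspos.le
    linarith
  · refine le_of_forall_gt_imp_ge_of_dense fun c hc => ?_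
    have h1 : f (0, Q, c) < 0 := hfB _ (by
      change ‖_‖ + ‖_‖ < c
      rw [norm_zero, zero_add]; exact hc)
    rw [hf, LinearMap.map_zero, zero_add] at h1
    have := neg_of_mul_neg_right h1 hspos.le
    linarith
  · have h1 := hA0 _ ⟨r, α, v, β, hv, rfl⟩
    rw [hf] at h1
    have := nonneg_of_mul_nonneg_right h1 hspos
    linarith

/-- Complete contractions into matrix algebras determine the matrix norms of an operator space. -/
theorem IsOperatorSpace.le_of_forall_amplify_le (hN : IsOperatorSpace N) {k : ℕ}
    (z : Matrix (Fin k) (Fin k) E) {D : ℝ} (hD : 0 ≤ D)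
    (h : ∀ φ : E →ₗ[ℂ] Matrix (Fin k) (Fin k) ℂ,
      (∀ (r : ℕ) (v : Matrix (Fin r) (Fin r) E), opNorm (amplify φ v) ≤ N r v) →
      opNorm (amplify φ z) ≤ D) : N k z ≤ D := by
  obtain ⟨F, hFz, hF⟩ := exists_dual_eq_seminorm (hN.seminorm k) z
  obtain ⟨p, q, hp1, hq1, hpq⟩ := hN.exists_dominating_functionals F hF
  have hN0 : ∀ r, N r 0 ≤ 1 := fun r => by rw [hN.map_zero]; exact zero_le_one
  -- With v = 0 and β = 0 the domination reduces to 0 ≤ p(αα^*); take α to be the single column ξ.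
  have hp0 : ∀ ξ : Fin k → ℂ, 0 ≤ p (vecMulVec ξ (star ξ)) := fun ξ => by
    have := hpq 1 (replicateCol (Fin 1) ξ) 0 0 (hN0 1)
    have e : replicateCol (Fin 1) ξ * (replicateCol (Fin 1) ξ)ᴴ = vecMulVec ξ (star ξ) := by
      ext i j; simp [mul_apply, vecMulVec_apply]
    rw [e] at this
    simpa [sandwich_zero] using this
  have hq0 : ∀ ξ : Fin k → ℂ, 0 ≤ q (vecMulVec ξ (star ξ)) := fun ξ => by
    have := hpq 1 0 0 (replicateRow (Fin 1) (star ξ)) (hN0 1)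
    have e : (replicateRow (Fin 1) (star ξ))ᴴ * replicateRow (Fin 1) (star ξ) =
        vecMulVec ξ (star ξ) := by
      ext i j; simp [mul_apply, vecMulVec_apply]
    rw [e] at this
    simpa [sandwich_zero] using this
  have hmain : ∀ ε : ℝ, 0 < ε → N k z ≤ D * (1 + ε) := by
    intro ε hε
    obtain ⟨R, hRu, hR1, hR⟩ := exists_invertible_dominating p hp0
      ((hp1 1).trans opNorm_one_le) hε
    obtain ⟨S, hSu, hS1, hS⟩ := exists_invertible_dominating q hq0
      ((hq1 1).trans opNorm_one_le) hε
    have hRdet := (isUnit_iff_isUnit_det R).1 hRu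
    have hSdet := (isUnit_iff_isUnit_det S).1 hSu
    have hSdet' : IsUnit (Sᴴ).det := by rw [det_conjTranspose]; exact hSdet.star
    let Fm : E →ₗ[ℂ] Matrix (Fin k) (Fin k) ℂ :=
      { toFun := fun e => of fun i j => F (single i j e)
        map_add' := fun a b => by ext i j; simp [single_add]
        map_smul' := fun c a => by ext i j; simp [← smul_single] }
    -- φ is F, read as an M_k-valued map and divided by the two density factors. Then F(αvβ) is the
    -- bilinear form of the amplification of φ at the vectors with entries Rα and βS^* (`hFs`), and
    -- the domination of F turns into complete contractivity of φ. The transposes come from summing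
    -- over the first index of α and the second of β.
    let φ : E →ₗ[ℂ] Matrix (Fin k) (Fin k) ℂ :=
      LinearMap.mulLeft ℂ (R⁻¹)ᵀ ∘ₗ LinearMap.mulRight ℂ ((Sᴴ)⁻¹)ᵀ ∘ₗ Fm
    have hφ : ∀ e, Rᵀ * φ e * (Sᴴ)ᵀ = Fm e := by
      intro e
      have h1 : Rᵀ * (R⁻¹)ᵀ = 1 := by
        rw [← transpose_mul, nonsing_inv_mul _ hRdet, transpose_one]
      have h2 : ((Sᴴ)⁻¹)ᵀ * (Sᴴ)ᵀ = 1 := by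
        rw [← transpose_mul, mul_nonsing_inv _ hSdet', transpose_one]
      calc Rᵀ * ((R⁻¹)ᵀ * (Fm e * ((Sᴴ)⁻¹)ᵀ)) * (Sᴴ)ᵀ
          = (Rᵀ * (R⁻¹)ᵀ) * Fm e * (((Sᴴ)⁻¹)ᵀ * (Sᴴ)ᵀ) := by simp only [Matrix.mul_assoc]
        _ = Fm e := by rw [h1, h2, Matrix.one_mul, Matrix.mul_one]
    have hFs : ∀ (r : ℕ) (α : Matrix (Fin k) (Fin r) ℂ) (v : Matrix (Fin r) (Fin r) E)
        (β : Matrix (Fin r) (Fin k) ℂ), F (sandwich α v β) =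
        ∑ x : Fin r × Fin k, ∑ y : Fin r × Fin k,
          (R * α) x.2 x.1 * amplify φ v x y * (β * Sᴴ) y.1 y.2 := by
      intro r α v β
      have h1 : F (sandwich α v β) = ∑ a, ∑ b, ∑ i, ∑ j, α i a * Fm (v a b) i j * β b j := by
        rw [matrix_eq_sum_single (sandwich α v β)]
        simp only [map_sum, sandwich, of_apply]
        have : ∀ i j, F (single i j (∑ a, ∑ b, (α i a * β b j) • v a b)) =
            ∑ a, ∑ b, α i a * Fm (v a b) i j * β b j := by
          intro i j
          change Fm _ i j = _
          simp only [map_sum, map_smul, Matrix.sum_apply, Matrix.smul_apply, smul_eq_mul]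
          refine Finset.sum_congr rfl fun a _ => Finset.sum_congr rfl fun b _ => ?_
          ring
        simp only [this]
        calc _ = ∑ i, ∑ a, ∑ j, ∑ b, α i a * Fm (v a b) i j * β b j :=
              Finset.sum_congr rfl fun i _ => Finset.sum_comm
          _ = ∑ a, ∑ i, ∑ b, ∑ j, α i a * Fm (v a b) i j * β b j := by
              rw [Finset.sum_comm]
              exact Finset.sum_congr rfl fun a _ => Finset.sum_congr rfl fun i _ =>
                Finset.sum_comm
          _ = _ := Finset.sum_congr rfl fun a _ => Finset.sum_comm
      have h2 : ∀ a b, ∑ i, ∑ j, α i a * Fm (v a b) i j * β b j =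
          ∑ i, ∑ j, (R * α) i a * φ (v a b) i j * (β * Sᴴ) b j := by
        intro a b
        have h3 : ∀ {s : ℕ} (X : Matrix (Fin k) (Fin s) ℂ) (Y : Matrix (Fin k) (Fin k) ℂ)
            (Z : Matrix (Fin s) (Fin k) ℂ) (a b : Fin s),
            ∑ i, ∑ j, X i a * Y i j * Z b j = (Xᵀ * Y * Zᵀ) a b := by
          intro s X Y Z a b
          simp only [mul_apply, transpose_apply, Finset.sum_mul]
          exact Finset.sum_comm
        rw [h3, h3, ← hφ]
        simp only [transpose_mul, Matrix.mul_assoc]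
      rw [h1]
      simp only [h2, Fintype.sum_prod_type, amplify, of_apply]
      exact Finset.sum_congr rfl fun a _ => Finset.sum_comm
    have hφc : ∀ (r : ℕ) (v : Matrix (Fin r) (Fin r) E), opNorm (amplify φ v) ≤ N r v := by
      have hunit : ∀ (r : ℕ) (v : Matrix (Fin r) (Fin r) E), N r v ≤ 1 →
          opNorm (amplify φ v) ≤ 1 := by
        intro r v hv
        refine opNorm_le_one_of_bilinear fun ξ η => ?_
        -- Because R and S are invertible, every pair of vectors ξ, η arises as Rα and βS^*.
        let α' : Matrix (Fin k) (Fin r) ℂ := of fun i a => ξ (a, i)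
        let β' : Matrix (Fin r) (Fin k) ℂ := of fun a i => η (a, i)
        have hα : R * (R⁻¹ * α') = α' := mul_nonsing_inv_cancel_left _ _ hRdet
        have hβ : (β' * (Sᴴ)⁻¹) * Sᴴ = β' := nonsing_inv_mul_cancel_right _ _ hSdet'
        have h1 := hpq r (R⁻¹ * α') v (β' * (Sᴴ)⁻¹) hv
        rw [hFs, hα, hβ] at h1
        refine h1.trans (add_le_add ((hR r _).trans (le_of_eq ?_)) ?_)
        · rw [hα, Fintype.sum_prod_type_right]; rfl
        · have h2 := hS r (β' * (Sᴴ)⁻¹)ᴴ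
          rw [conjTranspose_conjTranspose] at h2
          refine h2.trans (le_of_eq ?_)
          have h3 : S * (β' * (Sᴴ)⁻¹)ᴴ = β'ᴴ := by
            rw [← hβ, conjTranspose_mul (β' * (Sᴴ)⁻¹), hβ, conjTranspose_conjTranspose]
          rw [h3, Fintype.sum_prod_type_right]
          simp [β']
      intro r v
      refine le_of_forall_gt_imp_ge_of_dense fun c hc => ?_
      have hc0 : 0 < c := (hN.nonneg r v).trans_lt hc
      have h1 := hunit r ((c⁻¹ : ℂ) • v) (by
        rw [hN.smul_eq, norm_inv, Complex.norm_real, Real.norm_of_nonneg hc0.le,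
          inv_mul_le_iff₀ hc0, mul_one]
        exact hc.le)
      have h2 : amplify φ ((c⁻¹ : ℂ) • v) = (c⁻¹ : ℂ) • amplify φ v := by
        ext x y; simp [amplify]
      rw [h2, opNorm_smul, norm_inv, Complex.norm_real, Real.norm_of_nonneg hc0.le,
        inv_mul_le_iff₀ hc0, mul_one] at h1
      exact h1
    -- For α = β = 1 the test vectors are R and S^* themselves, with squared Hilbert–Schmidt norms
    -- at most 1 + ε; so N k z = F z is at most (1 + ε) times the norm of the amplification of φ at
    -- z.
    have h1 := hFs k 1 z 1
    rw [sandwich_one, Matrix.mul_one, Matrix.one_mul, hFz] at h1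
    have h2 : N k z = ‖((hN.seminorm k z : ℝ) : ℂ)‖ := by
      rw [Complex.norm_real, hN.seminorm_apply, Real.norm_of_nonneg (hN.nonneg k z)]
    rw [h2, h1]
    refine (norm_bilinear_le (amplify φ z) (fun x => R x.2 x.1) (fun y => Sᴴ y.1 y.2)).trans ?_
    have h3 : ∑ x : Fin k × Fin k, ‖R x.2 x.1‖ ^ 2 ≤ 1 + ε := by
      rw [Fintype.sum_prod_type_right]; exact hR1
    have h4 : ∑ x : Fin k × Fin k, ‖Sᴴ x.1 x.2‖ ^ 2 ≤ 1 + ε := by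
      rw [Fintype.sum_prod_type_right]; simpa using hS1
    rw [mul_assoc]
    have h5 : Real.sqrt (∑ x : Fin k × Fin k, ‖R x.2 x.1‖ ^ 2) *
        Real.sqrt (∑ x : Fin k × Fin k, ‖Sᴴ x.1 x.2‖ ^ 2) ≤ 1 + ε := by
      calc _ ≤ Real.sqrt (1 + ε) * Real.sqrt (1 + ε) :=
            mul_le_mul (Real.sqrt_le_sqrt h3) (Real.sqrt_le_sqrt h4) (Real.sqrt_nonneg _)
              (Real.sqrt_nonneg _)
        _ = 1 + ε := Real.mul_self_sqrt (by linarith)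
    exact mul_le_mul (h φ hφc) h5 (by positivity) hD
  refine le_of_forall_gt_imp_ge_of_dense fun c hc => ?_
  -- This ε satisfies D ε ≤ c - D; the denominator D + 1 allows D = 0.
  have h1 := hmain ((c - D) / (D + 1)) (div_pos (by linarith) (by linarith))
  refine h1.trans ?_
  have h2 : D * ((c - D) / (D + 1)) ≤ c - D := by
    rw [mul_div_assoc', div_le_iff₀ (by linarith)]
    nlinarith
  linarith

end Ruan

end OpSp
end

noncomputable section

namespace OpSp

/-! ### Complex interpolation of matrix norms. -/

section Interpolation

open Complex.HadamardThreeLines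

variable {V V' : Type*} [NormedAddCommGroup V] [NormedSpace ℂ V] [NormedAddCommGroup V']
  [NormedSpace ℂ V'] {k k' : ℕ}

attribute [local instance] Matrix.normedAddCommGroup Matrix.normedSpace

/-- The bounded analytic functions on the strip that enter in the definition of `interp`. -/
def IsAdmissible (f : ℂ → Matrix (Fin k) (Fin k) V) : Prop :=
  (∀ i j, DiffContOnCl ℂ (fun z => f z i j) (verticalStrip 0 1)) ∧
    ∃ B : ℝ, ∀ z ∈ verticalClosedStrip 0 1, ∀ i j, ‖f z i j‖ ≤ B

theorem DiffContOnCl.pi {ι : Type*} [Fintype ι] {F : ι → Type*} [∀ i, NormedAddCommGroup (F i)]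
    [∀ i, NormedSpace ℂ (F i)] {f : ℂ → ∀ i, F i} {s : Set ℂ}
    (h : ∀ i, DiffContOnCl ℂ (fun z => f z i) s) : DiffContOnCl ℂ f s :=
  ⟨differentiableOn_pi.2 fun i => (h i).1, continuousOn_pi.2 fun i => (h i).2⟩

theorem isAdmissible_iff {f : ℂ → Matrix (Fin k) (Fin k) V} :
    IsAdmissible f ↔ DiffContOnCl ℂ f (verticalStrip 0 1) ∧
      ∃ B : ℝ, 0 ≤ B ∧ ∀ z ∈ verticalClosedStrip 0 1, ‖f z‖ ≤ B := by
  constructor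
  · rintro ⟨h, B, hB⟩
    refine ⟨DiffContOnCl.pi fun i => DiffContOnCl.pi fun j => h i j, max B 0, le_max_right _ _,
      fun z hz => ?_⟩
    exact (Matrix.norm_le_iff (le_max_right _ _)).2 fun i j => (hB z hz i j).trans (le_max_left _ _)
  · rintro ⟨h, B, hB0, hB⟩
    refine ⟨fun i j => ?_, B, fun z hz i j => (Matrix.norm_entry_le_entrywise_sup_norm _).trans
      (hB z hz)⟩
    exact ⟨fun z hz => differentiableWithinAt_pi.1 (differentiableWithinAt_pi.1 (h.1 z hz) i) j,
      fun z hz => continuousWithinAt_pi.1 (continuousWithinAt_pi.1 (h.2 z hz) i) j⟩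

theorem exists_bound_and_diffContOnCl {X Y : Type*} [NormedAddCommGroup X] [NormedSpace ℂ X]
    [NormedAddCommGroup Y] [NormedSpace ℂ Y] (T : X →ₗ[ℂ] Y) (hT : Continuous T) :
    (∃ C : ℝ, 0 ≤ C ∧ ∀ x, ‖T x‖ ≤ C * ‖x‖) ∧
      ∀ (f : ℂ → X) (s : Set ℂ), DiffContOnCl ℂ f s → DiffContOnCl ℂ (fun z => T (f z)) s :=
  let T' : X →L[ℂ] Y := ⟨T, hT⟩
  ⟨⟨‖T'‖, norm_nonneg _, T'.le_opNorm⟩, fun _ _ hf => T'.differentiable.comp_diffContOnCl hf⟩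

theorem isAdmissible_const (x : Matrix (Fin k) (Fin k) V) : IsAdmissible fun _ => x :=
  isAdmissible_iff.2 ⟨diffContOnCl_const, ‖x‖, norm_nonneg _, fun _ _ => le_rfl⟩

theorem IsAdmissible.add {f g : ℂ → Matrix (Fin k) (Fin k) V} (hf : IsAdmissible f)
    (hg : IsAdmissible g) : IsAdmissible fun z => f z + g z := by
  obtain ⟨hf, B, hB0, hB⟩ := isAdmissible_iff.1 hf
  obtain ⟨hg, B', hB0', hB'⟩ := isAdmissible_iff.1 hg
  exact isAdmissible_iff.2 ⟨hf.add hg, B + B', by positivity, fun z hz =>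
    (norm_add_le _ _).trans (add_le_add (hB z hz) (hB' z hz))⟩

theorem IsAdmissible.map {f : ℂ → Matrix (Fin k) (Fin k) V} (hf : IsAdmissible f)
    {T : Matrix (Fin k) (Fin k) V →ₗ[ℂ] Matrix (Fin k') (Fin k') V'} (hT : Continuous T) :
    IsAdmissible fun z => T (f z) := by
  obtain ⟨hf, B, hB0, hB⟩ := isAdmissible_iff.1 hf
  obtain ⟨⟨C, hC0, hC⟩, hd⟩ := exists_bound_and_diffContOnCl T hT
  exact isAdmissible_iff.2 ⟨hd f _ hf, C * B, by positivity,
    fun z hz => (hC _).trans (mul_le_mul_of_nonneg_left (hB z hz) hC0)⟩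

/-- The scalar function `z ↦ a ^ (θ - z)`. -/
def expScale (a θ : ℝ) (z : ℂ) : ℂ := Complex.exp ((θ - z) * Real.log a)

theorem norm_expScale {a : ℝ} (ha : 0 < a) (θ : ℝ) (z : ℂ) :
    ‖expScale a θ z‖ = a ^ (θ - z.re) := by
  rw [expScale, Complex.norm_exp, Real.rpow_def_of_pos ha]
  congr 1
  simp [mul_comm]

theorem expScale_self (a θ : ℝ) : expScale a θ (θ : ℂ) = 1 := by simp [expScale]

theorem differentiable_expScale (a θ : ℝ) : Differentiable ℂ (expScale a θ) := by
  unfold expScale; fun_prop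

theorem norm_expScale_le (a θ : ℝ) {z : ℂ} (hz : z ∈ verticalClosedStrip 0 1) :
    ‖expScale a θ z‖ ≤ Real.exp ((|θ| + 1) * |Real.log a|) := by
  rw [expScale, Complex.norm_exp]
  refine Real.exp_le_exp.2 ?_
  obtain ⟨h0, h1⟩ := hz
  have : (((θ : ℂ) - z) * (Real.log a : ℂ)).re = (θ - z.re) * Real.log a := by simp
  rw [this]
  refine (le_abs_self _).trans ?_
  rw [abs_mul]
  refine mul_le_mul_of_nonneg_right ?_ (abs_nonneg _)
  refine (abs_sub _ _).trans (add_le_add_right ?_ _)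
  rw [abs_of_nonneg h0]; exact h1

theorem IsAdmissible.expScale_smul {f : ℂ → Matrix (Fin k) (Fin k) V} (hf : IsAdmissible f)
    (a θ : ℝ) : IsAdmissible fun z => expScale a θ z • f z := by
  obtain ⟨hf, B, hB0, hB⟩ := isAdmissible_iff.1 hf
  refine isAdmissible_iff.2 ⟨(differentiable_expScale a θ).diffContOnCl.smul hf,
    Real.exp ((|θ| + 1) * |Real.log a|) * B, by positivity, fun z hz => ?_⟩
  rw [norm_smul]
  exact mul_le_mul (norm_expScale_le a θ hz) (hB z hz) (norm_nonneg _) (Real.exp_pos _).le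

variable {N₀ N₁ : MatNorms V} {N₀' N₁' : MatNorms V'} {θ : ℝ}

theorem interp_nonneg (N₀ N₁ : MatNorms V) (θ : ℝ) (x : Matrix (Fin k) (Fin k) V) :
    0 ≤ interp N₀ N₁ θ k x :=
  Real.sInf_nonneg fun _ hC => hC.1

theorem interp_le {f : ℂ → Matrix (Fin k) (Fin k) V} (hf : IsAdmissible f) {C : ℝ} (hC : 0 ≤ C)
    (h0 : ∀ t : ℝ, N₀ k (f (t * Complex.I)) ≤ C) (h1 : ∀ t : ℝ, N₁ k (f (1 + t * Complex.I)) ≤ C) :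
    interp N₀ N₁ θ k (f θ) ≤ C :=
  csInf_le ⟨0, fun _ h => h.1⟩ ⟨hC, f, hf.1, hf.2, rfl, h0, h1⟩

/-- The constant function x is always a competitor, so the infimum runs over a nonempty set and is
not the default value 0. -/
theorem exists_of_interp_lt {x : Matrix (Fin k) (Fin k) V} {C : ℝ} (h : interp N₀ N₁ θ k x < C) :
    ∃ f : ℂ → Matrix (Fin k) (Fin k) V, IsAdmissible f ∧ f θ = x ∧
      (∀ t : ℝ, N₀ k (f (t * Complex.I)) ≤ C) ∧ ∀ t : ℝ, N₁ k (f (1 + t * Complex.I)) ≤ C := by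
  have hne : {C | 0 ≤ C ∧ ∃ f : ℂ → Matrix (Fin k) (Fin k) V,
      (∀ i j, DiffContOnCl ℂ (fun z => f z i j) (verticalStrip 0 1)) ∧
      (∃ B : ℝ, ∀ z ∈ verticalClosedStrip 0 1, ∀ i j, ‖f z i j‖ ≤ B) ∧
      f (θ : ℂ) = x ∧
      (∀ t : ℝ, N₀ k (f (t * Complex.I)) ≤ C) ∧
      (∀ t : ℝ, N₁ k (f (1 + t * Complex.I)) ≤ C)}.Nonempty :=
    ⟨max 0 (max (N₀ k x) (N₁ k x)), le_max_left _ _, fun _ => x, (isAdmissible_const x).1,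
      (isAdmissible_const x).2, rfl, fun _ => (le_max_left _ _).trans (le_max_right _ _),
      fun _ => (le_max_right _ _).trans (le_max_right _ _)⟩
  obtain ⟨C', ⟨-, f, hf, hB, hx, h0, h1⟩, hC'⟩ := exists_lt_of_csInf_lt hne h
  exact ⟨f, ⟨hf, hB⟩, hx, fun t => (h0 t).trans hC'.le, fun t => (h1 t).trans hC'.le⟩

/-- Let C decrease to I. All norms below are infima that need not be attained, and this is how
bounds pass through them; no sign of K is required. -/
theorem le_mul_of_forall_gt {X K I : ℝ} (h : ∀ C, I < C → X ≤ K * C) : X ≤ K * I := by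
  have h1 : Filter.Tendsto (fun C => K * C) (nhdsWithin I (Set.Ioi I)) (nhds (K * I)) :=
    ((continuous_const.mul continuous_id).tendsto I).mono_left nhdsWithin_le_nhds
  exact ge_of_tendsto h1 (Filter.eventually_of_mem self_mem_nhdsWithin fun C hC => h C hC)

/-- Interpolation of a linear map, with unequal bounds at the two ends. -/
theorem interp_map_le {T : Matrix (Fin k) (Fin k) V →ₗ[ℂ] Matrix (Fin k') (Fin k') V'}
    (hT : Continuous T) {D a : ℝ} (hD : 0 ≤ D) (ha : 0 < a)
    (hom₀ : ∀ (c : ℂ) y, N₀' k' (c • y) ≤ ‖c‖ * N₀' k' y)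
    (hom₁ : ∀ (c : ℂ) y, N₁' k' (c • y) ≤ ‖c‖ * N₁' k' y)
    (h₀ : ∀ x, N₀' k' (T x) ≤ D * N₀ k x) (h₁ : ∀ x, N₁' k' (T x) ≤ D * a * N₁ k x)
    (x : Matrix (Fin k) (Fin k) V) :
    interp N₀' N₁' θ k' (T x) ≤ D * a ^ θ * interp N₀ N₁ θ k x := by
  refine le_mul_of_forall_gt fun C hC => ?_
  have hC0 : 0 ≤ C := (interp_nonneg N₀ N₁ θ x).trans hC.le
  obtain ⟨f, hf, rfl, hf0, hf1⟩ := exists_of_interp_lt hC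
  -- The factor a^(θ-z) is 1 at θ and has modulus a^θ and a^(θ-1) on the two boundary lines; it
  -- evens out the bounds D and D a.
  have hg := (hf.map hT).expScale_smul a θ
  have key := interp_le (θ := θ) (N₀ := N₀') (N₁ := N₁') (C := D * a ^ θ * C) hg (by positivity)
    (fun t => (hom₀ _ _).trans ?_) (fun t => (hom₁ _ _).trans ?_)
  · simpa [expScale_self] using key
  · rw [norm_expScale ha]
    have e : (θ - ((t : ℂ) * Complex.I).re) = θ := by simp
    rw [e]
    calc a ^ θ * N₀' k' (T (f (t * Complex.I))) ≤ a ^ θ * (D * C) :=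
          mul_le_mul_of_nonneg_left ((h₀ _).trans (mul_le_mul_of_nonneg_left (hf0 t) hD))
            (by positivity)
      _ = _ := by ring
  · rw [norm_expScale ha]
    have e : (θ - (1 + (t : ℂ) * Complex.I).re) = θ - 1 := by simp
    rw [e]
    calc a ^ (θ - 1) * N₁' k' (T (f (1 + t * Complex.I))) ≤ a ^ (θ - 1) * (D * a * C) :=
          mul_le_mul_of_nonneg_left ((h₁ _).trans (mul_le_mul_of_nonneg_left (hf1 t)
            (by positivity))) (by positivity)
      _ = D * a ^ θ * C := by
        rw [Real.rpow_sub_one ha.ne']; field_simp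

/-- The competitor is a^(θ-z) x. When the identity has norm at most a from the first space to the
second, this bounds it by a^θ from the first space to the interpolated one. -/
theorem interp_le_of_le {D a : ℝ} (hD : 0 ≤ D) (ha : 0 < a) {x : Matrix (Fin k) (Fin k) V}
    (hom₀ : ∀ (c : ℂ) y, N₀ k (c • y) ≤ ‖c‖ * N₀ k y)
    (hom₁ : ∀ (c : ℂ) y, N₁ k (c • y) ≤ ‖c‖ * N₁ k y)
    (h₀ : N₀ k x ≤ D) (h₁ : N₁ k x ≤ a * D) : interp N₀ N₁ θ k x ≤ a ^ θ * D := by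
  have hg := (isAdmissible_const x).expScale_smul a θ
  have key := interp_le (θ := θ) (N₀ := N₀) (N₁ := N₁) (C := a ^ θ * D) hg (by positivity)
    (fun t => (hom₀ _ _).trans ?_) (fun t => (hom₁ _ _).trans ?_)
  · simpa [expScale_self] using key
  · rw [norm_expScale ha]
    have e : (θ - ((t : ℂ) * Complex.I).re) = θ := by simp
    rw [e]
    exact mul_le_mul_of_nonneg_left h₀ (by positivity)
  · rw [norm_expScale ha]
    have e : (θ - (1 + (t : ℂ) * Complex.I).re) = θ - 1 := by simp
    rw [e]
    refine (mul_le_mul_of_nonneg_left h₁ (by positivity)).trans (le_of_eq ?_)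
    rw [Real.rpow_sub_one ha.ne']; field_simp

theorem continuous_matrix_smul (c : ℂ) :
    Continuous (LinearMap.lsmul ℂ (Matrix (Fin k) (Fin k) V) c) :=
  continuous_const_smul c

theorem interp_smul_le (hom₀ : ∀ (c : ℂ) y, N₀ k (c • y) ≤ ‖c‖ * N₀ k y)
    (hom₁ : ∀ (c : ℂ) y, N₁ k (c • y) ≤ ‖c‖ * N₁ k y) (c : ℂ) (x : Matrix (Fin k) (Fin k) V) :
    interp N₀ N₁ θ k (c • x) ≤ ‖c‖ * interp N₀ N₁ θ k x := by
  have := interp_map_le (θ := θ) (T := LinearMap.lsmul ℂ (Matrix (Fin k) (Fin k) V) c)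
    (continuous_matrix_smul c) (norm_nonneg c) one_pos hom₀ hom₁ (hom₀ c)
    (fun y => by simpa using hom₁ c y) x
  simpa using this

theorem interp_add_le (h₀ : ∀ x y, N₀ k (x + y) ≤ N₀ k x + N₀ k y)
    (h₁ : ∀ x y, N₁ k (x + y) ≤ N₁ k x + N₁ k y) (x y : Matrix (Fin k) (Fin k) V) :
    interp N₀ N₁ θ k (x + y) ≤ interp N₀ N₁ θ k x + interp N₀ N₁ θ k y := by
  refine le_of_forall_pos_le_add fun ε hε => ?_
  have hx : interp N₀ N₁ θ k x < interp N₀ N₁ θ k x + ε / 2 := by linarith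
  have hy : interp N₀ N₁ θ k y < interp N₀ N₁ θ k y + ε / 2 := by linarith
  have hx0 := interp_nonneg N₀ N₁ θ x
  have hy0 := interp_nonneg N₀ N₁ θ y
  obtain ⟨f, hf, hfx, hf0, hf1⟩ := exists_of_interp_lt hx
  obtain ⟨g, hg, hgy, hg0, hg1⟩ := exists_of_interp_lt hy
  have := interp_le (θ := θ) (hf.add hg) (C := interp N₀ N₁ θ k x + ε / 2 +
    (interp N₀ N₁ θ k y + ε / 2)) (by positivity)
    (fun t => (h₀ _ _).trans (add_le_add (hf0 t) (hg0 t)))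
    (fun t => (h₁ _ _).trans (add_le_add (hf1 t) (hg1 t)))
  rw [hfx, hgy] at this
  linarith

/-- A continuous seminorm which is dominated at the two ends is dominated by the interpolated
norm. -/
theorem seminorm_le_interp (M : Seminorm ℂ (Matrix (Fin k) (Fin k) V)) (hM : Continuous M)
    {D a : ℝ} (hD : 0 ≤ D) (ha : 0 < a) (hθ : θ ∈ Set.Icc (0 : ℝ) 1)
    (h₀ : ∀ x, M x ≤ D * N₀ k x) (h₁ : ∀ x, M x ≤ D * a * N₁ k x)
    (x : Matrix (Fin k) (Fin k) V) : M x ≤ D * a ^ θ * interp N₀ N₁ θ k x := by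
  refine le_mul_of_forall_gt fun C hC => ?_
  have hC0 : 0 ≤ C := (interp_nonneg N₀ N₁ θ x).trans hC.le
  obtain ⟨f, hf, hfx, hf0, hf1⟩ := exists_of_interp_lt hC
  -- The target is not interpolated, so f is tested against a functional norming x for M, and the
  -- three lines theorem is applied to a scalar function.
  obtain ⟨F, hFx, hF⟩ := exists_dual_eq_seminorm M x
  have hFc : Continuous F := by
    refine continuous_of_continuousAt_zero F ?_
    rw [ContinuousAt, map_zero]
    refine squeeze_zero_norm hF ?_
    have := hM.tendsto 0
    rwa [map_zero] at this
  obtain ⟨⟨K, hK0, hK⟩, hFd⟩ := exists_bound_and_diffContOnCl F hFc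
  obtain ⟨hf, B, hB0, hB⟩ := isAdmissible_iff.1 hf
  let h : ℂ → ℂ := fun z => expScale a θ z • F (f z)
  have hd : DiffContOnCl ℂ h (verticalStrip 0 1) :=
    (differentiable_expScale a θ).diffContOnCl.smul (hFd f _ hf)
  have hbd : BddAbove ((norm ∘ h) '' verticalClosedStrip 0 1) := by
    refine ⟨Real.exp ((|θ| + 1) * |Real.log a|) * (K * B), ?_⟩
    rintro _ ⟨z, hz, rfl⟩
    simp only [Function.comp, h, norm_smul]
    refine mul_le_mul (norm_expScale_le a θ hz) ?_ (norm_nonneg _) (Real.exp_pos _).le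
    exact (hK _).trans (mul_le_mul_of_nonneg_left (hB z hz) hK0)
  have hz : (θ : ℂ) ∈ verticalClosedStrip 0 1 := by
    simpa [verticalClosedStrip] using hθ
  have hline : ∀ z : ℂ, z = z.re + z.im * Complex.I := fun z => (Complex.re_add_im z).symm
  have key := norm_le_interp_of_mem_verticalClosedStrip₀₁' (a := D * a ^ θ * C)
    (b := D * a ^ θ * C) h hz hd hbd ?_ ?_
  · have e1 : h θ = M x := by simp [h, expScale_self, hfx, hFx]
    rw [e1, Complex.norm_real, Real.norm_of_nonneg (apply_nonneg M x), Complex.ofReal_re] at key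
    refine key.trans (le_of_eq ?_)
    rw [← Real.rpow_add_of_nonneg (by positivity) (by linarith [hθ.2]) hθ.1]
    simp
  · intro z hz
    have hz0 : z.re = 0 := hz
    have ez : z = (z.im : ℂ) * Complex.I := by
      conv_lhs => rw [hline z, hz0]
      simp
    rw [norm_smul, norm_expScale ha, hz0, sub_zero]
    calc a ^ θ * ‖F (f z)‖ ≤ a ^ θ * (D * C) := by
          refine mul_le_mul_of_nonneg_left ((hF _).trans ((h₀ _).trans
            (mul_le_mul_of_nonneg_left ?_ hD))) (by positivity)
          rw [ez]; exact hf0 _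
      _ = _ := by ring
  · intro z hz
    have hz0 : z.re = 1 := hz
    have ez : z = 1 + (z.im : ℂ) * Complex.I := by
      conv_lhs => rw [hline z, hz0]
      simp
    rw [norm_smul, norm_expScale ha, hz0]
    calc a ^ (θ - 1) * ‖F (f z)‖ ≤ a ^ (θ - 1) * (D * a * C) := by
          refine mul_le_mul_of_nonneg_left ((hF _).trans ((h₁ _).trans
            (mul_le_mul_of_nonneg_left ?_ (by positivity)))) (by positivity)
          rw [ez]; exact hf1 _
      _ = _ := by rw [Real.rpow_sub_one ha.ne']; field_simp

end Interpolation

end OpSp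
end

noncomputable section

namespace OpSp

open Matrix

theorem opNorm_fin_one_const (c : ℂ) : opNorm (of fun _ _ => c : Matrix (Fin 1) (Fin 1) ℂ) = ‖c‖ := by
  refine le_antisymm (opNorm_le_of_sum_sq (norm_nonneg c) fun x => ?_)
    (norm_entry_le (of fun _ _ => c : Matrix (Fin 1) (Fin 1) ℂ) 0 0)
  simp [mulVec, dotProduct, mul_pow]

theorem isOperatorSpace_scalarNorms : IsOperatorSpace scalarNorms where
  add_le _ := opNorm_add_le
  smul_eq _ := opNorm_smul
  eq_zero _ _ := opNorm_eq_zero.1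
  one_eq := opNorm_fin_one_const
  directSum_eq k l v w := by
    change opNorm (reindex _ _ _) = _
    rw [opNorm_reindex, opNorm_fromBlocks]; rfl
  sandwich_le k l α w β := by
    have : sandwich α w β = α * w * β := by
      ext i j
      simp only [sandwich, of_apply, mul_apply, Finset.sum_mul, smul_eq_mul]
      rw [Finset.sum_comm]
      exact Finset.sum_congr rfl fun a _ => Finset.sum_congr rfl fun b _ => by ring
    rw [this]
    exact opNorm_mul_mul_le le_rfl le_rfl le_rfl

/-! ### Dual operator space norms. -/

section Dual

variable {V W : Type*} [AddCommGroup V] [Module ℂ V] [AddCommGroup W] [Module ℂ W]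
  {b : V →ₗ[ℂ] W →ₗ[ℂ] ℂ} {N : MatNorms W}

/-- The joint amplification of a pairing, evaluated at matrices over `V` and `W`. -/
def pairMat (b : V →ₗ[ℂ] W →ₗ[ℂ] ℂ) {ι l : Type} (x : Matrix l l V) (A : Matrix ι ι W) :
    Matrix (ι × l) (ι × l) ℂ :=
  of fun i j => b (x i.2 j.2) (A i.1 j.1)

theorem opNorm_pairMat_submatrix {ι ι' l l' : Type} [Fintype ι] [Fintype ι'] [Fintype l]
    [Fintype l'] [DecidableEq ι] [DecidableEq ι'] [DecidableEq l] [DecidableEq l']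
    (x : Matrix l l V) (A : Matrix ι ι W) (f : ι' ≃ ι) (e : l' ≃ l) :
    opNorm (pairMat b (x.submatrix e e) (A.submatrix f f)) = opNorm (pairMat b x A) :=
  opNorm_submatrix_equiv (pairMat b x A) (f.prodCongr e) (f.prodCongr e)

/-- The matrix norms of `W` are nonnegative and every matrix over `V` defines a completely bounded
map on `W`. -/
structure PairingBounded (b : V →ₗ[ℂ] W →ₗ[ℂ] ℂ) (N : MatNorms W) : Prop where
  nonneg : ∀ r (A : Matrix (Fin r) (Fin r) W), 0 ≤ N r A
  exists_bound : ∀ l (x : Matrix (Fin l) (Fin l) V), ∃ C, 0 ≤ C ∧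
    ∀ r (A : Matrix (Fin r) (Fin r) W), opNorm (pairMat b x A) ≤ C * N r A

theorem sInfty_pairingMap {r l : ℕ} (x : Matrix (Fin l) (Fin l) V) (A : Matrix (Fin r) (Fin r) W) :
    sInfty l scalarNorms r (A.map (pairingMap b x)) = opNorm (pairMat b x A) :=
  opNorm_reindex (pairMat b x A) _ _

theorem dualNorms_nonneg (b : V →ₗ[ℂ] W →ₗ[ℂ] ℂ) (N : MatNorms W) {l : ℕ}
    (x : Matrix (Fin l) (Fin l) V) : 0 ≤ dualNorms b N l x :=
  Real.sInf_nonneg fun _ hC => hC.1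

theorem dualNorms_le {l : ℕ} {x : Matrix (Fin l) (Fin l) V} {C : ℝ} (hC : 0 ≤ C)
    (h : ∀ r (A : Matrix (Fin r) (Fin r) W), opNorm (pairMat b x A) ≤ C * N r A) :
    dualNorms b N l x ≤ C :=
  csInf_le ⟨0, fun _ h => h.1⟩ ⟨hC, fun r A => (sInfty_pairingMap x A).trans_le (h r A)⟩

/-- The completely bounded norm is itself an admissible bound. `PairingBounded` ensures that the
infimum defining it is over a nonempty set. -/
theorem opNorm_pairMat_le (hb : PairingBounded b N) {l r : ℕ}
    (x : Matrix (Fin l) (Fin l) V) (A : Matrix (Fin r) (Fin r) W) :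
    opNorm (pairMat b x A) ≤ dualNorms b N l x * N r A := by
  rw [mul_comm]
  refine le_mul_of_forall_gt fun C hC => ?_
  obtain ⟨C₀, hC₀, hb'⟩ := hb.exists_bound l x
  obtain ⟨C', ⟨hC'0, hC'⟩, hlt⟩ := exists_lt_of_csInf_lt
    (s := {C | 0 ≤ C ∧ ∀ k (y : Matrix (Fin k) (Fin k) W),
      sInfty l scalarNorms k (y.map (pairingMap b x)) ≤ C * N k y})
    ⟨C₀, hC₀, fun r A => (sInfty_pairingMap x A).trans_le (hb' r A)⟩ hC
  have h1 : opNorm (pairMat b x A) ≤ C' * N r A := (sInfty_pairingMap x A).symm.trans_le (hC' r A)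
  rw [mul_comm]
  exact h1.trans (mul_le_mul_of_nonneg_right hlt.le (hb.nonneg r A))

theorem dualNorms_smul_le (hb : PairingBounded b N) {l : ℕ} (c : ℂ)
    (x : Matrix (Fin l) (Fin l) V) : dualNorms b N l (c • x) ≤ ‖c‖ * dualNorms b N l x := by
  refine dualNorms_le (mul_nonneg (norm_nonneg c) (dualNorms_nonneg b N x)) fun r A => ?_
  have : pairMat b (c • x) A = c • pairMat b x A := by
    ext i j; simp [pairMat]
  rw [this, opNorm_smul, mul_assoc]
  exact mul_le_mul_of_nonneg_left (opNorm_pairMat_le hb x A) (norm_nonneg c)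

theorem dualNorms_directSum_le (hb : PairingBounded b N) {l m : ℕ}
    (x : Matrix (Fin l) (Fin l) V) (y : Matrix (Fin m) (Fin m) V) :
    dualNorms b N (l + m) (directSum x y) ≤ max (dualNorms b N l x) (dualNorms b N m y) := by
  refine dualNorms_le (le_max_of_le_left (dualNorms_nonneg b N x)) fun r A => ?_
  have h : pairMat b (directSum x y) A =
      (fromBlocks (pairMat b x A) 0 0 (pairMat b y A)).submatrix
        (((Equiv.refl (Fin r)).prodCongr finSumFinEquiv.symm).trans
          (Equiv.prodSumDistrib (Fin r) (Fin l) (Fin m)))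
        (((Equiv.refl (Fin r)).prodCongr finSumFinEquiv.symm).trans
          (Equiv.prodSumDistrib (Fin r) (Fin l) (Fin m))) := by
    ext ⟨i, a⟩ ⟨j, c⟩
    obtain ⟨a, rfl⟩ := finSumFinEquiv.surjective a
    obtain ⟨c, rfl⟩ := finSumFinEquiv.surjective c
    rcases a with a | a <;> rcases c with c | c <;>
      simp [pairMat, directSum, -finSumFinEquiv_apply_left, -finSumFinEquiv_apply_right]
  rw [h, opNorm_submatrix_equiv, opNorm_fromBlocks, max_mul_of_nonneg _ _ (hb.nonneg r A)]
  exact max_le_max (opNorm_pairMat_le hb x A) (opNorm_pairMat_le hb y A)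

open Kronecker in
/-- Dual matrix norms are submultiplicative with respect to scalar matrices. -/
theorem dualNorms_tensor_le (hb : PairingBounded b N) {k l m : ℕ}
    (t : Matrix (Fin k) (Fin k) V) (α : Matrix (Fin k) (Fin l × Fin m) ℂ)
    (x : Matrix (Fin l) (Fin l) V) (y : Matrix (Fin m) (Fin m) ℂ)
    (β : Matrix (Fin l × Fin m) (Fin k) ℂ)
    (ht : ∀ r s, t r s = ∑ a : Fin l × Fin m, ∑ c : Fin l × Fin m,
      (α r a * β c s) • y a.2 c.2 • x a.1 c.1) :
    dualNorms b N k t ≤ opNorm α * dualNorms b N l x * opNorm y * opNorm β := by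
  have hx := dualNorms_nonneg b N x
  refine dualNorms_le (mul_nonneg (mul_nonneg (mul_nonneg (opNorm_nonneg _) hx)
    (opNorm_nonneg _)) (opNorm_nonneg _)) fun r A => ?_
  have h : pairMat b t A = ((1 : Matrix (Fin r) (Fin r) ℂ) ⊗ₖ α) *
      ((pairMat b x A) ⊗ₖ y).submatrix (Equiv.prodAssoc _ _ _).symm (Equiv.prodAssoc _ _ _).symm *
      ((1 : Matrix (Fin r) (Fin r) ℂ) ⊗ₖ β) := by
    ext ⟨i, a⟩ ⟨j, c⟩
    simp only [pairMat, of_apply, ht, mul_apply, Fintype.sum_prod_type (α₁ := Fin r),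
      kroneckerMap_apply, one_apply, ite_mul, one_mul, zero_mul, mul_ite, mul_zero,
      submatrix_apply, Finset.sum_ite_irrel, Finset.sum_const_zero, Finset.sum_ite_eq,
      Finset.sum_ite_eq', Finset.mem_univ, if_true, map_sum, map_smul, LinearMap.sum_apply,
      LinearMap.smul_apply, smul_eq_mul, Equiv.prodAssoc_symm_apply, Finset.sum_mul]
    rw [Finset.sum_comm]
    exact Finset.sum_congr rfl fun _ _ => Finset.sum_congr rfl fun _ _ => by ring
  rw [h]
  refine (opNorm_mul_mul_le (opNorm_one_kronecker_le α)
    ((opNorm_submatrix_equiv _ _ _).trans_le ((opNorm_kronecker_le _ _).trans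
      (mul_le_mul_of_nonneg_right (opNorm_pairMat_le hb x A) (opNorm_nonneg y))))
    (opNorm_one_kronecker_le β)).trans (le_of_eq (by ring))

end Dual

/-! ### Projective tensor norms. -/

section Proj

variable {V W U : Type*} [AddCommGroup V] [Module ℂ V] [AddCommGroup W] [Module ℂ W]
  [AddCommGroup U] [Module ℂ U] {b : V →ₗ[ℂ] W →ₗ[ℂ] U} {N : MatNorms V} {N' : MatNorms W}

theorem projNorms_nonneg (hN : ∀ l x, 0 ≤ N l x) (hN' : ∀ l x, 0 ≤ N' l x) {k : ℕ}
    (t : Matrix (Fin k) (Fin k) U) : 0 ≤ projNorms b N N' k t := by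
  refine Real.sInf_nonneg ?_
  rintro _ ⟨l, m, α, x, y, β, -, rfl⟩
  exact mul_nonneg (mul_nonneg (mul_nonneg (opNorm_nonneg _) (hN _ _)) (hN' _ _)) (opNorm_nonneg _)

/-- Any representation α(x ⊗ y)β is a competitor for the infimum. Arbitrary finite index types are
allowed, so product and sum indices can be used directly. -/
theorem projNorms_le (hN : ∀ l x, 0 ≤ N l x) (hN' : ∀ l x, 0 ≤ N' l x) {k : ℕ}
    {t : Matrix (Fin k) (Fin k) U} {τ ι κ : Type} [Fintype τ] [Fintype ι] [Fintype κ]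
    [DecidableEq τ] [DecidableEq ι] [DecidableEq κ]
    {l m : ℕ} (e : τ ≃ Fin k) (f : ι ≃ Fin l) (g : κ ≃ Fin m) (α : Matrix τ (ι × κ) ℂ)
    (x : Matrix ι ι V) (y : Matrix κ κ W) (β : Matrix (ι × κ) τ ℂ)
    (ht : ∀ r s, t (e r) (e s) = ∑ a : ι × κ, ∑ c : ι × κ,
      (α r a * β c s) • b (x a.1 c.1) (y a.2 c.2)) :
    projNorms b N N' k t ≤ opNorm α * N l (x.submatrix f.symm f.symm) *
      N' m (y.submatrix g.symm g.symm) * opNorm β := by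
  refine csInf_le ⟨0, ?_⟩ ⟨l, m, α.submatrix e.symm (f.prodCongr g).symm,
    x.submatrix f.symm f.symm, y.submatrix g.symm g.symm, β.submatrix (f.prodCongr g).symm e.symm, fun r s => ?_, ?_⟩
  · rintro _ ⟨l, m, α, x, y, β, -, rfl⟩
    exact mul_nonneg (mul_nonneg (mul_nonneg (opNorm_nonneg _) (hN _ _)) (hN' _ _))
      (opNorm_nonneg _)
  · have := ht (e.symm r) (e.symm s)
    simp only [Equiv.apply_symm_apply] at this
    rw [this, ← (f.prodCongr g).symm.sum_comp]
    refine Finset.sum_congr rfl fun a _ => ?_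
    rw [← (f.prodCongr g).symm.sum_comp]
    rfl
  · rw [opNorm_submatrix_equiv, opNorm_submatrix_equiv]

/-- Every matrix over `U` is of the form that enters in the definition of `projNorms`. -/
def ProjSpanning (b : V →ₗ[ℂ] W →ₗ[ℂ] U) : Prop :=
  ∀ k (t : Matrix (Fin k) (Fin k) U), ∃ (l m : ℕ) (α : Matrix (Fin k) (Fin l × Fin m) ℂ)
    (x : Matrix (Fin l) (Fin l) V) (y : Matrix (Fin m) (Fin m) W)
    (β : Matrix (Fin l × Fin m) (Fin k) ℂ), ∀ r s, t r s = ∑ a : Fin l × Fin m,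
      ∑ c : Fin l × Fin m, (α r a * β c s) • b (x a.1 c.1) (y a.2 c.2)

theorem exists_of_projNorms_lt (hb : ProjSpanning b) {k : ℕ} {t : Matrix (Fin k) (Fin k) U} {C : ℝ}
    (h : projNorms b N N' k t < C) :
    ∃ (l m : ℕ) (α : Matrix (Fin k) (Fin l × Fin m) ℂ)
      (x : Matrix (Fin l) (Fin l) V) (y : Matrix (Fin m) (Fin m) W)
      (β : Matrix (Fin l × Fin m) (Fin k) ℂ), (∀ r s, t r s = ∑ a : Fin l × Fin m,
        ∑ c : Fin l × Fin m, (α r a * β c s) • b (x a.1 c.1) (y a.2 c.2)) ∧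
      opNorm α * N l x * N' m y * opNorm β < C := by
  obtain ⟨l, m, α, x, y, β, ht⟩ := hb k t
  obtain ⟨_, ⟨l, m, α, x, y, β, ht, rfl⟩, hlt⟩ := exists_lt_of_csInf_lt
    (s := {C | ∃ (l m : ℕ) (α : Matrix (Fin k) (Fin l × Fin m) ℂ)
      (x : Matrix (Fin l) (Fin l) V) (y : Matrix (Fin m) (Fin m) W)
      (β : Matrix (Fin l × Fin m) (Fin k) ℂ), (∀ r s, t r s = ∑ a : Fin l × Fin m,
        ∑ c : Fin l × Fin m, (α r a * β c s) • b (x a.1 c.1) (y a.2 c.2)) ∧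
      C = opNorm α * N l x * N' m y * opNorm β}) ⟨_, l, m, α, x, y, β, ht, rfl⟩ h
  exact ⟨l, m, α, x, y, β, ht, hlt⟩

theorem projNorms_smul_le (hb : ProjSpanning b) (hN : ∀ l x, 0 ≤ N l x) (hN' : ∀ l x, 0 ≤ N' l x)
    {k : ℕ} (c : ℂ) (t : Matrix (Fin k) (Fin k) U) :
    projNorms b N N' k (c • t) ≤ ‖c‖ * projNorms b N N' k t := by
  refine le_mul_of_forall_gt fun C hC => ?_
  obtain ⟨l, m, α, x, y, β, ht, hlt⟩ := exists_of_projNorms_lt hb hC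
  refine (projNorms_le hN hN' (Equiv.refl _) (Equiv.refl _) (Equiv.refl _) (c • α) x y β
    fun r s => ?_).trans ?_
  · simp only [Equiv.refl_apply, Matrix.smul_apply, ht, Finset.smul_sum, smul_smul, smul_eq_mul, mul_assoc]
  · rw [opNorm_smul]
    refine le_trans (le_of_eq ?_) (mul_le_mul_of_nonneg_left hlt.le (norm_nonneg c))
    simp only [mul_assoc]; rfl

/-- Replaces norms that may vanish by larger factors, positive when the norms are nonnegative, by
which one can divide. -/
theorem exists_add_mul_lt {a b c d C : ℝ} (h : a * b * c * d < C) :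
    ∃ δ : ℝ, 0 < δ ∧ (a + δ) * (b + δ) * (c + δ) * (d + δ) < C := by
  have h1 : Filter.Tendsto (fun δ : ℝ => (a + δ) * (b + δ) * (c + δ) * (d + δ))
      (nhdsWithin 0 (Set.Ioi 0)) (nhds ((a + 0) * (b + 0) * (c + 0) * (d + 0))) := by
    have : Continuous fun δ : ℝ => (a + δ) * (b + δ) * (c + δ) * (d + δ) := by fun_prop
    exact (this.tendsto 0).mono_left nhdsWithin_le_nhds
  simp only [add_zero] at h1
  obtain ⟨δ, hδ, hδ'⟩ := ((h1.eventually (gt_mem_nhds h)).and self_mem_nhdsWithin).exists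
  exact ⟨δ, hδ', hδ⟩

/-- By homogeneity all the size can be moved to α and β, in equal shares √C. Direct sums of
representations in this form have bounds that add up. -/
theorem exists_normalized_of_projNorms_lt (hb : ProjSpanning b) (hN : ∀ l x, 0 ≤ N l x)
    (hN' : ∀ l x, 0 ≤ N' l x) (hom : ∀ l (c : ℂ) x, N l (c • x) ≤ ‖c‖ * N l x)
    (hom' : ∀ l (c : ℂ) x, N' l (c • x) ≤ ‖c‖ * N' l x) {k : ℕ} {t : Matrix (Fin k) (Fin k) U}
    {C : ℝ} (h : projNorms b N N' k t < C) :
    ∃ (l m : ℕ) (α : Matrix (Fin k) (Fin l × Fin m) ℂ)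
      (x : Matrix (Fin l) (Fin l) V) (y : Matrix (Fin m) (Fin m) W)
      (β : Matrix (Fin l × Fin m) (Fin k) ℂ), (∀ r s, t r s = ∑ a : Fin l × Fin m,
        ∑ c : Fin l × Fin m, (α r a * β c s) • b (x a.1 c.1) (y a.2 c.2)) ∧
      N l x ≤ 1 ∧ N' m y ≤ 1 ∧ opNorm α ^ 2 ≤ C ∧ opNorm β ^ 2 ≤ C := by
  have hC : 0 < C := (projNorms_nonneg hN hN' t).trans_lt h
  obtain ⟨l, m, α, x, y, β, ht, hlt⟩ := exists_of_projNorms_lt hb h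
  obtain ⟨δ, hδ, hlt⟩ := exists_add_mul_lt hlt
  set a := opNorm α + δ with ha
  set p := N l x + δ with hp
  set q := N' m y + δ with hq
  set d := opNorm β + δ with hd
  have ha0 : 0 < a := add_pos_of_nonneg_of_pos (opNorm_nonneg α) hδ
  have hp0 : 0 < p := add_pos_of_nonneg_of_pos (hN l x) hδ
  have hq0 : 0 < q := add_pos_of_nonneg_of_pos (hN' m y) hδ
  have hd0 : 0 < d := add_pos_of_nonneg_of_pos (opNorm_nonneg β) hδ
  have hsC : 0 < Real.sqrt C := Real.sqrt_pos.2 hC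
  have hnorm : ∀ r : ℝ, 0 < r → ‖(r : ℂ)‖ = r := fun r hr => by
    rw [Complex.norm_real, Real.norm_of_nonneg hr.le]
  have hu : 0 < Real.sqrt C / a := by positivity
  have hv : 0 < p * q * a / Real.sqrt C := by positivity
  -- The four scalars multiply to 1, so the represented matrix is unchanged.
  refine ⟨l, m, ((Real.sqrt C / a : ℝ) : ℂ) • α, ((p⁻¹ : ℝ) : ℂ) • x, ((q⁻¹ : ℝ) : ℂ) • y,
    ((p * q * a / Real.sqrt C : ℝ) : ℂ) • β, fun r s => ?_, ?_, ?_, ?_, ?_⟩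
  · rw [ht]
    refine Finset.sum_congr rfl fun i _ => Finset.sum_congr rfl fun j _ => ?_
    simp only [Matrix.smul_apply, map_smul, LinearMap.smul_apply, smul_smul, smul_eq_mul]
    congr 1
    have : ((Real.sqrt C / a : ℝ) : ℂ) * ((p * q * a / Real.sqrt C : ℝ) : ℂ) *
        ((p⁻¹ : ℝ) : ℂ) * ((q⁻¹ : ℝ) : ℂ) = 1 := by
      rw [← Complex.ofReal_mul, ← Complex.ofReal_mul, ← Complex.ofReal_mul,
        ← Complex.ofReal_one]
      congr 1
      field_simp
    calc α r i * β j s = 1 * (α r i * β j s) := (one_mul _).symm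
      _ = _ := by rw [← this]; ring
  · refine (hom _ _ _).trans ?_
    rw [hnorm _ (inv_pos.2 hp0), inv_mul_le_iff₀ hp0, mul_one]
    linarith
  · refine (hom' _ _ _).trans ?_
    rw [hnorm _ (inv_pos.2 hq0), inv_mul_le_iff₀ hq0, mul_one]
    linarith
  · rw [opNorm_smul, hnorm _ hu]
    calc (Real.sqrt C / a * opNorm α) ^ 2 ≤ (Real.sqrt C / a * a) ^ 2 := by
          have := opNorm_nonneg α
          gcongr
          linarith
      _ = C := by rw [div_mul_cancel₀ _ ha0.ne', Real.sq_sqrt hC.le]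
  · rw [opNorm_smul, hnorm _ hv]
    have h1 : p * q * a / Real.sqrt C * opNorm β ≤ Real.sqrt C := by
      rw [div_mul_eq_mul_div, div_le_iff₀ hsC, Real.mul_self_sqrt hC.le]
      calc p * q * a * opNorm β ≤ p * q * a * d := by gcongr; linarith
        _ = a * p * q * d := by ring
        _ ≤ C := hlt.le
    calc _ ≤ Real.sqrt C ^ 2 := by
          have := opNorm_nonneg β
          gcongr
      _ = C := Real.sq_sqrt hC.le

/-- Two normalised representations are placed in orthogonal blocks: x ⊕ x' and y ⊕ y' remain
contractive, A and B vanish on the mixed indices, so AA^* = αα^* + α'α'^* and likewise for B;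
finally ‖A‖‖B‖ ≤ (‖A‖² + ‖B‖²)/2. -/
theorem projNorms_add_le (hb : ProjSpanning b) (hN : ∀ l x, 0 ≤ N l x)
    (hN' : ∀ l x, 0 ≤ N' l x) (hom : ∀ l (c : ℂ) x, N l (c • x) ≤ ‖c‖ * N l x)
    (hom' : ∀ l (c : ℂ) x, N' l (c • x) ≤ ‖c‖ * N' l x)
    (hsum : ∀ l m x y, N (l + m) (directSum x y) ≤ max (N l x) (N m y))
    (hsum' : ∀ l m x y, N' (l + m) (directSum x y) ≤ max (N' l x) (N' m y)) {k : ℕ}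
    (t t' : Matrix (Fin k) (Fin k) U) :
    projNorms b N N' k (t + t') ≤ projNorms b N N' k t + projNorms b N N' k t' := by
  refine le_of_forall_pos_le_add fun ε hε => ?_
  set C := projNorms b N N' k t + ε / 2 with hC
  set C' := projNorms b N N' k t' + ε / 2 with hC'
  have h1 : projNorms b N N' k t < C := by linarith
  have h2 : projNorms b N N' k t' < C' := by linarith
  have hC0 : 0 < C := (projNorms_nonneg hN hN' t).trans_lt h1
  have hC0' : 0 < C' := (projNorms_nonneg hN hN' t').trans_lt h2
  obtain ⟨l, m, α, x, y, β, ht, hx, hy, hα, hβ⟩ :=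
    exists_normalized_of_projNorms_lt hb hN hN' hom hom' h1
  obtain ⟨l', m', α', x', y', β', ht', hx', hy', hα', hβ'⟩ :=
    exists_normalized_of_projNorms_lt hb hN hN' hom hom' h2
  let A : Matrix (Fin k) ((Fin l ⊕ Fin l') × (Fin m ⊕ Fin m')) ℂ := of fun r a =>
    Sum.elim (fun i => Sum.elim (fun j => α r (i, j)) (fun _ => 0) a.2)
      (fun i => Sum.elim (fun _ => 0) (fun j => α' r (i, j)) a.2) a.1
  let B : Matrix ((Fin l ⊕ Fin l') × (Fin m ⊕ Fin m')) (Fin k) ℂ := of fun a r =>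
    Sum.elim (fun i => Sum.elim (fun j => β (i, j) r) (fun _ => 0) a.2)
      (fun i => Sum.elim (fun _ => 0) (fun j => β' (i, j) r) a.2) a.1
  have hA : opNorm A ^ 2 ≤ C + C' := by
    have : A * Aᴴ = α * αᴴ + α' * α'ᴴ := by
      ext i j
      simp [A, mul_apply, Fintype.sum_prod_type]
    rw [← opNorm_mul_conjTranspose_self, this]
    refine (opNorm_add_le _ _).trans ?_
    rw [opNorm_mul_conjTranspose_self, opNorm_mul_conjTranspose_self]
    exact add_le_add hα hα'
  have hB : opNorm B ^ 2 ≤ C + C' := by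
    have : Bᴴ * B = βᴴ * β + β'ᴴ * β' := by
      ext i j
      simp [B, mul_apply, Fintype.sum_prod_type]
    rw [← opNorm_conjTranspose_mul_self, this]
    refine (opNorm_add_le _ _).trans ?_
    rw [opNorm_conjTranspose_mul_self, opNorm_conjTranspose_mul_self]
    exact add_le_add hβ hβ'
  have key := projNorms_le (b := b) (t := t + t') hN hN' (Equiv.refl _) finSumFinEquiv
    finSumFinEquiv A (fromBlocks x 0 0 x') (fromBlocks y 0 0 y') B fun r s => by
      simp [A, B, ht, ht', Fintype.sum_prod_type]
  refine key.trans ?_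
  have hX : N (l + l') ((fromBlocks x 0 0 x').submatrix finSumFinEquiv.symm
      finSumFinEquiv.symm) ≤ 1 := (hsum l l' x x').trans (max_le hx hx')
  have hY : N' (m + m') ((fromBlocks y 0 0 y').submatrix finSumFinEquiv.symm
      finSumFinEquiv.symm) ≤ 1 := (hsum' m m' y y').trans (max_le hy hy')
  have hA0 := opNorm_nonneg A
  have hB0 := opNorm_nonneg B
  calc _ ≤ opNorm A * 1 * 1 * opNorm B := by
        refine mul_le_mul_of_nonneg_right (mul_le_mul (mul_le_mul_of_nonneg_left hX hA0) hY
          (hN' _ _) (by simpa using hA0)) hB0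
    _ ≤ C + C' := by nlinarith [sq_nonneg (opNorm A - opNorm B)]
    _ = _ := by rw [hC, hC']; ring

end Proj

/-- The projective tensor product of a dual operator space with `ℂ`. -/
theorem projNorms_scalar_eq_dualNorms {V W : Type*} [AddCommGroup V] [Module ℂ V] [AddCommGroup W]
    [Module ℂ W] {b : V →ₗ[ℂ] W →ₗ[ℂ] ℂ} {N : MatNorms W} (hb : PairingBounded b N)
    {m : V →ₗ[ℂ] ℂ →ₗ[ℂ] V} (hm : ∀ v c, m v c = c • v) :
    projNorms m (dualNorms b N) scalarNorms = dualNorms b N := by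
  have hN : ∀ l (x : Matrix (Fin l) (Fin l) V), 0 ≤ dualNorms b N l x :=
    fun l x => dualNorms_nonneg b N x
  have hN' : ∀ l (x : Matrix (Fin l) (Fin l) ℂ), 0 ≤ scalarNorms l x := fun l x => opNorm_nonneg x
  have hrep : ∀ k (t : Matrix (Fin k) (Fin k) V) (r s : Fin k), t r s =
      ∑ a : Fin k × Fin 1, ∑ c : Fin k × Fin 1,
        ((1 : Matrix (Fin k) (Fin k) ℂ).submatrix id (Equiv.prodUnique (Fin k) (Fin 1)) r a *
          (1 : Matrix (Fin k) (Fin k) ℂ).submatrix (Equiv.prodUnique (Fin k) (Fin 1)) id c s) •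
        m (t a.1 c.1) ((of fun _ _ => (1 : ℂ) : Matrix (Fin 1) (Fin 1) ℂ) a.2 c.2) := by
    intro k t r s
    simp [Fintype.sum_prod_type, hm, one_apply, ite_smul]
  funext k t
  -- One direction uses the representation 1 (t ⊗ 1) 1; the other bounds every representation by
  -- `dualNorms_tensor_le`.
  refine le_antisymm ?_ ?_
  · let e : Fin k × Fin 1 ≃ Fin k := Equiv.prodUnique (Fin k) (Fin 1)
    have key := projNorms_le (b := m) (t := t) hN hN' (Equiv.refl _) (Equiv.refl _) (Equiv.refl _)
      ((1 : Matrix (Fin k) (Fin k) ℂ).submatrix id e) t (of fun _ _ => (1 : ℂ))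
      ((1 : Matrix (Fin k) (Fin k) ℂ).submatrix e id) (hrep k t)
    refine key.trans ?_
    have h1 : opNorm ((1 : Matrix (Fin k) (Fin k) ℂ).submatrix id e) ≤ 1 :=
      opNorm_one_submatrix_le e e.injective
    have h2 : opNorm ((1 : Matrix (Fin k) (Fin k) ℂ).submatrix e id) ≤ 1 :=
      (opNorm_submatrix_le _ e id e.injective Function.injective_id).trans opNorm_one_le
    have h3 : scalarNorms 1 ((of fun _ _ => (1 : ℂ)).submatrix (Equiv.refl (Fin 1)).symm
        (Equiv.refl (Fin 1)).symm) = 1 := (opNorm_fin_one_const 1).trans norm_one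
    rw [h3, mul_one]
    have h4 := hN k t
    have h5 := opNorm_nonneg ((1 : Matrix (Fin k) (Fin k) ℂ).submatrix e id)
    calc _ ≤ 1 * dualNorms b N k t * 1 :=
          mul_le_mul (mul_le_mul_of_nonneg_right h1 h4) h2 h5 (by simpa using h4)
      _ = _ := by ring
  · refine le_of_forall_gt_imp_ge_of_dense fun C hC => ?_
    obtain ⟨l, n, α, x, y, β, ht, hlt⟩ := exists_of_projNorms_lt
      (fun k t => ⟨k, 1, _, t, _, _, hrep k t⟩) hC
    refine (dualNorms_tensor_le hb t α x y β fun r s => ?_).trans hlt.le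
    simp only [ht, hm]

end OpSp
end

noncomputable section

set_option linter.unusedSectionVars false

namespace OpSp

open Matrix

/-! ### The trace and sum dualities; representations in S_1^n ⊗^ E and ℓ_1 ⊗^ E. -/

section Concrete

variable {n : ℕ} {κ : Type} [Fintype κ]

theorem tracePairing_apply (B C : Matrix (Fin n) (Fin n) ℂ) :
    tracePairing n B C = ∑ p, ∑ q, B p q * C p q := by
  simp [tracePairing, trace, mul_apply]

theorem sumPairing_apply (b c : κ → ℂ) : sumPairing κ b c = ∑ i, b i * c i := rfl

theorem sInfty_scalarNorms (r : ℕ) (A : Matrix (Fin r) (Fin r) (Matrix (Fin n) (Fin n) ℂ)) :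
    sInfty n scalarNorms r A = opNorm (comp (Fin r) (Fin r) (Fin n) (Fin n) ℂ A) :=
  opNorm_reindex _ _ _

open Kronecker in
-- The pairing is a finite sum of Kronecker products of entry blocks, and each block of A is a
-- submatrix of A. Only finiteness of the constant matters.
theorem pairingBounded_trace (n : ℕ) : PairingBounded (tracePairing n) (sInfty n scalarNorms) where
  nonneg r A := (sInfty_scalarNorms r A).symm ▸ opNorm_nonneg _
  exists_bound l x := by
    refine ⟨∑ p, ∑ q, opNorm (of fun a c => x a c p q), Finset.sum_nonneg fun p _ =>
      Finset.sum_nonneg fun q _ => opNorm_nonneg _, fun r A => ?_⟩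
    have h : pairMat (tracePairing n) x A =
        ∑ p, ∑ q, (of fun i j => A i j p q) ⊗ₖ (of fun a c => x a c p q) := by
      ext i j
      simp [pairMat, tracePairing_apply, Matrix.sum_apply, mul_comm]
    have hsum : ∀ (M : Fin n → Matrix (Fin r × Fin l) (Fin r × Fin l) ℂ),
        opNorm (∑ p, M p) ≤ ∑ p, opNorm (M p) := fun M =>
      Finset.le_sum_of_subadditive opNorm opNorm_zero.le opNorm_add_le _ _
    rw [h, Finset.sum_mul]
    refine (hsum _).trans (Finset.sum_le_sum fun p _ => ?_)
    rw [Finset.sum_mul]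
    refine (hsum _).trans (Finset.sum_le_sum fun q _ => (opNorm_kronecker_le _ _).trans ?_)
    rw [mul_comm, sInfty_scalarNorms]
    refine mul_le_mul_of_nonneg_left ?_ (opNorm_nonneg _)
    exact opNorm_submatrix_le (comp (Fin r) (Fin r) (Fin n) (Fin n) ℂ A) (fun i => (i, p))
      (fun i => (i, q)) (fun i j h => (Prod.mk.inj h).1) (fun i j h => (Prod.mk.inj h).1)

theorem sOne_nonneg (l : ℕ) (x : Matrix (Fin l) (Fin l) (Matrix (Fin n) (Fin n) ℂ)) :
    0 ≤ sOne n l x := dualNorms_nonneg _ _ x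

theorem opNorm_pairMat_trace_le {ι L : Type} [Fintype ι] [Fintype L] [DecidableEq ι]
    [DecidableEq L] {l : ℕ} (f : L ≃ Fin l) (x : Matrix L L (Matrix (Fin n) (Fin n) ℂ))
    (A : Matrix ι ι (Matrix (Fin n) (Fin n) ℂ)) :
    opNorm (pairMat (tracePairing n) x A) ≤
      sOne n l (x.submatrix f.symm f.symm) * opNorm (comp ι ι (Fin n) (Fin n) ℂ A) := by
  let e := (Fintype.equivFin ι).symm
  have h := opNorm_pairMat_le (pairingBounded_trace n) (x.submatrix f.symm f.symm)
    (A.submatrix e e)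
  rw [opNorm_pairMat_submatrix, sInfty_scalarNorms] at h
  refine h.trans (le_of_eq ?_)
  congr 1
  exact opNorm_submatrix_equiv (comp ι ι (Fin n) (Fin n) ℂ A) (e.prodCongr (Equiv.refl _))
    (e.prodCongr (Equiv.refl _))

theorem sOne_le {L : Type} [Fintype L] [DecidableEq L] {l : ℕ} (f : L ≃ Fin l)
    {x : Matrix L L (Matrix (Fin n) (Fin n) ℂ)} {C : ℝ} (hC : 0 ≤ C)
    (h : ∀ r (A : Matrix (Fin r) (Fin r) (Matrix (Fin n) (Fin n) ℂ)),
      opNorm (pairMat (tracePairing n) x A) ≤ C * opNorm (comp (Fin r) (Fin r) (Fin n) (Fin n) ℂ A)) :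
    sOne n l (x.submatrix f.symm f.symm) ≤ C := by
  refine dualNorms_le hC fun r A => ?_
  rw [sInfty_scalarNorms]
  refine le_trans (le_of_eq ?_) (h r A)
  exact opNorm_pairMat_submatrix x A (Equiv.refl _) f.symm

theorem le_ellInfty {E : Type*} (N : MatNorms E) {r : ℕ} (x : Matrix (Fin r) (Fin r) (κ → E))
    (c : κ) : N r (x.map fun v => v c) ≤ ellInfty κ N r x :=
  le_ciSup (f := fun c => N r (x.map fun v => v c)) (Set.finite_range _).bddAbove c

theorem ellInfty_nonneg {E : Type*} {N : MatNorms E} (hN : ∀ r x, 0 ≤ N r x) {r : ℕ}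
    (x : Matrix (Fin r) (Fin r) (κ → E)) : 0 ≤ ellInfty κ N r x :=
  Real.iSup_nonneg fun _ => hN _ _

open Kronecker in
theorem pairingBounded_sum (κ : Type) [Fintype κ] :
    PairingBounded (sumPairing κ) (ellInfty κ scalarNorms) where
  nonneg r A := ellInfty_nonneg (fun _ _ => opNorm_nonneg _) A
  exists_bound l x := by
    refine ⟨∑ c, opNorm (of fun a d => x a d c), Finset.sum_nonneg fun p _ => opNorm_nonneg _,
      fun r A => ?_⟩
    have h : pairMat (sumPairing κ) x A =
        ∑ c, (A.map fun v => v c) ⊗ₖ (of fun a d => x a d c) := by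
      ext i j
      simp [pairMat, sumPairing_apply, Matrix.sum_apply, mul_comm]
    rw [h, Finset.sum_mul]
    refine (Finset.le_sum_of_subadditive opNorm opNorm_zero.le opNorm_add_le _ _).trans
      (Finset.sum_le_sum fun c _ => (opNorm_kronecker_le _ _).trans ?_)
    rw [mul_comm]
    exact mul_le_mul_of_nonneg_left (le_ellInfty scalarNorms A c) (opNorm_nonneg _)

theorem ellOne_nonneg (l : ℕ) (x : Matrix (Fin l) (Fin l) (κ → ℂ)) :
    0 ≤ ellOne κ l x := dualNorms_nonneg _ _ x

theorem opNorm_pairMat_sum_le {ι L : Type} [Fintype ι] [Fintype L] [DecidableEq ι]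
    [DecidableEq L] {l : ℕ} (f : L ≃ Fin l) (x : Matrix L L (κ → ℂ))
    (A : Matrix ι ι (κ → ℂ)) {M : ℝ} (hM : 0 ≤ M)
    (hA : ∀ c, opNorm (A.map fun v => v c) ≤ M) :
    opNorm (pairMat (sumPairing κ) x A) ≤ ellOne κ l (x.submatrix f.symm f.symm) * M := by
  let e := (Fintype.equivFin ι).symm
  have h := opNorm_pairMat_le (pairingBounded_sum κ) (x.submatrix f.symm f.symm)
    (A.submatrix e e)
  rw [opNorm_pairMat_submatrix] at h
  refine h.trans (mul_le_mul_of_nonneg_left ?_ (ellOne_nonneg _ _))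
  exact Real.iSup_le (fun c => (opNorm_submatrix_equiv (A.map fun v => v c) e e).trans_le (hA c)) hM

theorem ellOne_le {L : Type} [Fintype L] [DecidableEq L] {l : ℕ} (f : L ≃ Fin l)
    {x : Matrix L L (κ → ℂ)} {C : ℝ} (hC : 0 ≤ C)
    (h : ∀ r (A : Matrix (Fin r) (Fin r) (κ → ℂ)) (M : ℝ), 0 ≤ M →
      (∀ c, opNorm (A.map fun v => v c) ≤ M) → opNorm (pairMat (sumPairing κ) x A) ≤ C * M) :
    ellOne κ l (x.submatrix f.symm f.symm) ≤ C := by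
  refine dualNorms_le hC fun r A => ?_
  refine le_trans (le_of_eq ?_) (h r A (ellInfty κ scalarNorms r A)
    (ellInfty_nonneg (fun _ _ => opNorm_nonneg _) A) fun c => le_ellInfty scalarNorms A c)
  exact opNorm_pairMat_submatrix x A (Equiv.refl _) f.symm

theorem projSpanning_of_exists {V W U : Type*} [AddCommGroup V] [Module ℂ V] [AddCommGroup W]
    [Module ℂ W] [AddCommGroup U] [Module ℂ U] {b : V →ₗ[ℂ] W →ₗ[ℂ] U}
    (h : ∀ k (t : Matrix (Fin k) (Fin k) U), ∃ (ι κ : Type) (_ : Fintype ι) (_ : Fintype κ)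
      (α : Matrix (Fin k) (ι × κ) ℂ) (x : Matrix ι ι V) (y : Matrix κ κ W)
      (β : Matrix (ι × κ) (Fin k) ℂ), ∀ r s, t r s = ∑ a : ι × κ, ∑ c : ι × κ,
        (α r a * β c s) • b (x a.1 c.1) (y a.2 c.2)) : ProjSpanning b := by
  intro k t
  obtain ⟨ι, κ, _, _, α, x, y, β, ht⟩ := h k t
  let f := Fintype.equivFin ι
  let g := Fintype.equivFin κ
  refine ⟨_, _, α.submatrix id (f.prodCongr g).symm, x.submatrix f.symm f.symm,
    y.submatrix g.symm g.symm, β.submatrix (f.prodCongr g).symm id, fun r s => ?_⟩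
  rw [ht, ← (f.prodCongr g).symm.sum_comp]
  refine Finset.sum_congr rfl fun a _ => ?_
  rw [← (f.prodCongr g).symm.sum_comp]
  rfl

section MatTensor

variable {E : Type*} [AddCommGroup E] [Module ℂ E]

theorem sum_sum_ite_smul {ι ρ : Type} [Fintype ι] [Fintype ρ] [DecidableEq ρ] {X : Type*}
    [AddCommGroup X] [Module ℂ X] (g : ι × ρ → ι × ρ → X) (u v : ι → ρ) :
    ∑ a : ι × ρ, ∑ c : ι × ρ, ((if a.2 = u a.1 then (1 : ℂ) else 0) *
      (if c.2 = v c.1 then (1 : ℂ) else 0)) • g a c = ∑ i, ∑ j, g (i, u i) (j, v j) := by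
  rw [Fintype.sum_prod_type]
  refine Finset.sum_congr rfl fun i _ => ?_
  rw [Finset.sum_eq_single (u i) (fun b _ hb => by simp [hb]) (by simp), Fintype.sum_prod_type]
  refine Finset.sum_congr rfl fun j _ => ?_
  rw [Finset.sum_eq_single (v j) (fun b _ hb => by simp [hb]) (by simp)]
  simp

/-- The row matrix with entries `δ_{r r'} δ_{i i'}` at `(r, (i, (r', i')))`. -/
def flipRow (n k : ℕ) : Matrix (Fin k) (Fin n × (Fin k × Fin n)) ℂ :=
  of fun r a => if a.2 = (r, a.1) then 1 else 0

theorem conjTranspose_flipRow_apply (n k : ℕ) (a : Fin n × (Fin k × Fin n)) (r : Fin k) :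
    (flipRow n k)ᴴ a r = if a.2 = (r, a.1) then 1 else 0 := by
  simp [flipRow, apply_ite]

/-- This is ∑ e_ij ⊗ t_ij, cut out of (e_ij) ⊗ t by `flipRow`, which keeps only those positions
where the index of the matrix unit agrees with the M_n-index of t. -/
theorem matTensor_representation {k : ℕ} (t : Matrix (Fin k) (Fin k) (Matrix (Fin n) (Fin n) E))
    (r s : Fin k) :
    t r s = ∑ a : Fin n × (Fin k × Fin n), ∑ c : Fin n × (Fin k × Fin n),
      (flipRow n k r a * (flipRow n k)ᴴ c s) • matTensor n E ((of fun i j => single i j 1 :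
        Matrix (Fin n) (Fin n) (Matrix (Fin n) (Fin n) ℂ)) a.1 c.1)
        (comp (Fin k) (Fin k) (Fin n) (Fin n) E t a.2 c.2) := by
  simp only [conjTranspose_flipRow_apply]
  refine Eq.trans ?_ (sum_sum_ite_smul (fun a c => matTensor n E (single a.1 c.1 1)
    (comp (Fin k) (Fin k) (Fin n) (Fin n) E t a.2 c.2)) (fun i => (r, i)) (fun i => (s, i))).symm
  conv_lhs => rw [matrix_eq_sum_single (t r s)]
  refine Finset.sum_congr rfl fun i _ => Finset.sum_congr rfl fun j _ => ?_
  ext a b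
  simp [matTensor, single_apply, ite_smul]

theorem projSpanning_matTensor (n : ℕ) (E : Type*) [AddCommGroup E] [Module ℂ E] :
    ProjSpanning (matTensor n E) :=
  projSpanning_of_exists fun k t => ⟨Fin n, Fin k × Fin n, inferInstance, inferInstance,
    flipRow n k, of fun i j => single i j 1, comp (Fin k) (Fin k) (Fin n) (Fin n) E t,
    (flipRow n k)ᴴ, matTensor_representation t⟩

/-- Each of the k rows has exactly n unit entries, and the rows have disjoint supports. The factor n
lost on passing from M_n[E] to S_1^n ⊗^ E comes from here. -/
theorem opNorm_flipRow_sq_le (n k : ℕ) : opNorm (flipRow n k) ^ 2 ≤ n := by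
  have h : flipRow n k * (flipRow n k)ᴴ = (n : ℂ) • 1 := by
    ext r s
    simp only [mul_apply, flipRow, of_apply, Fintype.sum_prod_type
      (α₁ := Fin n)]
    rw [Finset.sum_congr rfl fun i _ => Finset.sum_eq_single (r, i)
      (fun b _ hb => by simp [hb]) (by simp)]
    simp [one_apply]
  rw [← opNorm_mul_conjTranspose_self, h, opNorm_smul, Complex.norm_natCast]
  exact mul_le_of_le_one_right (Nat.cast_nonneg n) opNorm_one_le

/-- The identity map from `M_n[E]` to `S_1^n ⊗^ E` has completely bounded norm at most `n`. -/
theorem projNorms_le_sInfty {N : MatNorms E} (hN : ∀ l x, 0 ≤ N l x) {k : ℕ}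
    (t : Matrix (Fin k) (Fin k) (Matrix (Fin n) (Fin n) E)) :
    projNorms (matTensor n E) (sOne n) N k t ≤ n * sInfty n N k t := by
  have h := projNorms_le (sOne_nonneg (n := n)) hN (Equiv.refl (Fin k)) (Equiv.refl (Fin n))
    finProdFinEquiv (flipRow n k) (of fun i j => single i j 1)
    (comp (Fin k) (Fin k) (Fin n) (Fin n) E t) (flipRow n k)ᴴ (matTensor_representation t)
  -- As an element of M_n[S_1^n] = CB(M_n, M_n), the matrix (e_ij) is the identity map: pairing it
  -- with A returns A.
  have h1 : sOne n n ((of fun i j => single i j (1 : ℂ)).submatrix (Equiv.refl (Fin n)).symm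
      (Equiv.refl (Fin n)).symm) ≤ 1 := by
    refine sOne_le (Equiv.refl (Fin n)) zero_le_one fun r A => le_of_eq ?_
    rw [one_mul]
    congr 1
    ext i j
    simp [pairMat, tracePairing_apply, single_apply, ite_and]
  refine h.trans ?_
  rw [opNorm_conjTranspose]
  have h2 := opNorm_flipRow_sq_le n k
  have h3 := opNorm_nonneg (flipRow n k)
  have h4 : 0 ≤ sInfty n N k t := hN _ _
  calc _ ≤ opNorm (flipRow n k) * 1 * sInfty n N k t * opNorm (flipRow n k) :=
        mul_le_mul_of_nonneg_right (mul_le_mul_of_nonneg_right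
          (mul_le_mul_of_nonneg_left h1 h3) h4) h3
    _ = opNorm (flipRow n k) ^ 2 * sInfty n N k t := by ring
    _ ≤ _ := mul_le_mul_of_nonneg_right h2 h4

/-- The sum ∑ e_d ⊗ t_d is cut out of the diagonal matrix of the e_d, tensored with blocks of
coordinates of t. It only serves to make the projective infimum nonempty; no norm of it is
estimated. -/
theorem piTensor_representation [DecidableEq κ] {k : ℕ} (t : Matrix (Fin k) (Fin k) (κ → E))
    (r s : Fin k) :
    t r s = ∑ a : κ × (κ × Fin k), ∑ c : κ × (κ × Fin k),
      ((of fun r a => if a.2 = (a.1, r) then 1 else 0 : Matrix (Fin k) (κ × (κ × Fin k)) ℂ) r a *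
        (of fun a r => if a.2 = (a.1, r) then 1 else 0 : Matrix (κ × (κ × Fin k)) (Fin k) ℂ) c s) •
      piTensor κ E ((diagonal fun d => Pi.single d 1 : Matrix κ κ (κ → ℂ)) a.1 c.1)
        ((of fun a b => t a.2 b.2 a.1 : Matrix (κ × Fin k) (κ × Fin k) E) a.2 c.2) := by
  simp only [of_apply]
  refine Eq.trans ?_ (sum_sum_ite_smul (fun a c => piTensor κ E
    ((diagonal fun d => Pi.single d 1 : Matrix κ κ (κ → ℂ)) a.1 c.1) (t a.2.2 c.2.2 a.2.1))
    (fun i => (i, r)) (fun i => (i, s))).symm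
  have h : ∀ i, ∑ j, piTensor κ E ((diagonal fun d => Pi.single d 1 : Matrix κ κ (κ → ℂ)) i j)
      (t r s i) = piTensor κ E (Pi.single i 1) (t r s i) := by
    intro i
    rw [Finset.sum_eq_single i (fun j _ hj => by rw [diagonal_apply_ne' _ hj, map_zero,
      LinearMap.zero_apply]) (by simp), diagonal_apply_eq]
  simp only [h]
  ext c
  simp [piTensor, Pi.single_apply, Finset.sum_apply, ite_smul]

theorem projSpanning_piTensor [DecidableEq κ] (E : Type*) [AddCommGroup E] [Module ℂ E] :
    ProjSpanning (piTensor κ E) :=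
  projSpanning_of_exists fun k t => ⟨κ, κ × Fin k, inferInstance, inferInstance, _,
    diagonal fun d => Pi.single d 1, of fun a b => t a.2 b.2 a.1, _, piTensor_representation t⟩

end MatTensor

end Concrete

end OpSp
end

noncomputable section

set_option linter.unusedSectionVars false

namespace OpSp

open Matrix

/-! ### Twirling by an orthogonal family of unitaries. -/

section Twirl

variable {n : ℕ} {κ : Type} [Fintype κ] [DecidableEq κ]

/-- Unitary matrices which are pairwise orthogonal with respect to the trace. -/
structure IsUnitaryFamily (T : κ → Matrix (Fin n) (Fin n) ℂ) : Prop where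
  conjTranspose_mul : ∀ c, (T c)ᴴ * T c = 1
  trace_eq : ∀ c d, ((T c)ᴴ * T d).trace = if c = d then (n : ℂ) else 0

namespace IsUnitaryFamily

variable {T : κ → Matrix (Fin n) (Fin n) ℂ}

theorem mul_conjTranspose (hT : IsUnitaryFamily T) (c : κ) : T c * (T c)ᴴ = 1 :=
  mul_eq_one_comm.1 (hT.conjTranspose_mul c)

theorem conjTranspose (hT : IsUnitaryFamily T) : IsUnitaryFamily fun c => (T c)ᴴ where
  conjTranspose_mul c := by rw [conjTranspose_conjTranspose]; exact hT.mul_conjTranspose c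
  trace_eq c d := by
    rw [conjTranspose_conjTranspose, trace_mul_comm, hT.trace_eq]
    simp [eq_comm]

theorem opNorm_le_one (hT : IsUnitaryFamily T) (c : κ) : opNorm (T c) ≤ 1 :=
  opNorm_le_one_of_conjTranspose_mul_self (hT.conjTranspose_mul c)

/-- The main estimate: the matrix norms of `∑ T_c x T_c^* ⊗ Y_c` are controlled by the norm of `x`
in `S_1^n` and by the supremum of the norms of the `Y_c`. -/
theorem opNorm_sum_conj_le (hT : IsUnitaryFamily T) {L ρ : Type} [Fintype L] [DecidableEq L]
    [Fintype ρ] [DecidableEq ρ] {l : ℕ} (f : L ≃ Fin l)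
    (x : Matrix L L (Matrix (Fin n) (Fin n) ℂ)) (Y : κ → Matrix ρ ρ ℂ) {M : ℝ} (hM : 0 ≤ M)
    (hY : ∀ c, opNorm (Y c) ≤ M) :
    opNorm (of fun u v : (Fin n × ρ) × L =>
      ∑ c, (T c * x u.2 v.2 * (T c)ᴴ) u.1.1 v.1.1 * Y c u.1.2 v.1.2) ≤
      n * sOne n l (x.submatrix f.symm f.symm) * M := by
  let A : Matrix (Fin n × ρ) (Fin n × ρ) (Matrix (Fin n) (Fin n) ℂ) := of fun u v => of fun p q =>
    ∑ c, T c u.1 p * star (T c v.1 q) * Y c u.2 v.2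
  -- Column (r, c) is the vectorised T_c placed at position r of ρ. Trace orthogonality makes the
  -- columns orthogonal of squared length n, so V^*V = n.
  let V : Matrix ((Fin n × ρ) × Fin n) (ρ × κ) ℂ := of fun u a =>
    if a.1 = u.1.2 then T a.2 u.1.1 u.2 else 0
  have hV : opNorm V ^ 2 ≤ n := by
    have h : Vᴴ * V = (n : ℂ) • 1 := by
      ext ⟨r, c⟩ ⟨s, d⟩
      have h1 := hT.trace_eq c d
      simp only [trace, diag_apply, mul_apply, conjTranspose_apply] at h1
      simp only [V, mul_apply, conjTranspose_apply, of_apply, Fintype.sum_prod_type, mul_ite,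
        mul_zero, apply_ite star, star_zero, ite_mul, zero_mul, Matrix.smul_apply, one_apply, smul_eq_mul,
        Prod.mk.injEq]
      rcases eq_or_ne r s with rfl | hrs
      · simp only [Finset.sum_ite_irrel, Finset.sum_const_zero, Finset.sum_ite_eq, Finset.mem_univ,
          if_true, true_and]
        rw [Finset.sum_comm, h1]
        split_ifs <;> simp
      · rw [if_neg (fun h => hrs h.1)]
        refine Finset.sum_eq_zero fun i _ => Finset.sum_eq_zero fun p _ =>
          Finset.sum_eq_zero fun j _ => ?_
        split_ifs with h2 h3
        · exact absurd (h3.trans h2.symm) hrs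
        all_goals simp
    rw [← opNorm_conjTranspose_mul_self, h, opNorm_smul, Complex.norm_natCast]
    exact mul_le_of_le_one_right (Nat.cast_nonneg n) opNorm_one_le
  have hA : comp (Fin n × ρ) (Fin n × ρ) (Fin n) (Fin n) ℂ A = V * blockDiagonal Y * Vᴴ := by
    ext ⟨⟨i, r⟩, p⟩ ⟨⟨j, s⟩, q⟩
    simp only [A, V, comp_apply, of_apply, mul_apply, conjTranspose_apply, Fintype.sum_prod_type,
      blockDiagonal_apply, ite_mul, zero_mul, mul_ite, mul_zero, Finset.sum_ite_irrel,
      Finset.sum_const_zero, Finset.sum_ite_eq', Finset.mem_univ, if_true,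
      apply_ite star, star_zero]
    exact Finset.sum_congr rfl fun c _ => by ring
  have hA' : opNorm (comp (Fin n × ρ) (Fin n × ρ) (Fin n) (Fin n) ℂ A) ≤ n * M := by
    rw [hA]
    refine (opNorm_mul_mul_le le_rfl (opNorm_blockDiagonal_le hM hY)
      (opNorm_conjTranspose V).le).trans ?_
    calc opNorm V * M * opNorm V = opNorm V ^ 2 * M := by ring
      _ ≤ _ := mul_le_mul_of_nonneg_right hV hM
  have hP : (of fun u v : (Fin n × ρ) × L =>
      ∑ c, (T c * x u.2 v.2 * (T c)ᴴ) u.1.1 v.1.1 * Y c u.1.2 v.1.2) =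
      pairMat (tracePairing n) x A := by
    ext u v
    simp only [pairMat, of_apply, tracePairing_apply, A, mul_apply, conjTranspose_apply,
      Finset.sum_mul, Finset.mul_sum]
    calc _ = ∑ c, ∑ p, ∑ q, T c u.1.1 p * x u.2 v.2 p q * star (T c v.1.1 q) * Y c u.1.2 v.1.2 :=
          Finset.sum_congr rfl fun c _ => Finset.sum_comm
      _ = ∑ p, ∑ c, ∑ q, T c u.1.1 p * x u.2 v.2 p q * star (T c v.1.1 q) * Y c u.1.2 v.1.2 :=
          Finset.sum_comm
      _ = ∑ p, ∑ q, ∑ c, T c u.1.1 p * x u.2 v.2 p q * star (T c v.1.1 q) * Y c u.1.2 v.1.2 :=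
          Finset.sum_congr rfl fun p _ => Finset.sum_comm
      _ = _ := Finset.sum_congr rfl fun p _ => Finset.sum_congr rfl fun q _ =>
          Finset.sum_congr rfl fun c _ => by ring
  rw [hP]
  refine (opNorm_pairMat_trace_le f x A).trans ?_
  calc _ ≤ sOne n l (x.submatrix f.symm f.symm) * (n * M) :=
        mul_le_mul_of_nonneg_left hA' (sOne_nonneg _ _)
    _ = _ := by ring

end IsUnitaryFamily

section Maps

variable (T : κ → Matrix (Fin n) (Fin n) ℂ) (E : Type*) [AddCommGroup E] [Module ℂ E]

/-- The map `x ↦ ∑_c T_c x T_c^* ⊗ e_c` on `M_n ⊗ E`. -/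
def twirl : Matrix (Fin n) (Fin n) E →ₗ[ℂ] Matrix (Fin n) (Fin n) (κ → E) where
  toFun x := of fun i j c => ∑ a, ∑ b, (T c i a * star (T c j b)) • x a b
  map_add' x y := by ext i j c; simp [Finset.sum_add_distrib]
  map_smul' r x := by
    ext i j c
    simp only [Matrix.smul_apply, Pi.smul_apply, of_apply, RingHom.id_apply, Finset.smul_sum,
      smul_comm r]

/-- The map `y ↦ ∑_c T_c^* y_c T_c` on `M_n ⊗ (κ → E)`. -/
def untwirl : Matrix (Fin n) (Fin n) (κ → E) →ₗ[ℂ] Matrix (Fin n) (Fin n) E where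
  toFun y := of fun i j => ∑ c, ∑ a, ∑ b, (star (T c a i) * T c b j) • y a b c
  map_add' x y := by ext i j; simp [Finset.sum_add_distrib]
  map_smul' r x := by
    ext i j
    simp only [Matrix.smul_apply, Pi.smul_apply, of_apply, RingHom.id_apply, Finset.smul_sum,
      smul_comm r]

variable {T E}

theorem twirl_matTensor (X : Matrix (Fin n) (Fin n) ℂ) (e : E) (i j : Fin n) :
    twirl T E (matTensor n E X e) i j = piTensor κ E (fun c => (T c * X * (T c)ᴴ) i j) e := by
  ext c
  simp only [twirl, matTensor, piTensor, LinearMap.coe_mk, AddHom.coe_mk, LinearMap.mk₂_apply,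
    of_apply, mul_apply, conjTranspose_apply, smul_smul, Finset.sum_mul, Finset.sum_smul]
  rw [Finset.sum_comm]
  exact Finset.sum_congr rfl fun b _ => Finset.sum_congr rfl fun a _ => by congr 1; ring

theorem untwirl_matTensor (X : Matrix (Fin n) (Fin n) ℂ) (v : κ → E) (i j : Fin n) :
    untwirl T E (matTensor n (κ → E) X v) i j = ∑ c, ((T c)ᴴ * X * T c) i j • v c := by
  simp only [untwirl, matTensor, LinearMap.coe_mk, AddHom.coe_mk, LinearMap.mk₂_apply,
    of_apply, mul_apply, conjTranspose_apply, Finset.sum_mul, Finset.sum_smul, Pi.smul_apply,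
    smul_smul]
  refine Finset.sum_congr rfl fun c _ => ?_
  rw [Finset.sum_comm]
  exact Finset.sum_congr rfl fun b _ => Finset.sum_congr rfl fun a _ => by congr 1; ring

theorem untwirl_matTensor_piTensor (X : Matrix (Fin n) (Fin n) ℂ) (b : κ → ℂ) (e : E) :
    untwirl T E (matTensor n (κ → E) X (piTensor κ E b e)) =
      matTensor n E (∑ c, b c • ((T c)ᴴ * X * T c)) e := by
  ext i j
  rw [untwirl_matTensor]
  simp [matTensor, piTensor, Matrix.sum_apply, smul_smul, mul_comm]

/-- Every c contributes T_c^*(T_c x T_c^*)T_c = x. Only unitarity matters here; orthogonality enters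
through the norms. -/
theorem untwirl_twirl (hT : IsUnitaryFamily T) (x : Matrix (Fin n) (Fin n) E) :
    untwirl T E (twirl T E x) = (Fintype.card κ : ℂ) • x := by
  ext i j
  have h : ∀ c, ∑ a, ∑ b, (star (T c a i) * T c b j) •
      ∑ a', ∑ b', (T c a a' * star (T c b b')) • x a' b' = x i j := by
    intro c
    have h1 : ∀ a', ∑ a, star (T c a i) * T c a a' = if i = a' then 1 else 0 := by
      intro a'
      have := congrFun (congrFun (hT.conjTranspose_mul c) i) a'
      simpa only [mul_apply, conjTranspose_apply, one_apply] using this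
    have h2 : ∀ b', ∑ b, T c b j * star (T c b b') = if b' = j then 1 else 0 := by
      intro b'
      have := congrFun (congrFun (hT.conjTranspose_mul c) b') j
      simp only [mul_apply, conjTranspose_apply, one_apply] at this
      rw [← this]
      exact Finset.sum_congr rfl fun _ _ => mul_comm _ _
    calc _ = ∑ a, ∑ b, ∑ a', ∑ b',
          ((star (T c a i) * T c a a') * (T c b j * star (T c b b'))) • x a' b' := by
          simp only [Finset.smul_sum, smul_smul]
          refine Finset.sum_congr rfl fun a _ => Finset.sum_congr rfl fun b _ =>
            Finset.sum_congr rfl fun a' _ => Finset.sum_congr rfl fun b' _ => ?_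
          congr 1; ring
      _ = ∑ a, ∑ a', ∑ b, ∑ b',
          ((star (T c a i) * T c a a') * (T c b j * star (T c b b'))) • x a' b' :=
          Finset.sum_congr rfl fun a _ => Finset.sum_comm
      _ = ∑ a', ∑ a, ∑ b', ∑ b,
          ((star (T c a i) * T c a a') * (T c b j * star (T c b b'))) • x a' b' := by
          rw [Finset.sum_comm]
          exact Finset.sum_congr rfl fun a' _ => Finset.sum_congr rfl fun a _ => Finset.sum_comm
      _ = ∑ a', ∑ b', ((∑ a, star (T c a i) * T c a a') *
          (∑ b, T c b j * star (T c b b'))) • x a' b' := by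
          refine Finset.sum_congr rfl fun a' _ => ?_
          rw [Finset.sum_comm]
          refine Finset.sum_congr rfl fun b' _ => ?_
          simp only [Finset.sum_mul_sum, Finset.sum_smul]
      _ = x i j := by
          simp only [h1, h2, ite_mul, one_mul, zero_mul, ite_smul, one_smul, zero_smul]
          simp
  change ∑ c, _ = _
  simp only [twirl, LinearMap.coe_mk, AddHom.coe_mk, of_apply, h]
  simp [Finset.sum_const, Finset.card_univ, Nat.cast_smul_eq_nsmul]

end Maps

section Endpoints

variable {T : κ → Matrix (Fin n) (Fin n) ℂ}

/-- The ℓ_1 norm is tested by pairing with matrices A over ℓ_∞, and pairing (T_c x T_c^*)_c with A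
gives the sum in `opNorm_sum_conj_le` with Y_c = A_c. -/
theorem ellOne_conj_le (hT : IsUnitaryFamily T) {l : ℕ}
    (x : Matrix (Fin l) (Fin l) (Matrix (Fin n) (Fin n) ℂ)) :
    ellOne κ (l * n) ((of fun a b : Fin l × Fin n => fun c =>
      (T c * x a.1 b.1 * (T c)ᴴ) a.2 b.2).submatrix finProdFinEquiv.symm finProdFinEquiv.symm) ≤
      n * sOne n l x := by
  refine ellOne_le finProdFinEquiv (mul_nonneg (Nat.cast_nonneg n) (sOne_nonneg _ _))
    fun r A M hM hA => ?_
  let e : Fin r × (Fin l × Fin n) ≃ (Fin n × Fin r) × Fin l :=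
    { toFun := fun a => ((a.2.2, a.1), a.2.1)
      invFun := fun a => (a.1.2, (a.2, a.1.1))
      left_inv := fun _ => rfl
      right_inv := fun _ => rfl }
  have h := hT.opNorm_sum_conj_le (Equiv.refl (Fin l)) x (fun c => A.map fun v => v c) hM hA
  rw [← opNorm_submatrix_equiv _ e e] at h
  exact h

/-- Conjugation by T_c can be moved across the trace pairing onto A, where it is contractive.
Pairing with A thus becomes pairing b with a matrix over ℓ_∞ whose coordinates have norm at most
‖x‖‖A‖; no factor n is lost. -/
theorem sOne_conj_le (hT : IsUnitaryFamily T) {l l' : ℕ}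
    (x : Matrix (Fin l) (Fin l) (Matrix (Fin n) (Fin n) ℂ)) (b : Matrix (Fin l') (Fin l') (κ → ℂ)) :
    sOne n (l * l') ((of fun a d : Fin l × Fin l' =>
      ∑ c, b a.2 d.2 c • ((T c)ᴴ * x a.1 d.1 * T c)).submatrix finProdFinEquiv.symm
        finProdFinEquiv.symm) ≤ sOne n l x * ellOne κ l' b := by
  refine sOne_le finProdFinEquiv (mul_nonneg (sOne_nonneg _ _) (ellOne_nonneg _ _)) fun r A => ?_
  let B : Matrix (Fin r × Fin l) (Fin r × Fin l) (κ → ℂ) := of fun u v c =>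
    pairMat (tracePairing n) x (of fun i j => (T c)ᴴᵀ * A i j * (T c)ᵀ) u v
  have hB : ∀ c, opNorm (B.map fun v => v c) ≤
      sOne n l x * opNorm (comp (Fin r) (Fin r) (Fin n) (Fin n) ℂ A) := by
    intro c
    refine (opNorm_pairMat_trace_le (Equiv.refl (Fin l)) x
      (of fun i j => (T c)ᴴᵀ * A i j * (T c)ᵀ)).trans ?_
    refine mul_le_mul_of_nonneg_left ?_ (sOne_nonneg _ _)
    open Kronecker in
    have h : comp (Fin r) (Fin r) (Fin n) (Fin n) ℂ (of fun i j => (T c)ᴴᵀ * A i j * (T c)ᵀ) =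
        ((1 : Matrix (Fin r) (Fin r) ℂ) ⊗ₖ (T c)ᴴᵀ) * comp (Fin r) (Fin r) (Fin n) (Fin n) ℂ A *
          ((1 : Matrix (Fin r) (Fin r) ℂ) ⊗ₖ (T c)ᵀ) := by
      ext ⟨i, p⟩ ⟨j, q⟩
      simp [mul_apply, Fintype.sum_prod_type, one_apply, Finset.sum_ite_irrel]
    have h1 : opNorm (T c)ᴴᵀ ≤ 1 := opNorm_le_one_of_conjTranspose_mul_self (by
      have := congrArg transpose (hT.conjTranspose_mul c)
      rw [transpose_mul, transpose_one] at this
      rw [← this]; congr 1; ext i j; simp)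
    have h2 : opNorm (T c)ᵀ ≤ 1 := opNorm_le_one_of_conjTranspose_mul_self (by
      have := congrArg transpose (hT.mul_conjTranspose c)
      rw [transpose_mul, transpose_one] at this
      rw [← this]; congr 1)
    rw [h]
    refine (opNorm_mul_mul_le ((opNorm_one_kronecker_le _).trans h1) le_rfl
      ((opNorm_one_kronecker_le _).trans h2)).trans ?_
    simp
  have h := opNorm_pairMat_sum_le (Equiv.refl (Fin l')) b B
    (mul_nonneg (sOne_nonneg _ _) (opNorm_nonneg _)) hB
  rw [← opNorm_submatrix_equiv _ (Equiv.prodAssoc _ _ _).symm (Equiv.prodAssoc _ _ _).symm] at h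
  have e : pairMat (tracePairing n) (of fun a d : Fin l × Fin l' =>
      ∑ c, b a.2 d.2 c • ((T c)ᴴ * x a.1 d.1 * T c)) A =
      (pairMat (sumPairing κ) b B).submatrix (Equiv.prodAssoc _ _ _).symm
        (Equiv.prodAssoc _ _ _).symm := by
    ext ⟨i, a, a'⟩ ⟨j, d, d'⟩
    simp only [pairMat, of_apply, submatrix_apply, Equiv.prodAssoc_symm_apply, map_sum, map_smul,
      LinearMap.sum_apply, LinearMap.smul_apply, sumPairing_apply, smul_eq_mul, B]
    refine Finset.sum_congr rfl fun c _ => congrArg _ ?_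
    simp only [tracePairing, LinearMap.mk₂_apply, transpose_mul, transpose_transpose]
    rw [Matrix.mul_assoc ((T c)ᴴ), Matrix.mul_assoc ((T c)ᴴ), trace_mul_comm]
    simp only [Matrix.mul_assoc]
  rw [e]
  refine h.trans (le_of_eq ?_)
  change ellOne κ l' b * _ = _
  ring

end Endpoints

end Twirl

end OpSp
end

noncomputable section

set_option linter.unusedSectionVars false

namespace OpSp

open Matrix

/-! ### Endpoint estimates at every matrix level. -/

section Levels

variable {n : ℕ} {κ : Type} [Fintype κ] [DecidableEq κ]

section Defs

variable (T : κ → Matrix (Fin n) (Fin n) ℂ) (E : Type*) [AddCommGroup E] [Module ℂ E]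

/-- The amplification of `twirl` to `M_k[M_n[E]]`, with values in `M_{kn}[κ → E]`. -/
def twirlLevel (k : ℕ) : Matrix (Fin k) (Fin k) (Matrix (Fin n) (Fin n) E) →ₗ[ℂ]
    Matrix (Fin (k * n)) (Fin (k * n)) (κ → E) where
  toFun x := reindex finProdFinEquiv finProdFinEquiv
    (comp (Fin k) (Fin k) (Fin n) (Fin n) (κ → E) (x.map (twirl T E)))
  map_add' x y := by ext i j; simp
  map_smul' r x := by ext i j; simp

variable {E} in
theorem twirlLevel_apply {k : ℕ} (x : Matrix (Fin k) (Fin k) (Matrix (Fin n) (Fin n) E))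
    (r s : Fin k × Fin n) : twirlLevel T E k x (finProdFinEquiv r) (finProdFinEquiv s) =
      twirl T E (x r.1 s.1) r.2 s.2 := by
  simp [twirlLevel]

/-- The map `y ↦ α ((∑_c T_c^* x T_c ⊗ y_c)) β` from `M_m[κ → E]` to `M_k[M_n[E]]`. -/
def untwirlLevel {k l m : ℕ} (α : Matrix (Fin k) (Fin l × Fin m) ℂ)
    (x : Matrix (Fin l) (Fin l) (Matrix (Fin n) (Fin n) ℂ))
    (β : Matrix (Fin l × Fin m) (Fin k) ℂ) :
    Matrix (Fin m) (Fin m) (κ → E) →ₗ[ℂ] Matrix (Fin k) (Fin k) (Matrix (Fin n) (Fin n) E) where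
  toFun y := of fun r s => ∑ a : Fin l × Fin m, ∑ c : Fin l × Fin m,
    (α r a * β c s) • untwirl T E (matTensor n (κ → E) (x a.1 c.1) (y a.2 c.2))
  map_add' y z := by
    ext1 r s
    simp only [of_apply, Matrix.add_apply, map_add, smul_add, Finset.sum_add_distrib]
  map_smul' d y := by
    ext1 r s
    simp only [of_apply, Matrix.smul_apply, map_smul, Finset.smul_sum, RingHom.id_apply,
      smul_comm d]

end Defs

variable {T : κ → Matrix (Fin n) (Fin n) ℂ}

/-- In a representation α(z ⊗ y)β twirling affects only z: the image is (α ⊗ 1)(twirl z ⊗ y)(β ⊗ 1),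
and `ellOne_conj_le` bounds the middle factor. -/
theorem projNorms_twirlLevel_le {E : Type*} [AddCommGroup E] [Module ℂ E]
    (hT : IsUnitaryFamily T) {N : MatNorms E} (hN : ∀ l x, 0 ≤ N l x) {k : ℕ}
    (x : Matrix (Fin k) (Fin k) (Matrix (Fin n) (Fin n) E)) :
    projNorms (piTensor κ E) (ellOne κ) N (k * n) (twirlLevel T E k x) ≤
      n * projNorms (matTensor n E) (sOne n) N k x := by
  refine le_mul_of_forall_gt fun C hC => ?_
  obtain ⟨l, m, α, z, y, β, hx, hlt⟩ :=
    exists_of_projNorms_lt (projSpanning_matTensor n E) hC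
  let φ : (Fin l × Fin n) × Fin m ≃ (Fin l × Fin m) × Fin n :=
    { toFun := fun a => ((a.1.1, a.2), a.1.2)
      invFun := fun a => ((a.1.1, a.2), a.1.2)
      left_inv := fun _ => rfl
      right_inv := fun _ => rfl }
  open Kronecker in
  have key := projNorms_le (b := piTensor κ E) (t := twirlLevel T E k x) (ellOne_nonneg (κ := κ)) hN
    finProdFinEquiv finProdFinEquiv (Equiv.refl (Fin m))
    ((α ⊗ₖ (1 : Matrix (Fin n) (Fin n) ℂ)).submatrix id φ)
    (of fun a b : Fin l × Fin n => fun c => (T c * z a.1 b.1 * (T c)ᴴ) a.2 b.2) y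
    ((β ⊗ₖ (1 : Matrix (Fin n) (Fin n) ℂ)).submatrix φ id) (by
      rintro ⟨r, i⟩ ⟨s, j⟩
      rw [twirlLevel_apply, hx]
      have h : ∀ (c : ℂ) (X : Matrix (Fin n) (Fin n) ℂ) (e : E),
          twirl T E (c • matTensor n E X e) i j =
            c • piTensor κ E (fun d => (T d * X * (T d)ᴴ) i j) e := by
        intro c X e
        rw [map_smul, ← twirl_matTensor]; rfl
      simp only [map_sum, Matrix.sum_apply, h]
      rw [← φ.symm.sum_comp, Fintype.sum_prod_type (α₁ := Fin l × Fin m)]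
      refine Finset.sum_congr rfl fun a _ => ?_
      rw [Finset.sum_eq_single i]
      rotate_left
      · intro i' _ hi'
        refine Finset.sum_eq_zero fun c _ => ?_
        simp [φ, one_apply_ne' hi']
      · simp
      rw [← φ.symm.sum_comp, Fintype.sum_prod_type (α₁ := Fin l × Fin m)]
      refine Finset.sum_congr rfl fun c _ => ?_
      rw [Finset.sum_eq_single j]
      rotate_left
      · intro j' _ hj'
        simp [φ, one_apply_ne hj']
      · simp
      simp [φ])
  refine key.trans ?_
  have h1 : opNorm ((α ⊗ₖ (1 : Matrix (Fin n) (Fin n) ℂ)).submatrix id φ) ≤ opNorm α :=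
    (opNorm_submatrix_equiv _ (Equiv.refl _) φ).trans_le (opNorm_kronecker_one_le α)
  have h2 : opNorm ((β ⊗ₖ (1 : Matrix (Fin n) (Fin n) ℂ)).submatrix φ id) ≤ opNorm β :=
    (opNorm_submatrix_equiv _ φ (Equiv.refl _)).trans_le (opNorm_kronecker_one_le β)
  have h3 := ellOne_conj_le hT z
  have hz := sOne_nonneg l z
  have hy := hN m y
  have hα := opNorm_nonneg α
  have hβ := opNorm_nonneg β
  calc _ ≤ opNorm α * (n * sOne n l z) * N m y * opNorm β := by
        refine mul_le_mul (mul_le_mul_of_nonneg_right (mul_le_mul h1 h3 (ellOne_nonneg _ _) hα) hy)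
          h2 (opNorm_nonneg _) (by positivity)
    _ = n * (opNorm α * sOne n l z * N m y * opNorm β) := by ring
    _ ≤ n * C := mul_le_mul_of_nonneg_left hlt.le (Nat.cast_nonneg n)

/-- Substitute y = α'(b ⊗ w)β'. The outer factors become α(1 ⊗ α') and (1 ⊗ β')β, and x and b merge
into one matrix over S_1^n, controlled by `sOne_conj_le`. -/
theorem projNorms_untwirlLevel_le {E : Type*} [AddCommGroup E] [Module ℂ E]
    (hT : IsUnitaryFamily T) {N : MatNorms E} (hN : ∀ l x, 0 ≤ N l x) {k l m : ℕ}
    (α : Matrix (Fin k) (Fin l × Fin m) ℂ) (x : Matrix (Fin l) (Fin l) (Matrix (Fin n) (Fin n) ℂ))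
    (β : Matrix (Fin l × Fin m) (Fin k) ℂ) (y : Matrix (Fin m) (Fin m) (κ → E)) :
    projNorms (matTensor n E) (sOne n) N k (untwirlLevel T E α x β y) ≤
      opNorm α * opNorm β * sOne n l x * projNorms (piTensor κ E) (ellOne κ) N m y := by
  refine le_mul_of_forall_gt fun C hC => ?_
  obtain ⟨l', m', α', b, w, β', hy, hlt⟩ :=
    exists_of_projNorms_lt (projSpanning_piTensor E) hC
  let φ : (Fin l × Fin l') × Fin m' ≃ Fin l × (Fin l' × Fin m') := Equiv.prodAssoc _ _ _
  open Kronecker in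
  have key := projNorms_le (b := matTensor n E) (t := untwirlLevel T E α x β y)
    (sOne_nonneg (n := n)) hN (Equiv.refl (Fin k)) finProdFinEquiv (Equiv.refl (Fin m'))
    ((α * ((1 : Matrix (Fin l) (Fin l) ℂ) ⊗ₖ α')).submatrix id φ)
    (of fun a d : Fin l × Fin l' => ∑ c, b a.2 d.2 c • ((T c)ᴴ * x a.1 d.1 * T c)) w
    ((((1 : Matrix (Fin l) (Fin l) ℂ) ⊗ₖ β') * β).submatrix φ id) (by
      intro r s
      let G : Fin l × (Fin l' × Fin m') → Fin l × (Fin l' × Fin m') → Matrix (Fin n) (Fin n) E :=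
        fun a d => matTensor n E (∑ c, b a.2.1 d.2.1 c • ((T c)ᴴ * x a.1 d.1 * T c))
          (w a.2.2 d.2.2)
      have hL : untwirlLevel T E α x β y r s = ∑ a : Fin l × Fin m, ∑ c : Fin l × Fin m,
          ∑ a', ∑ c', (α r a * α' a.2 a') • (β' c' c.2 * β c s) • G (a.1, a') (c.1, c') := by
        change ∑ a : Fin l × Fin m, ∑ c : Fin l × Fin m,
          (α r a * β c s) • untwirl T E (matTensor n (κ → E) (x a.1 c.1) (y a.2 c.2)) = _
        refine Finset.sum_congr rfl fun a _ => Finset.sum_congr rfl fun c _ => ?_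
        rw [hy]
        simp only [map_sum, map_smul, untwirl_matTensor_piTensor, Finset.smul_sum, smul_smul]
        refine Finset.sum_congr rfl fun a' _ => Finset.sum_congr rfl fun c' _ => ?_
        congr 1
        · ring
        · simp only [G, map_sum, map_smul]
      have hcomb : ∀ {q p : ℕ} {ι X : Type _} [Fintype ι] [AddCommGroup X] [Module ℂ X]
          (F : Fin q × Fin p → ι → ℂ) (K : Fin q × ι → X),
          ∑ a : Fin q × Fin p, ∑ a', F a a' • K (a.1, a') =
            ∑ d : Fin q × ι, (∑ i, F (d.1, i) d.2) • K d := by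
        intro q p ι X _ _ _ F K
        rw [Fintype.sum_prod_type, Fintype.sum_prod_type]
        refine Finset.sum_congr rfl fun i _ => ?_
        rw [Finset.sum_comm]
        exact Finset.sum_congr rfl fun a' _ => by simp only [← Finset.sum_smul]
      have hα : ∀ d : Fin l × (Fin l' × Fin m'), (α * ((1 : Matrix (Fin l) (Fin l) ℂ) ⊗ₖ α')) r d =
          ∑ i, α r (d.1, i) * α' i d.2 := by
        intro d
        simp [mul_apply, Fintype.sum_prod_type, one_apply, Finset.sum_ite_irrel]
      have hβ : ∀ d : Fin l × (Fin l' × Fin m'), (((1 : Matrix (Fin l) (Fin l) ℂ) ⊗ₖ β') * β) d s =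
          ∑ i, β' d.2 i * β (d.1, i) s := by
        intro d
        simp [mul_apply, Fintype.sum_prod_type, one_apply, Finset.sum_ite_irrel]
      rw [Equiv.refl_apply, Equiv.refl_apply, hL]
      calc _ = ∑ a : Fin l × Fin m, ∑ a', (α r a * α' a.2 a') • ∑ c : Fin l × Fin m,
            ∑ c', (β' c' c.2 * β c s) • G (a.1, a') (c.1, c') := by
            refine Finset.sum_congr rfl fun a _ => ?_
            rw [Finset.sum_comm]
            simp only [Finset.smul_sum]
        _ = ∑ d, (∑ i, α r (d.1, i) * α' i d.2) •
            ∑ e, (∑ i, β' e.2 i * β (e.1, i) s) • G d e := by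
            rw [hcomb (fun a a' => α r a * α' a.2 a')
              (fun d => ∑ c : Fin l × Fin m, ∑ c', (β' c' c.2 * β c s) • G d (c.1, c'))]
            refine Finset.sum_congr rfl fun d _ => congrArg _ ?_
            exact hcomb (fun c c' => β' c' c.2 * β c s) (fun e => G d e)
        _ = _ := by
            rw [← φ.sum_comp]
            refine Finset.sum_congr rfl fun d _ => ?_
            rw [← φ.sum_comp, Finset.smul_sum]
            refine Finset.sum_congr rfl fun e _ => ?_
            rw [smul_smul, ← hα, ← hβ]
            rfl)
  refine key.trans ?_
  have hα := opNorm_nonneg α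
  have hβ := opNorm_nonneg β
  have hα' := opNorm_nonneg α'
  have hβ' := opNorm_nonneg β'
  have h1 : opNorm ((α * ((1 : Matrix (Fin l) (Fin l) ℂ) ⊗ₖ α')).submatrix id φ) ≤
      opNorm α * opNorm α' :=
    (opNorm_submatrix_equiv _ (Equiv.refl _) φ).trans_le ((opNorm_mul_le _ _).trans
      (mul_le_mul_of_nonneg_left (opNorm_one_kronecker_le α') hα))
  have h2 : opNorm ((((1 : Matrix (Fin l) (Fin l) ℂ) ⊗ₖ β') * β).submatrix φ id) ≤
      opNorm β' * opNorm β :=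
    (opNorm_submatrix_equiv _ φ (Equiv.refl _)).trans_le ((opNorm_mul_le _ _).trans
      (mul_le_mul_of_nonneg_right (opNorm_one_kronecker_le β') hβ))
  have h3 := sOne_conj_le hT x b
  have hx := sOne_nonneg l x
  have hb := ellOne_nonneg l' b
  have hw := hN m' w
  calc _ ≤ (opNorm α * opNorm α') * (sOne n l x * ellOne κ l' b) * N m' w *
        (opNorm β' * opNorm β) := by
        refine mul_le_mul (mul_le_mul_of_nonneg_right (mul_le_mul h1 h3 (sOne_nonneg _ _)
          (by positivity)) hw) h2 (opNorm_nonneg _) (by positivity)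
    _ = opNorm α * opNorm β * sOne n l x *
        (opNorm α' * ellOne κ l' b * N m' w * opNorm β') := by ring
    _ ≤ _ := mul_le_mul_of_nonneg_left hlt.le (by positivity)

variable {E : Type*} [NormedAddCommGroup E] [NormedSpace ℂ E]

/-- Each coordinate is x sandwiched between 1 ⊗ T_c and its adjoint, so Ruan's second axiom
suffices. -/
theorem ellInfty_twirlLevel_le (hT : IsUnitaryFamily T) {N : MatNorms E} (hN : IsOperatorSpace N)
    {k : ℕ} (x : Matrix (Fin k) (Fin k) (Matrix (Fin n) (Fin n) E)) :
    ellInfty κ N (k * n) (twirlLevel T E k x) ≤ sInfty n N k x := by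
  refine Real.iSup_le (fun c => ?_) (hN.nonneg _ _)
  open Kronecker in
  let U : Matrix (Fin (k * n)) (Fin (k * n)) ℂ :=
    reindex finProdFinEquiv finProdFinEquiv ((1 : Matrix (Fin k) (Fin k) ℂ) ⊗ₖ T c)
  have hU : opNorm U ≤ 1 := (opNorm_reindex _ _ _).trans_le
    ((opNorm_one_kronecker_le _).trans (hT.opNorm_le_one c))
  have hU' : opNorm Uᴴ ≤ 1 := (opNorm_conjTranspose U).trans_le hU
  have h : (twirlLevel T E k x).map (fun v => v c) = sandwich U (reindex finProdFinEquiv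
      finProdFinEquiv (comp (Fin k) (Fin k) (Fin n) (Fin n) E x)) Uᴴ := by
    ext i j
    obtain ⟨⟨r, i⟩, rfl⟩ := finProdFinEquiv.surjective i
    obtain ⟨⟨s, j⟩, rfl⟩ := finProdFinEquiv.surjective j
    rw [map_apply, twirlLevel_apply]
    change ∑ a, ∑ b, (T c i a * star (T c j b)) • x r s a b = _
    simp only [sandwich, of_apply, ← finProdFinEquiv.sum_comp, Fintype.sum_prod_type]
    rw [Finset.sum_eq_single r]
    rotate_left
    · intro r' _ hr'
      refine Finset.sum_eq_zero fun a _ => Finset.sum_eq_zero fun s' _ =>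
        Finset.sum_eq_zero fun b _ => ?_
      simp [U, one_apply_ne' hr']
    · simp
    refine Finset.sum_congr rfl fun a _ => ?_
    rw [Finset.sum_eq_single s]
    rotate_left
    · intro s' _ hs'
      refine Finset.sum_eq_zero fun b _ => ?_
      simp [U, one_apply_ne' hs']
    · simp
    simp [U]
  rw [h]
  refine (hN.sandwich_le _ _ _ _ _).trans ?_
  have h0 : 0 ≤ sInfty n N k x := hN.nonneg _ _
  calc _ ≤ 1 * sInfty n N k x * 1 :=
        mul_le_mul (mul_le_mul_of_nonneg_right hU h0) hU' (opNorm_nonneg _) (by simpa using h0)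
    _ = _ := by ring

/-- A complete contraction φ from E to matrices replaces E by scalars. Then `opNorm_sum_conj_le`
applies to the adjoint family T_c^* with Y_c = φ(y_c), followed by multiplication by α ⊗ 1 and β ⊗
1. -/
theorem sInfty_untwirlLevel_le (hT : IsUnitaryFamily T) {N : MatNorms E} (hN : IsOperatorSpace N)
    {k l m : ℕ} (α : Matrix (Fin k) (Fin l × Fin m) ℂ)
    (x : Matrix (Fin l) (Fin l) (Matrix (Fin n) (Fin n) ℂ))
    (β : Matrix (Fin l × Fin m) (Fin k) ℂ) (y : Matrix (Fin m) (Fin m) (κ → E)) :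
    sInfty n N k (untwirlLevel T E α x β y) ≤
      opNorm α * opNorm β * (n * sOne n l x) * ellInfty κ N m y := by
  have hα := opNorm_nonneg α
  have hβ := opNorm_nonneg β
  have hx := sOne_nonneg l x
  have hy := ellInfty_nonneg hN.nonneg y
  refine hN.le_of_forall_amplify_le _ (by positivity) fun φ hφ => ?_
  let K := Fin (k * n)
  let Y : κ → Matrix (Fin m × K) (Fin m × K) ℂ := fun c => amplify φ (y.map fun v => v c)
  have hY : ∀ c, opNorm (Y c) ≤ ellInfty κ N m y := fun c =>
    (hφ m _).trans (le_ellInfty N y c)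
  have key := hT.conjTranspose.opNorm_sum_conj_le (Equiv.refl (Fin l)) x Y hy hY
  set Z : Matrix ((Fin n × (Fin m × K)) × Fin l) ((Fin n × (Fin m × K)) × Fin l) ℂ :=
    of fun u v => ∑ c, ((T c)ᴴ * x u.2 v.2 * ((T c)ᴴ)ᴴ) u.1.1 v.1.1 * Y c u.1.2 v.1.2 with hZ
  let e : (Fin l × Fin m) × (Fin n × K) ≃ (Fin n × (Fin m × K)) × Fin l :=
    { toFun := fun a => ((a.2.1, (a.1.2, a.2.2)), a.1.1)
      invFun := fun a => ((a.2, a.1.2.1), (a.1.1, a.1.2.2))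
      left_inv := fun _ => rfl
      right_inv := fun _ => rfl }
  let e' : Fin (k * n) × K ≃ Fin k × (Fin n × K) :=
    (finProdFinEquiv.symm.prodCongr (Equiv.refl K)).trans (Equiv.prodAssoc _ _ _)
  open Kronecker in
  have h : amplify φ (reindex finProdFinEquiv finProdFinEquiv
      (comp (Fin k) (Fin k) (Fin n) (Fin n) E (untwirlLevel T E α x β y))) =
      ((α ⊗ₖ (1 : Matrix (Fin n × K) (Fin n × K) ℂ)) * Z.submatrix e e *
        (β ⊗ₖ (1 : Matrix (Fin n × K) (Fin n × K) ℂ))).submatrix e' e' := by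
    ext ⟨i, u⟩ ⟨j, v⟩
    obtain ⟨⟨r, i⟩, rfl⟩ := finProdFinEquiv.surjective i
    obtain ⟨⟨s, j⟩, rfl⟩ := finProdFinEquiv.surjective j
    have hl : amplify φ (reindex finProdFinEquiv finProdFinEquiv
        (comp (Fin k) (Fin k) (Fin n) (Fin n) E (untwirlLevel T E α x β y)))
        (finProdFinEquiv (r, i), u) (finProdFinEquiv (s, j), v) =
        ∑ a, ∑ c, α r a * Z.submatrix e e (a, (i, u)) (c, (j, v)) * β c s := by
      have h1 : ∀ (X : Matrix (Fin n) (Fin n) ℂ) (w : κ → E),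
          φ (untwirl T E (matTensor n (κ → E) X w) i j) u v =
            ∑ c, ((T c)ᴴ * X * T c) i j * φ (w c) u v := by
        intro X w
        rw [untwirl_matTensor, map_sum, Matrix.sum_apply]
        exact Finset.sum_congr rfl fun c _ => by rw [map_smul]; rfl
      simp only [amplify, of_apply, reindex_apply, submatrix_apply, comp_apply,
        Equiv.symm_apply_apply]
      change φ ((∑ a, ∑ c, (α r a * β c s) • untwirl T E (matTensor n (κ → E) (x a.1 c.1)
        (y a.2 c.2))) i j) u v = _
      simp only [Matrix.sum_apply, Matrix.smul_apply, map_sum, map_smul, h1, smul_eq_mul]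
      refine Finset.sum_congr rfl fun a _ => Finset.sum_congr rfl fun c _ => ?_
      simp only [hZ, e, Y, amplify, of_apply, Equiv.coe_fn_mk, map_apply,
        conjTranspose_conjTranspose]
      ring
    rw [hl]
    simp only [submatrix_apply, e', Equiv.trans_apply, Equiv.prodCongr_apply, Prod.map,
      Equiv.symm_apply_apply, Equiv.refl_apply, Equiv.prodAssoc_apply, mul_apply,
      Fintype.sum_prod_type (α₁ := Fin l × Fin m), kroneckerMap_apply, one_apply, mul_ite, mul_one,
      mul_zero, ite_mul, zero_mul, Finset.sum_ite_eq, Finset.sum_ite_eq', Finset.mem_univ, if_true,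
      Finset.sum_mul]
    rw [Finset.sum_comm]
  have hz : opNorm (Z.submatrix e e) ≤ n * sOne n l x * ellInfty κ N m y :=
    (opNorm_submatrix_equiv Z e e).trans_le key
  rw [h, opNorm_submatrix_equiv]
  refine (opNorm_mul_mul_le (opNorm_kronecker_one_le α) hz (opNorm_kronecker_one_le β)).trans ?_
  exact le_of_eq (by ring)

end Levels

end OpSp
end

noncomputable section

set_option linter.unusedSectionVars false

namespace OpSp

open Matrix

/-! ### Interpolated estimates for twirling and untwirling. -/

section Interpolated

attribute [local instance] Matrix.normedAddCommGroup Matrix.normedSpace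

theorem toReal_inv_mem_Icc {p : ℝ≥0∞} (hp : 1 ≤ p) : (p⁻¹).toReal ∈ Set.Icc (0 : ℝ) 1 :=
  ⟨ENNReal.toReal_nonneg, ENNReal.toReal_mono ENNReal.one_ne_top (ENNReal.inv_le_one.2 hp)⟩

variable {E : Type*} [NormedAddCommGroup E] [NormedSpace ℂ E] {N : MatNorms E} {n k : ℕ}
  {κ : Type} [Fintype κ] [DecidableEq κ] {p q : ℝ≥0∞}

/-- Makes the matrix norms continuous for the entrywise topology that governs analyticity in
`interp`. -/
theorem IsOperatorSpace.le_sum_norm (hN : IsOperatorSpace N) (x : Matrix (Fin k) (Fin k) E) :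
    N k x ≤ ∑ i, ∑ j, ‖x i j‖ := by
  have h : x = ∑ i, ∑ j, sandwich (of fun r _ => if r = i then 1 else 0)
      (of fun _ _ : Fin 1 => x i j) (of fun _ s => if s = j then 1 else 0) := by
    ext r s
    simp [sandwich, Matrix.sum_apply]
  have hc : ∀ i : Fin k, opNorm (of fun r (_ : Fin 1) => if r = i then (1 : ℂ) else 0) ≤ 1 :=
    fun i => opNorm_le_one_of_conjTranspose_mul_self (by
      ext a b
      obtain rfl := Subsingleton.elim a b
      simp [mul_apply])
  have hr : ∀ j : Fin k, opNorm (of fun (_ : Fin 1) s => if s = j then (1 : ℂ) else 0) ≤ 1 := by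
    intro j
    have e : (of fun (_ : Fin 1) s => if s = j then (1 : ℂ) else 0) =
        (of fun r (_ : Fin 1) => if r = j then (1 : ℂ) else 0)ᴴ := by
      ext a b
      simp [apply_ite]
    rw [e, opNorm_conjTranspose]
    exact hc j
  calc N k x ≤ ∑ i, ∑ j, N k (sandwich (of fun r _ => if r = i then 1 else 0)
      (of fun _ _ : Fin 1 => x i j) (of fun _ s => if s = j then 1 else 0)) := by
        conv_lhs => rw [h]
        have hs := Finset.le_sum_of_subadditive (N k) (hN.map_zero k).le (hN.add_le k)
          (Finset.univ : Finset (Fin k))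
        exact (hs _).trans (Finset.sum_le_sum fun i _ => hs _)
    _ ≤ _ := by
        refine Finset.sum_le_sum fun i _ => Finset.sum_le_sum fun j _ => ?_
        refine (hN.sandwich_le _ _ _ _ _).trans ?_
        rw [hN.one_eq]
        calc _ ≤ 1 * ‖x i j‖ * 1 := mul_le_mul (mul_le_mul_of_nonneg_right (hc i) (norm_nonneg _))
              (hr j) (opNorm_nonneg _) (by positivity)
          _ = _ := by ring

theorem sInfty_smul_le (hN : IsOperatorSpace N) (c : ℂ)
    (x : Matrix (Fin k) (Fin k) (Matrix (Fin n) (Fin n) E)) :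
    sInfty n N k (c • x) ≤ ‖c‖ * sInfty n N k x :=
  (hN.smul_eq (k * n) c _).le

theorem projNorms_sOne_smul_le {N : MatNorms E} (hN : ∀ l x, 0 ≤ N l x) (c : ℂ)
    (x : Matrix (Fin k) (Fin k) (Matrix (Fin n) (Fin n) E)) :
    projNorms (matTensor n E) (sOne n) N k (c • x) ≤
      ‖c‖ * projNorms (matTensor n E) (sOne n) N k x :=
  projNorms_smul_le (projSpanning_matTensor n E) sOne_nonneg hN c x

theorem ellInfty_smul_le (hN : IsOperatorSpace N) (c : ℂ) (x : Matrix (Fin k) (Fin k) (κ → E)) :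
    ellInfty κ N k (c • x) ≤ ‖c‖ * ellInfty κ N k x := by
  refine Real.iSup_le (fun d => ?_) (mul_nonneg (norm_nonneg _) (ellInfty_nonneg hN.nonneg _))
  refine (hN.smul_eq k c (x.map fun v => v d)).le.trans ?_
  exact mul_le_mul_of_nonneg_left (le_ellInfty N x d) (norm_nonneg c)

theorem ellV_smul_le (hN : IsOperatorSpace N) (c : ℂ) (x : Matrix (Fin k) (Fin k) (κ → E)) :
    ellV p κ N k (c • x) ≤ ‖c‖ * ellV p κ N k x :=
  interp_smul_le (N₀ := ellInfty κ N) (N₁ := projNorms (piTensor κ E) (ellOne κ) N)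
    (ellInfty_smul_le hN) (projNorms_smul_le (projSpanning_piTensor E) ellOne_nonneg hN.nonneg) c x

theorem ellV_nonneg (l : ℕ) (x : Matrix (Fin l) (Fin l) (κ → E)) : 0 ≤ ellV p κ N l x :=
  interp_nonneg _ _ _ x

theorem schattenV_nonneg {N : MatNorms E} (l : ℕ)
    (x : Matrix (Fin l) (Fin l) (Matrix (Fin n) (Fin n) E)) : 0 ≤ schattenV p n N l x :=
  interp_nonneg _ _ _ x

theorem schattenV_smul_le (hN : IsOperatorSpace N) (c : ℂ)
    (x : Matrix (Fin k) (Fin k) (Matrix (Fin n) (Fin n) E)) :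
    schattenV p n N k (c • x) ≤ ‖c‖ * schattenV p n N k x :=
  interp_smul_le (N₀ := sInfty n N) (sInfty_smul_le hN) (projNorms_sOne_smul_le hN.nonneg) c x

theorem schattenV_add_le (hN : IsOperatorSpace N)
    (x y : Matrix (Fin k) (Fin k) (Matrix (Fin n) (Fin n) E)) :
    schattenV p n N k (x + y) ≤ schattenV p n N k x + schattenV p n N k y := by
  refine interp_add_le (N₀ := sInfty n N) (N₁ := projNorms (matTensor n E) (sOne n) N) (fun x y => hN.add_le (k * n) _ _) (fun x y => ?_) x y
  exact projNorms_add_le (projSpanning_matTensor n E) sOne_nonneg hN.nonneg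
    (fun l c x => dualNorms_smul_le (pairingBounded_trace n) c x) (fun l c x => (hN.smul_eq l c x).le)
    (fun l m x y => dualNorms_directSum_le (pairingBounded_trace n) x y)
    (fun l m x y => (hN.directSum_eq l m x y).le) x y

/-- The matrix norms of `S_p^n[E]`, as seminorms. -/
def schattenVSeminorm (hN : IsOperatorSpace N) (p : ℝ≥0∞) (n k : ℕ) :
    Seminorm ℂ (Matrix (Fin k) (Fin k) (Matrix (Fin n) (Fin n) E)) :=
  Seminorm.ofSMulLE (schattenV p n N k)
    (le_antisymm (by simpa using schattenV_smul_le (p := p) (k := k) (n := n) hN 0 0)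
      (interp_nonneg _ _ _ _))
    (schattenV_add_le hN) (schattenV_smul_le hN)

/-- Supplies the continuity of the target norm demanded by `seminorm_le_interp`. -/
theorem schattenV_le_norm (hN : IsOperatorSpace N) (hn : 0 < n)
    (x : Matrix (Fin k) (Fin k) (Matrix (Fin n) (Fin n) E)) :
    schattenV p n N k x ≤ (n : ℝ) ^ (p⁻¹).toReal * ((k * n * (k * n) : ℕ) * ‖x‖) := by
  have h0 : sInfty n N k x ≤ (k * n * (k * n) : ℕ) * ‖x‖ := by
    refine (hN.le_sum_norm _).trans ?_
    refine (Finset.sum_le_sum fun i _ => Finset.sum_le_sum fun j _ =>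
      (?_ : _ ≤ ‖x‖)).trans (by simp [mul_assoc])
    exact (norm_entry_le_entrywise_sup_norm (x (finProdFinEquiv.symm i).1
      (finProdFinEquiv.symm j).1)).trans (norm_entry_le_entrywise_sup_norm _)
  refine interp_le_of_le (by positivity) (by exact_mod_cast hn) (sInfty_smul_le hN)
    (projNorms_sOne_smul_le hN.nonneg) h0 ?_
  exact (projNorms_le_sInfty hN.nonneg x).trans (mul_le_mul_of_nonneg_left h0 (Nat.cast_nonneg n))

theorem continuous_schattenVSeminorm (hN : IsOperatorSpace N) (hn : 0 < n) :
    Continuous (schattenVSeminorm hN p n k) := by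
  let C : NNReal := (n : NNReal) ^ (p⁻¹).toReal * (k * n * (k * n) : ℕ)
  refine Seminorm.continuous_of_le (q := C • normSeminorm ℂ _) ?_ fun x => ?_
  · exact continuous_norm.const_smul C
  · refine (schattenV_le_norm hN hn x).trans (le_of_eq ?_)
    simp only [C, _root_.smul_apply, coe_normSeminorm, NNReal.smul_def, NNReal.coe_mul,
      NNReal.coe_rpow, NNReal.coe_natCast, smul_eq_mul, mul_assoc]

section Maps

variable {T : κ → Matrix (Fin n) (Fin n) ℂ}

theorem continuous_twirlLevel : Continuous (twirlLevel T E k) := by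
  refine continuous_pi fun r => continuous_pi fun s => continuous_pi fun c => ?_
  change Continuous fun x : Matrix (Fin k) (Fin k) (Matrix (Fin n) (Fin n) E) =>
    ∑ a, ∑ b, (T c (finProdFinEquiv.symm r).2 a * star (T c (finProdFinEquiv.symm s).2 b)) •
      x (finProdFinEquiv.symm r).1 (finProdFinEquiv.symm s).1 a b
  fun_prop

theorem continuous_untwirl : Continuous (untwirl T E) := by
  refine continuous_pi fun i => continuous_pi fun j => ?_
  change Continuous fun y : Matrix (Fin n) (Fin n) (κ → E) =>
    ∑ c, ∑ a, ∑ b, (star (T c a i) * T c b j) • y a b c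
  fun_prop

theorem continuous_untwirlLevel {l m : ℕ} (α : Matrix (Fin k) (Fin l × Fin m) ℂ)
    (x : Matrix (Fin l) (Fin l) (Matrix (Fin n) (Fin n) ℂ))
    (β : Matrix (Fin l × Fin m) (Fin k) ℂ) : Continuous (untwirlLevel T E α x β) := by
  refine continuous_pi fun r => continuous_pi fun s => ?_
  change Continuous fun y : Matrix (Fin m) (Fin m) (κ → E) =>
    ∑ a : Fin l × Fin m, ∑ c : Fin l × Fin m,
      (α r a * β c s) • untwirl T E (matTensor n (κ → E) (x a.1 c.1) (y a.2 c.2))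
  have h : ∀ a c : Fin l × Fin m, Continuous fun y : Matrix (Fin m) (Fin m) (κ → E) =>
      matTensor n (κ → E) (x a.1 c.1) (y a.2 c.2) := fun a c => by
    refine continuous_pi fun i => continuous_pi fun j => ?_
    change Continuous fun y : Matrix (Fin m) (Fin m) (κ → E) => x a.1 c.1 i j • y a.2 c.2
    fun_prop
  exact continuous_finsetSum _ fun a _ => continuous_finsetSum _ fun c _ =>
    (continuous_untwirl.comp (h a c)).fun_const_smul _

/-- Interpolates the endpoint bounds 1 and n. As M_k[M_n[F]] is by definition M_{kn}[F], this is an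
estimate in M_n[ℓ_p[E]]. -/
theorem ellV_twirlLevel_le (hn : 0 < n) (hT : IsUnitaryFamily T) (hN : IsOperatorSpace N)
    (x : Matrix (Fin k) (Fin k) (Matrix (Fin n) (Fin n) E)) :
    ellV p κ N (k * n) (twirlLevel T E k x) ≤ (n : ℝ) ^ (p⁻¹).toReal * schattenV p n N k x := by
  have h := interp_map_le (θ := (p⁻¹).toReal) (T := twirlLevel T E k) continuous_twirlLevel
    zero_le_one (a := n) (by exact_mod_cast hn) (N₀ := sInfty n N) (N₀' := ellInfty κ N)
    (N₁ := projNorms (matTensor n E) (sOne n) N) (N₁' := projNorms (piTensor κ E) (ellOne κ) N)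
    (ellInfty_smul_le hN) (projNorms_smul_le (projSpanning_piTensor E) ellOne_nonneg hN.nonneg)
    (fun x => by rw [one_mul]; exact ellInfty_twirlLevel_le hT hN x)
    (fun x => by rw [one_mul]; exact projNorms_twirlLevel_le hT hN.nonneg x) x
  rwa [one_mul] at h

/-- With F = ℓ_p[E], the S_1^n ⊗^ F norm is at most n times the M_n[F] norm, so passing from M_n[F]
to S_q^n[F] costs n^(1/q). -/
theorem schattenV_twirl_le (hn : 0 < n) (hT : IsUnitaryFamily T) (hN : IsOperatorSpace N)
    (x : Matrix (Fin k) (Fin k) (Matrix (Fin n) (Fin n) E)) :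
    schattenV q n (ellV p κ N) k (x.map (twirl T E)) ≤
      (n : ℝ) ^ (q⁻¹).toReal * ((n : ℝ) ^ (p⁻¹).toReal * schattenV p n N k x) := by
  have h0 : sInfty n (ellV p κ N) k (x.map (twirl T E)) ≤
      (n : ℝ) ^ (p⁻¹).toReal * schattenV p n N k x := ellV_twirlLevel_le hn hT hN x
  refine interp_le_of_le (mul_nonneg (by positivity) (interp_nonneg _ _ _ _))
    (by exact_mod_cast hn) (fun c y => ?_) (projNorms_sOne_smul_le ellV_nonneg) h0 ?_
  · exact ellV_smul_le hN c (reindex finProdFinEquiv finProdFinEquiv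
      (comp (Fin k) (Fin k) (Fin n) (Fin n) (κ → E) y))
  · exact (projNorms_le_sInfty ellV_nonneg _).trans
      (mul_le_mul_of_nonneg_left h0 (Nat.cast_nonneg n))

/-- For fixed α, x, β the two endpoint bounds in y are in the ratio n to 1, so D carries the factor
n and a = 1/n, giving n · n^(-1/p). -/
theorem schattenV_untwirlLevel_le (hn : 0 < n) (hT : IsUnitaryFamily T) (hN : IsOperatorSpace N)
    {l m : ℕ} (α : Matrix (Fin k) (Fin l × Fin m) ℂ)
    (x : Matrix (Fin l) (Fin l) (Matrix (Fin n) (Fin n) ℂ))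
    (β : Matrix (Fin l × Fin m) (Fin k) ℂ) (y : Matrix (Fin m) (Fin m) (κ → E)) :
    schattenV p n N k (untwirlLevel T E α x β y) ≤ (n : ℝ) ^ (1 - (p⁻¹).toReal) *
      (opNorm α * sOne n l x * ellV p κ N m y * opNorm β) := by
  have hn' : (0 : ℝ) < n := by exact_mod_cast hn
  have hα := opNorm_nonneg α
  have hβ := opNorm_nonneg β
  have hx := sOne_nonneg l x
  have h := interp_map_le (θ := (p⁻¹).toReal) (T := untwirlLevel T E α x β)
    (continuous_untwirlLevel α x β) (D := opNorm α * opNorm β * (n * sOne n l x)) (a := (n : ℝ)⁻¹)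
    (by positivity) (by positivity) (N₀' := sInfty n N) (N₀ := ellInfty κ N)
    (N₁' := projNorms (matTensor n E) (sOne n) N) (N₁ := projNorms (piTensor κ E) (ellOne κ) N)
    (sInfty_smul_le hN) (projNorms_sOne_smul_le hN.nonneg)
    (sInfty_untwirlLevel_le hT hN α x β)
    (fun y => (projNorms_untwirlLevel_le hT hN.nonneg α x β y).trans_eq (by field_simp)) y
  refine h.trans_eq ?_
  rw [Real.rpow_sub hn', Real.rpow_one, Real.inv_rpow hn'.le]
  change _ * ellV p κ N m y = _
  ring

/-- On a representation α(x ⊗ y)β untwirling is `untwirlLevel` evaluated at y, so the infimum over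
representations turns the preceding bound into the endpoint q = 1. -/
theorem schattenV_untwirl_le_projNorms (hn : 0 < n) (hT : IsUnitaryFamily T)
    (hN : IsOperatorSpace N) (t : Matrix (Fin k) (Fin k) (Matrix (Fin n) (Fin n) (κ → E))) :
    schattenV p n N k (t.map (untwirl T E)) ≤ (n : ℝ) ^ (1 - (p⁻¹).toReal) *
      projNorms (matTensor n (κ → E)) (sOne n) (ellV p κ N) k t := by
  refine le_mul_of_forall_gt fun C hC => ?_
  obtain ⟨l, m, α, x, y, β, ht, hlt⟩ :=
    exists_of_projNorms_lt (projSpanning_matTensor n (κ → E)) hC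
  have e : t.map (untwirl T E) = untwirlLevel T E α x β y := by
    ext1 r s
    rw [map_apply, ht]
    simp only [map_sum, map_smul]
    rfl
  rw [e]
  exact (schattenV_untwirlLevel_le hn hT hN α x β y).trans
    (mul_le_mul_of_nonneg_left hlt.le (by positivity))

/-- Only the domain is interpolated, the target S_p^n[E] staying fixed, whence `seminorm_le_interp`.
The bound at q = 1 is n^(1-1/p); at q = ∞ it is n times larger, by `projNorms_le_sInfty`. -/
theorem schattenV_untwirl_le (hn : 0 < n) (hq : 1 ≤ q) (hT : IsUnitaryFamily T)
    (hN : IsOperatorSpace N) (t : Matrix (Fin k) (Fin k) (Matrix (Fin n) (Fin n) (κ → E))) :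
    schattenV p n N k (t.map (untwirl T E)) ≤ (n : ℝ) ^ (2 - (p⁻¹).toReal - (q⁻¹).toReal) *
      schattenV q n (ellV p κ N) k t := by
  have hn' : (0 : ℝ) < n := by exact_mod_cast hn
  have h1 := schattenV_untwirl_le_projNorms (p := p) (k := k) hn hT hN
  have hc : Continuous fun t : Matrix (Fin k) (Fin k) (Matrix (Fin n) (Fin n) (κ → E)) =>
      t.map (untwirl T E) :=
    continuous_pi fun r => continuous_pi fun s => continuous_untwirl.comp
      ((continuous_apply s).comp (continuous_apply r))
  have h := seminorm_le_interp (θ := (q⁻¹).toReal) (a := (n : ℝ)⁻¹)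
    (D := (n : ℝ) ^ (1 - (p⁻¹).toReal) * n) (N₀ := sInfty n (ellV p κ N))
    (N₁ := projNorms (matTensor n (κ → E)) (sOne n) (ellV p κ N))
    ((schattenVSeminorm hN p n k).comp (untwirl T E).mapMatrix)
    ((continuous_schattenVSeminorm hN hn).comp hc) (by positivity) (by positivity)
    (toReal_inv_mem_Icc hq)
    (fun t => (h1 t).trans ((mul_le_mul_of_nonneg_left (projNorms_le_sInfty ellV_nonneg t)
      (by positivity)).trans_eq (by ring)))
    (fun t => (h1 t).trans_eq (by field_simp)) t
  refine h.trans_eq ?_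
  rw [Real.rpow_sub hn', Real.rpow_sub hn', Real.rpow_sub hn', Real.rpow_one,
    Real.inv_rpow hn'.le, Real.rpow_two]
  change _ * schattenV q n (ellV p κ N) k t = _
  ring

end Maps

section Scalar

/-- S_1^n ⊗^ ℂ is S_1^n, so the scalar case of the theorem becomes the vector valued one at E = ℂ.
-/
theorem schattenV_scalarNorms (p : ℝ≥0∞) (n : ℕ) : schattenV p n scalarNorms = schatten p n := by
  have h := projNorms_scalar_eq_dualNorms (pairingBounded_trace n) (m := matTensor n ℂ)
    (fun v c => by ext i j; simp [matTensor, mul_comm])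
  unfold schattenV schatten
  change interp _ (projNorms (matTensor n ℂ) (dualNorms _ _) _) _ = _
  rw [h]
  rfl

theorem ellV_scalarNorms (p : ℝ≥0∞) (κ : Type) [Fintype κ] :
    ellV p κ scalarNorms = ell p κ := by
  have h := projNorms_scalar_eq_dualNorms (pairingBounded_sum κ) (m := piTensor κ ℂ)
    (fun v c => by ext i; simp [piTensor, mul_comm])
  unfold ellV ell
  change interp _ (projNorms (piTensor κ ℂ) (dualNorms _ _) _) _ = _
  rw [h]
  rfl

end Scalar

end Interpolated

end OpSp
end

noncomputable section

namespace OpSp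

open Matrix

/-! ### Contractive retractions and the normalised twirling maps. -/

section Retraction

variable {V V' : Type*} [AddCommGroup V] [Module ℂ V] [AddCommGroup V'] [Module ℂ V']
  {N : MatNorms V} {N' : MatNorms V'} {J : V →ₗ[ℂ] V'} {W : V' →ₗ[ℂ] V}

theorem IsCompleteContraction.comp (hJ : IsCompleteContraction N N' J)
    (hW : IsCompleteContraction N' N W) : IsCompleteContraction N' N' (J ∘ₗ W) :=
  fun k y => (hJ k (y.map W)).trans (hW k y)

/-- The reverse inequality holds because x = W(Jx) is no larger than Jx. -/
theorem IsCompleteContraction.isCompleteIsometry (hJ : IsCompleteContraction N N' J)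
    (hW : IsCompleteContraction N' N W) (hWJ : W ∘ₗ J = LinearMap.id) :
    IsCompleteIsometry N N' J := by
  refine fun k x => (hJ k x).antisymm ?_
  have e : (x.map J).map W = x := by
    ext1 i j
    exact LinearMap.congr_fun hWJ (x i j)
  exact (congrArg (N k) e).symm.le.trans (hW k (x.map J))

theorem isProj_range_of_comp_eq_id (hWJ : W ∘ₗ J = LinearMap.id) :
    LinearMap.IsProj (LinearMap.range J) (J ∘ₗ W) where
  map_mem y := ⟨W y, rfl⟩
  map_id := by
    rintro _ ⟨x, rfl⟩
    exact congrArg J (LinearMap.congr_fun hWJ x)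

end Retraction

section Teleportation

set_option linter.unusedSectionVars false

variable {n : ℕ} {κ : Type} [Fintype κ] [DecidableEq κ] {T : κ → Matrix (Fin n) (Fin n) ℂ}
  {E : Type*} [NormedAddCommGroup E] [NormedSpace ℂ E] {N : MatNorms E} {p q : ℝ≥0∞}

theorem isCompleteContraction_smul_twirl (hn : 0 < n) (hT : IsUnitaryFamily T)
    (hN : IsOperatorSpace N) {a : ℝ} (ha : 0 ≤ a)
    (ha' : a * (n : ℝ) ^ ((p⁻¹).toReal + (q⁻¹).toReal) ≤ 1) :
    IsCompleteContraction (schattenV p n N) (schattenV q n (ellV p κ N))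
      ((a : ℂ) • twirl T E) := by
  intro k x
  have hn' : (0 : ℝ) < n := by exact_mod_cast hn
  have e : x.map ((a : ℂ) • twirl T E) = ((a : ℂ) • x).map (twirl T E) := by
    ext1 i j
    exact ((twirl T E).map_smul _ _).symm
  have h0 : 0 ≤ schattenV p n N k x := schattenV_nonneg k x
  rw [e]
  refine (schattenV_twirl_le hn hT hN _).trans ?_
  calc _ ≤ (n : ℝ) ^ (q⁻¹).toReal * ((n : ℝ) ^ (p⁻¹).toReal * (a * schattenV p n N k x)) := by
        gcongr
        refine (schattenV_smul_le hN _ x).trans_eq ?_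
        rw [Complex.norm_real, Real.norm_of_nonneg ha]
    _ = a * (n : ℝ) ^ ((p⁻¹).toReal + (q⁻¹).toReal) * schattenV p n N k x := by
        rw [Real.rpow_add hn']; ring
    _ ≤ _ := mul_le_of_le_one_left h0 ha'

theorem isCompleteContraction_smul_untwirl (hn : 0 < n) (hq : 1 ≤ q) (hT : IsUnitaryFamily T)
    (hN : IsOperatorSpace N) {a : ℝ} (ha : 0 ≤ a)
    (ha' : a * (n : ℝ) ^ (2 - (p⁻¹).toReal - (q⁻¹).toReal) ≤ 1) :
    IsCompleteContraction (schattenV q n (ellV p κ N)) (schattenV p n N)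
      ((a : ℂ) • untwirl T E) := by
  intro k y
  have h0 : 0 ≤ schattenV q n (ellV p κ N) k y := schattenV_nonneg k y
  calc _ ≤ a * schattenV p n N k (y.map (untwirl T E)) := by
        refine (schattenV_smul_le hN (a : ℂ) (y.map (untwirl T E))).trans_eq ?_
        rw [Complex.norm_real, Real.norm_of_nonneg ha]
    _ ≤ a * ((n : ℝ) ^ (2 - (p⁻¹).toReal - (q⁻¹).toReal) * schattenV q n (ellV p κ N) k y) :=
        mul_le_mul_of_nonneg_left (schattenV_untwirl_le hn hq hT hN y) ha
    _ = a * (n : ℝ) ^ (2 - (p⁻¹).toReal - (q⁻¹).toReal) * schattenV q n (ellV p κ N) k y := by ring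
    _ ≤ _ := mul_le_of_le_one_left h0 ha'

theorem smul_untwirl_comp_smul_twirl (hT : IsUnitaryFamily T) {a b : ℂ}
    (h : a * b * Fintype.card κ = 1) :
    (a • untwirl T E) ∘ₗ (b • twirl T E) = LinearMap.id := by
  ext1 x
  change a • untwirl T E (b • twirl T E x) = x
  rw [map_smul, untwirl_twirl hT, smul_smul, smul_smul, h, one_smul]

theorem tensorIdOut_smul_twirl (a : ℂ) :
    tensorIdOut (a • twirl T ℂ) E = a • twirl T E := by
  ext x i j c
  change ∑ r, ∑ s, (a * ∑ r', ∑ s', (T c i r' * star (T c j s')) • single r s (1 : ℂ) r' s') •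
    x r s = a • ∑ r, ∑ s, (T c i r * star (T c j s)) • x r s
  simp only [Finset.smul_sum, smul_smul]
  refine Finset.sum_congr rfl fun r _ => Finset.sum_congr rfl fun s _ => ?_
  congr 2
  rw [Finset.sum_eq_single r (fun b _ hb => by simp [hb.symm]) (by simp),
    Finset.sum_eq_single s (fun b _ hb => by simp [hb.symm]) (by simp)]
  simp

theorem tensorIdIn_smul_untwirl (a : ℂ) :
    tensorIdIn (a • untwirl T ℂ) E = a • untwirl T E := by
  ext x i j
  change ∑ r, ∑ s, ∑ c, (a * ∑ c', ∑ r', ∑ s', (star (T c' r' i) * T c' s' j) •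
    (single r s (Pi.single c (1 : ℂ) : κ → ℂ) r' s' c')) • x r s c =
      a • ∑ c, ∑ r, ∑ s, (star (T c r i) * T c s j) • x r s c
  have h : ∀ r s c, ∑ c', ∑ r', ∑ s', (star (T c' r' i) * T c' s' j) •
      (single r s (Pi.single c (1 : ℂ) : κ → ℂ) r' s' c') = star (T c r i) * T c s j := by
    intro r s c
    rw [Finset.sum_eq_single c, Finset.sum_eq_single r, Finset.sum_eq_single s]
    · simp
    · intro b _ hb
      simp [hb.symm]
    · simp
    · intro b _ hb
      simp [hb.symm]
    · simp
    · intro b _ hb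
      refine Finset.sum_eq_zero fun r' _ => Finset.sum_eq_zero fun s' _ => ?_
      rw [single_apply]
      split_ifs <;> simp [hb]
    · simp
  simp only [h, Finset.smul_sum, smul_smul]
  rw [Finset.sum_congr rfl fun r _ => Finset.sum_comm, Finset.sum_comm]

end Teleportation

/-! ### Complete positivity. -/

section Positivity

open scoped ComplexOrder

variable {n : ℕ} {κ : Type}

/-- Each coordinate is conjugation by 1 ⊗ T_c, which preserves positive semidefiniteness for any
T_c. -/
theorem isCompletelyPositive_smul_twirl (T : κ → Matrix (Fin n) (Fin n) ℂ) {a : ℝ} (ha : 0 ≤ a) :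
    IsCompletelyPositive (matCone n) (matEllCone n κ) ((a : ℂ) • twirl T ℂ) := by
  intro k x hx c
  have hx : (comp (Fin k) (Fin k) (Fin n) (Fin n) ℂ x).PosSemidef := hx
  open Kronecker in
  have e : ((comp (Fin k) (Fin k) (Fin n) (Fin n) (κ → ℂ) (x.map ⇑((a : ℂ) • twirl T ℂ))).map
      fun v => v c) = (a : ℂ) • (((1 : Matrix (Fin k) (Fin k) ℂ) ⊗ₖ T c) *
        comp (Fin k) (Fin k) (Fin n) (Fin n) ℂ x * ((1 : Matrix (Fin k) (Fin k) ℂ) ⊗ₖ T c)ᴴ) := by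
    ext ⟨r, i⟩ ⟨s, j⟩
    change a * ∑ u, ∑ v, (T c i u * star (T c j v)) • x r s u v = _
    simp only [Matrix.smul_apply, mul_apply, conjTranspose_apply, kroneckerMap_apply,
      Fintype.sum_prod_type, one_apply, comp_apply, ite_mul, one_mul, zero_mul, apply_ite star,
      star_zero, mul_ite, mul_zero, Finset.sum_ite_irrel, Finset.sum_const_zero,
      Finset.sum_ite_eq, Finset.mem_univ, if_true, Finset.sum_mul, smul_eq_mul]
    rw [Finset.sum_comm]
    congr 1
    exact Finset.sum_congr rfl fun u _ => Finset.sum_congr rfl fun v _ => by ring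
  rw [e]
  exact (hx.mul_mul_conjTranspose_same _).smul (by exact_mod_cast ha)

theorem isCompletelyPositive_smul_untwirl [Fintype κ] (T : κ → Matrix (Fin n) (Fin n) ℂ) {a : ℝ} (ha : 0 ≤ a) :
    IsCompletelyPositive (matEllCone n κ) (matCone n) ((a : ℂ) • untwirl T ℂ) := by
  intro k y hy
  have hy : ∀ c, ((comp (Fin k) (Fin k) (Fin n) (Fin n) (κ → ℂ) y).map fun v => v c).PosSemidef :=
    hy
  open Kronecker in
  have e : comp (Fin k) (Fin k) (Fin n) (Fin n) ℂ (y.map ⇑((a : ℂ) • untwirl T ℂ)) =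
      (a : ℂ) • ∑ c, ((1 : Matrix (Fin k) (Fin k) ℂ) ⊗ₖ T c)ᴴ *
        ((comp (Fin k) (Fin k) (Fin n) (Fin n) (κ → ℂ) y).map fun v => v c) *
          ((1 : Matrix (Fin k) (Fin k) ℂ) ⊗ₖ T c) := by
    ext ⟨r, i⟩ ⟨s, j⟩
    change a * ∑ c, ∑ u, ∑ v, (star (T c u i) * T c v j) • y r s u v c = _
    simp only [Matrix.smul_apply, Matrix.sum_apply, mul_apply, conjTranspose_apply,
      kroneckerMap_apply, Fintype.sum_prod_type, one_apply, comp_apply, map_apply, ite_mul, one_mul,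
      zero_mul, apply_ite star, star_zero, mul_ite, mul_zero, Finset.sum_ite_irrel,
      Finset.sum_const_zero, Finset.sum_ite_eq', Finset.mem_univ, if_true,
      Finset.sum_mul, smul_eq_mul]
    congr 1
    refine Finset.sum_congr rfl fun c _ => ?_
    rw [Finset.sum_comm]
    exact Finset.sum_congr rfl fun u _ => Finset.sum_congr rfl fun v _ => by ring
  change (comp (Fin k) (Fin k) (Fin n) (Fin n) ℂ _).PosSemidef
  rw [e]
  exact (posSemidef_sum _ fun c _ => (hy c).conjTranspose_mul_mul_same _).smul
    (by exact_mod_cast ha)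

end Positivity

/-! ### The clock and shift unitaries. -/

section Weyl

variable {n : ℕ}

theorem weyl_apply (k l i j : Fin n) : weyl n k l i j =
    if i = l + j then Complex.exp (2 * Real.pi * Complex.I * (-(k : ℕ) * (j : ℕ)) / n) else 0 := by
  rw [weyl, clock, mul_diagonal, shift, of_apply, ite_mul, one_mul, zero_mul]
  congr 3
  push_cast
  ring

/-- Column a of T_{k,l} has its only nonzero entry in row l + a, so a single term of the matrix
product survives. -/
theorem conjTranspose_weyl_mul_weyl_apply (k l k' l' a b : Fin n) :
    ((weyl n k l)ᴴ * weyl n k' l') a b = if l + a = l' + b then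
      Complex.exp (2 * Real.pi * Complex.I * ((k : ℕ) * (a : ℕ) - (k' : ℕ) * (b : ℕ)) / n)
    else 0 := by
  rw [mul_apply, Finset.sum_eq_single (l + a)]
  · simp only [conjTranspose_apply, weyl_apply, if_true]
    split_ifs
    · rw [← starRingEnd_apply, ← Complex.exp_conj, ← Complex.exp_add]
      congr 1
      simp [map_ofNat]
      ring
    · simp
  · intro i _ hi
    simp [weyl_apply, hi]
  · simp

/-- A full geometric sum of an n-th root of unity other than 1. -/
theorem sum_exp_mul_eq_zero {m : ℤ} (hm : ¬ (n : ℤ) ∣ m) (hn : 0 < n) :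
    ∑ a : Fin n, Complex.exp (2 * Real.pi * Complex.I * (m * (a : ℕ)) / n) = 0 := by
  have hn' : (n : ℂ) ≠ 0 := by exact_mod_cast hn.ne'
  set z := Complex.exp (2 * Real.pi * Complex.I * m / n) with hz
  have hz1 : z ≠ 1 := by
    intro h
    obtain ⟨r, hr⟩ := Complex.exp_eq_one_iff.1 h
    refine hm ⟨r, ?_⟩
    rw [div_eq_iff hn'] at hr
    have h2 : (2 * Real.pi * Complex.I : ℂ) * m = (2 * Real.pi * Complex.I) * (n * r) := by
      rw [hr]; ring
    exact_mod_cast mul_left_cancel₀ Complex.two_pi_I_ne_zero h2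
  have hzn : z ^ n = 1 := by
    rw [hz, ← Complex.exp_nat_mul, Complex.exp_eq_one_iff]
    exact ⟨m, by field_simp⟩
  have h : ∀ a : Fin n, Complex.exp (2 * Real.pi * Complex.I * (m * (a : ℕ)) / n) = z ^ (a : ℕ) := by
    intro a
    rw [hz, ← Complex.exp_nat_mul]
    congr 1
    ring
  simp only [h]
  rw [Fin.sum_univ_eq_sum_range (fun a => z ^ a), geom_sum_eq hz1, hzn, sub_self, zero_div]

theorem isUnitaryFamily_weyl (hn : 0 < n) :
    IsUnitaryFamily fun c : Fin n × Fin n => weyl n c.1 c.2 := by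
  have : NeZero n := ⟨hn.ne'⟩
  constructor
  · rintro ⟨k, l⟩
    ext a b
    rw [conjTranspose_weyl_mul_weyl_apply, one_apply]
    by_cases hab : a = b
    · simp [hab]
    · simp [hab]
  · rintro ⟨k, l⟩ ⟨k', l'⟩
    simp only [trace, diag_apply, conjTranspose_weyl_mul_weyl_apply, add_left_inj, ← sub_mul]
    by_cases hl : l = l'
    · subst hl
      by_cases hk : k = k'
      · subst hk
        simp
      · have h := sum_exp_mul_eq_zero (m := (k : ℕ) - (k' : ℕ)) (fun hd => hk ?_) hn
        · simp only [if_true, Prod.mk.injEq, hk, false_and, if_false]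
          rw [← h]
          push_cast
          rfl
        · have hk1 := k.isLt
          have hk2 := k'.isLt
          -- |k - k'| < n, so divisibility by n forces k = k'.
          have := Int.eq_zero_of_abs_lt_dvd hd (by rw [abs_lt]; omega)
          exact Fin.ext (by omega)
    · simp [hl]

theorem teleport_eq_smul_twirl (n : ℕ) (p q : ℝ≥0∞) : teleport n p q =
    (((n : ℝ) ^ (1 - (p⁻¹).toReal - (q⁻¹).toReal) * (1 / (n : ℝ)) : ℝ) : ℂ) •
      twirl (fun c : Fin n × Fin n => weyl n c.1 c.2) ℂ := by
  ext1 ρ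
  ext i j c
  change _ * (weyl n c.1 c.2 * ρ * (weyl n c.1 c.2)ᴴ) i j =
    _ * ∑ a, ∑ b, (weyl n c.1 c.2 i a * star (weyl n c.1 c.2 j b)) • ρ a b
  congr 1
  simp only [mul_apply, conjTranspose_apply, Finset.sum_mul, smul_eq_mul]
  rw [Finset.sum_comm]
  exact Finset.sum_congr rfl fun u _ => Finset.sum_congr rfl fun v _ => by ring

end Weyl

end OpSp
end

/-! ### Normalisation and assembly. -/

theorem corollary1p2 (n : ℕ) (hn : 0 < n) (p q : ℝ≥0∞) (hp : 1 ≤ p) (hq : 1 ≤ q) :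
    OpSp.IsCompletelyPositive (OpSp.matCone n) (OpSp.matEllCone n (Fin n × Fin n))
      (OpSp.teleport n p q) ∧
    ∃ W : Matrix (Fin n) (Fin n) (Fin n × Fin n → ℂ) →ₗ[ℂ] Matrix (Fin n) (Fin n) ℂ,
      -- complete positivity of the retraction `W` and of the projection `J W`
      OpSp.IsCompletelyPositive (OpSp.matEllCone n (Fin n × Fin n)) (OpSp.matCone n) W ∧
      OpSp.IsCompletelyPositive (OpSp.matEllCone n (Fin n × Fin n))
        (OpSp.matEllCone n (Fin n × Fin n)) (OpSp.teleport n p q ∘ₗ W) ∧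
      -- the scalar case
      W ∘ₗ OpSp.teleport n p q = LinearMap.id ∧
      LinearMap.IsProj (LinearMap.range (OpSp.teleport n p q)) (OpSp.teleport n p q ∘ₗ W) ∧
      OpSp.IsCompleteIsometry (OpSp.schatten p n)
        (OpSp.schattenV q n (OpSp.ell p (Fin n × Fin n))) (OpSp.teleport n p q) ∧
      OpSp.IsCompleteContraction (OpSp.schattenV q n (OpSp.ell p (Fin n × Fin n)))
        (OpSp.schatten p n) W ∧
      OpSp.IsCompleteContraction (OpSp.schattenV q n (OpSp.ell p (Fin n × Fin n)))
        (OpSp.schattenV q n (OpSp.ell p (Fin n × Fin n))) (OpSp.teleport n p q ∘ₗ W) ∧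
      -- the vector valued case
      ∀ (E : Type*) [NormedAddCommGroup E] [NormedSpace ℂ E] [CompleteSpace E]
        (N : OpSp.MatNorms E), OpSp.IsOperatorSpace N →
        OpSp.tensorIdIn W E ∘ₗ OpSp.tensorIdOut (OpSp.teleport n p q) E = LinearMap.id ∧
        LinearMap.IsProj (LinearMap.range (OpSp.tensorIdOut (OpSp.teleport n p q) E))
          (OpSp.tensorIdOut (OpSp.teleport n p q) E ∘ₗ OpSp.tensorIdIn W E) ∧
        OpSp.IsCompleteIsometry (OpSp.schattenV p n N)
          (OpSp.schattenV q n (OpSp.ellV p (Fin n × Fin n) N))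
          (OpSp.tensorIdOut (OpSp.teleport n p q) E) ∧
        OpSp.IsCompleteContraction (OpSp.schattenV q n (OpSp.ellV p (Fin n × Fin n) N))
          (OpSp.schattenV p n N) (OpSp.tensorIdIn W E) ∧
        OpSp.IsCompleteContraction (OpSp.schattenV q n (OpSp.ellV p (Fin n × Fin n) N))
          (OpSp.schattenV q n (OpSp.ellV p (Fin n × Fin n) N))
          (OpSp.tensorIdOut (OpSp.teleport n p q) E ∘ₗ OpSp.tensorIdIn W E) := by
  have hn' : (0 : ℝ) < n := by exact_mod_cast hn
  have hT := OpSp.isUnitaryFamily_weyl hn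
  rw [OpSp.teleport_eq_smul_twirl]
  set s := (p⁻¹).toReal
  set t := (q⁻¹).toReal
  set a : ℝ := (n : ℝ) ^ (1 - s - t) * (1 / (n : ℝ)) with ha
  -- The reciprocal of the bound for `untwirl`, just as a = n^(-(s+t)) is that of the bound for
  -- `twirl`. Their product n^(-2) cancels the number n² of unitaries, so W ∘ J is the identity.
  let b : ℝ := (n : ℝ) ^ (s + t - 2)
  have ha0 : 0 ≤ a := by positivity
  have hb0 : 0 ≤ b := by positivity
  have ha' : a = (n : ℝ) ^ (-(s + t)) := by
    rw [ha, one_div, ← Real.rpow_neg_one, ← Real.rpow_add hn']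
    congr 1
    ring
  have ha1 : a * (n : ℝ) ^ (s + t) ≤ 1 := by
    rw [ha', ← Real.rpow_add hn', neg_add_cancel, Real.rpow_zero]
  have hb1 : b * (n : ℝ) ^ (2 - s - t) ≤ 1 := by
    rw [← Real.rpow_add hn', show s + t - 2 + (2 - s - t) = 0 by ring, Real.rpow_zero]
  have hba : (b : ℂ) * a * Fintype.card (Fin n × Fin n) = 1 := by
    have h : b * a * (n * n) = 1 := by
      rw [ha', ← Real.rpow_add hn', show s + t - 2 + -(s + t) = -2 by ring, Real.rpow_neg hn'.le,
        Real.rpow_two]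
      field_simp
    rw [Fintype.card_prod, Fintype.card_fin]
    exact_mod_cast h
  have hJ := OpSp.isCompletelyPositive_smul_twirl (fun c : Fin n × Fin n => OpSp.weyl n c.1 c.2) ha0
  have hW := OpSp.isCompletelyPositive_smul_untwirl (fun c : Fin n × Fin n => OpSp.weyl n c.1 c.2)
    hb0
  have hJ1 := OpSp.isCompleteContraction_smul_twirl (p := p) (q := q) hn hT
    OpSp.isOperatorSpace_scalarNorms ha0 ha1
  have hW1 := OpSp.isCompleteContraction_smul_untwirl (p := p) (q := q) hn hq hT
    OpSp.isOperatorSpace_scalarNorms hb0 hb1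
  rw [OpSp.schattenV_scalarNorms, OpSp.ellV_scalarNorms] at hJ1 hW1
  have hid := OpSp.smul_untwirl_comp_smul_twirl (E := ℂ) hT hba
  refine ⟨hJ, (b : ℂ) • OpSp.untwirl (fun c : Fin n × Fin n => OpSp.weyl n c.1 c.2) ℂ, hW,
    fun k y hy => hJ k _ (hW k y hy), hid, OpSp.isProj_range_of_comp_eq_id hid,
    hJ1.isCompleteIsometry hW1 hid, hW1, hJ1.comp hW1, ?_⟩
  intro E _ _ _ N hN
  rw [OpSp.tensorIdIn_smul_untwirl, OpSp.tensorIdOut_smul_twirl]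
  have hidE := OpSp.smul_untwirl_comp_smul_twirl (E := E) hT hba
  have hJE := OpSp.isCompleteContraction_smul_twirl (p := p) (q := q) hn hT hN ha0 ha1
  have hWE := OpSp.isCompleteContraction_smul_untwirl (p := p) (q := q) hn hq hT hN hb0 hb1
  exact ⟨hidE, OpSp.isProj_range_of_comp_eq_id hidE, hJE.isCompleteIsometry hWE hidE, hWE,
    hJE.comp hWE⟩
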